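/- **Conventions.** $\alpha\odot\beta=\tfrac12(\alpha\otimes\beta+\beta\otimes\alpha)$ and $\alpha\wedge\beta=\tfrac12(\alpha\otimes\beta-\beta\otimes\alpha)$ for one-forms; the summation convention is used. **Setting.** Let $N$ be a smooth (Hausdorff, second countable) manifold of dimension $n\ge 2$ with a projective structure $[\nabla]$: a full class of smooth torsion-free affine connections, any two of which are related by $\overline\nabla_XY=\nabla_XY+\Upsilon(X)Y+\Upsilon(Y)X$ for a smooth one-form $\Upsilon$. For $\nabla\in[\nabla]$ with $\nabla_{\partial_i}\partial_j=\Gamma^k_{ij}\partial_k$ and Ricci tensor $R_{ij}$ ($\mathrm{Ric}(Y,Z)=\operatorname{tr}(X\mapsto R(X,Y)Z)$), the Schouten tensor $\mathrm P_{ij}$ is given by $\mathrm P_{(ij)}=\frac1{n-1}R_{(ij)}$ and $\mathrm P_{[ij]}=\frac1{n+1}R_{[ij]}$. Let $\mathcal E(1)$ be the line bundle whose elements at $p$ are the functions $f:\Lambda^nT_p^*N\to\mathbb R$ with $f(c\eta)=|c|^{1/(n+1)}f(\eta)$ for all $c\in\mathbb R$. The cotractor bundle $\mathcal T^*\to N$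 is the rank $n+1$ vector bundle whose elements $V$ are represented, for each $\nabla\in[\nabla]$, by pairs $[V]_\nabla=(\sigma,\mu)\in\mathcal E(1)\oplus T^*N\otimes\mathcal E(1)$, with $[V]_{\overline\nabla}=(\sigma,\mu+\sigma\Upsilon)$. The canonical tractor $X$ is the projection $X\lrcorner V=\sigma$, with kernel $T^*N(1)=T^*N\otimes\mathcal E(1)$. The tractor connection is $\nabla^{\mathcal T}_i(\sigma,\mu_j)=(\nabla_i\sigma-\mu_i,\ \nabla_i\mu_j+\mathrm P_{ij}\sigma)$. On the total space of $\mathcal T^*$, with bundle projection $\pi:\mathcal T^*\to N$, put $\tau(U)=X\lrcorner U$. Let $\kappa:U\mapsto[U]$ be the fibrewise projectivisation and let $M=\mathbb P(\mathcal T^*)\setminus\mathcal Z(\tau)$ be the complement of the zero locus of $\tau$, a manifold of dimension $2n$. The tractor connection splits $T_U(\mathcal T^*)$ into its horizontal subspace, identified with $T_{\pi(U)}N$ by $\pi_*$, and the vertical subspace, identified with the fibre $\mathcal T^*_{\pi(U)}$. Where $\tau(U)\neq0$, the pairing of $v\in T_{\pi(U)}N$ with $W\in\mathcal T^*_{\pi(U)}$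 is the real number $$\langle v,W\rangle_U=\frac1{\tau(U)}\;v\lrcorner\Big(W-\frac{\tau(W)}{\tau(U)}\,U\Big),$$ in which the bracket lies in $T^*N(1)$. **Theorem.** On $M$ there are a unique covariant $2$-tensor $g$ and a unique covariant $2$-tensor $\Omega$ such that, for all $U$ with $\tau(U)\ne0$, all horizontal $h_1,h_2\in T_U(\mathcal T^*)$ and all vertical $W_1,W_2$, $$g\big(\kappa_*(h_1+W_1),\kappa_*(h_2+W_2)\big)=\tfrac12\big(\langle\pi_*h_1,W_2\rangle_U+\langle\pi_*h_2,W_1\rangle_U\big),$$ $$\Omega\big(\kappa_*(h_1+W_1),\kappa_*(h_2+W_2)\big)=\tfrac12\big(\langle\pi_*h_1,W_2\rangle_U-\langle\pi_*h_2,W_1\rangle_U\big).$$ Moreover: 1. $g$ is a smooth pseudo-Riemannian metric of neutral signature $(n,n)$. It is Einstein, and its scalar curvature is a non-zero constant. 2. $\Omega$ is a symplectic form. 3. For every $\nabla\in[\nabla]$ and every chart $(x^i)$ of $N$, in the coordinates $(x^i,\xi_i)$ on $M$ in which the class of $U$, with $[U]_\nabla=(\sigma,\mu)$, has $\xi_i=\mu_i/\sigma$,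 $$g=\big(d\xi_j-(\Gamma^k_{ij}\xi_k-\xi_i\xi_j-\mathrm P_{(ij)})\,dx^i\big)\odot dx^j,\qquad \Omega=-\big(d\xi_i\wedge dx^i+\mathrm P_{[ij]}\,dx^i\wedge dx^j\big).$$ -/

import Mathlib

open Set Bundle
open scoped Manifold ContDiff

noncomputable section

namespace TractorGeometry

/-! ### Coordinate calculus -/

section Coordinates

variable {ι : Type*} [Fintype ι] [DecidableEq ι]

/-- The partial derivative `∂f/∂yⁱ` at `y`. -/
def pd (i : ι) (f : (ι → ℝ) → ℝ) (y : ι → ℝ) : ℝ := fderiv ℝ f y (Pi.single i 1)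

/-- The Ricci tensor of connection coefficients `Γ i j k = Γᵏᵢⱼ`, where `∇_∂ᵢ ∂ⱼ = Γᵏᵢⱼ ∂ₖ`:
the components `Rᵢⱼ = ∂ₖΓᵏᵢⱼ - ∂ᵢΓᵏₖⱼ + ΓᵏₖₗΓˡᵢⱼ - ΓᵏᵢₗΓˡₖⱼ` of
`Ric(Y, Z) = tr (X ↦ R(X, Y) Z)`. -/
def ricciOf (Γ : ι → ι → ι → (ι → ℝ) → ℝ) (i j : ι) (y : ι → ℝ) : ℝ :=
  ∑ k, (pd k (Γ i j k) y - pd i (Γ k j k) y)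
    + ∑ k, ∑ l, (Γ k l k y * Γ i j l y - Γ i l k y * Γ k j l y)

variable {X : Type*} [TopologicalSpace X] [ChartedSpace (ι → ℝ) X]

/-- The `i`-th coordinate vector field `∂ᵢ` of a chart `e` (meaningful on the domain of `e`). -/
def coordField (e : OpenPartialHomeomorph X (ι → ℝ)) (i : ι) (q : X) :
    TangentSpace 𝓘(ℝ, ι → ℝ) q :=
  mfderiv 𝓘(ℝ, ι → ℝ) 𝓘(ℝ, ι → ℝ) e.symm (e q) (Pi.single i 1 : ι → ℝ)

end Coordinates

/-- The coordinate space `ℝⁿ`. -/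
abbrev Rn (n : ℕ) : Type := Fin n → ℝ

section Projective

variable {n : ℕ} {N : Type*} [TopologicalSpace N] [ChartedSpace (Rn n) N]

variable (n) in
/-- The tangent space `T_pN`. -/
abbrev TN (p : N) : Type := TangentSpace 𝓘(ℝ, Rn n) p

/-- The coordinate differential `dxʲ` of a chart `e` at `p`. -/
def coordForm (e : OpenPartialHomeomorph N (Rn n)) (j : Fin n) (p : N) : TN n p →ₗ[ℝ] ℝ :=
  (LinearMap.proj j : Rn n →ₗ[ℝ] ℝ).comp
    (mfderiv 𝓘(ℝ, Rn n) 𝓘(ℝ, Rn n) e p : TN n p →L[ℝ] Rn n).toLinearMap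

/-- The coordinate volume form `dx¹ ∧ ⋯ ∧ dxⁿ` of a chart `e` at `p`. -/
def coordVol (e : OpenPartialHomeomorph N (Rn n)) (p : N) : TN n p [⋀^Fin n]→ₗ[ℝ] ℝ :=
  (Pi.basisFun ℝ (Fin n)).det.compLinearMap
    (mfderiv 𝓘(ℝ, Rn n) 𝓘(ℝ, Rn n) e p : TN n p →L[ℝ] Rn n).toLinearMap

/-! ### Densities -/

variable (n) in
/-- The functions `f` on `ΛⁿT*_pN` with `f(cη) = |c|^{1/(n+1)} f(η)`. -/
def densitySubmodule (p : N) : Submodule ℝ ((TN n p [⋀^Fin n]→ₗ[ℝ] ℝ) → ℝ) where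
  carrier := {f | ∀ (c : ℝ) (η : TN n p [⋀^Fin n]→ₗ[ℝ] ℝ),
    f (c • η) = |c| ^ (1 / ((n : ℝ) + 1)) * f η}
  add_mem' := by
    intro f g hf hg c η
    simp only [Pi.add_apply, hf c η, hg c η]; ring
  zero_mem' := by intro c η; simp
  smul_mem' := by
    intro a f hf c η
    simp only [Pi.smul_apply, smul_eq_mul, hf c η]; ring

variable (n) in
/-- The fibre at `p` of the density bundle `𝓔(1)`, the `-2(n+1)`-th root of the square of the
canonical bundle `ΛⁿT*N`: a density of weight `1` is a function `f` on `ΛⁿT*_pN` with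
`f(cη) = |c|^{1/(n+1)} f(η)`. -/
def Density (p : N) : Type := densitySubmodule n p

instance (p : N) : AddCommGroup (Density n p) := inferInstanceAs (AddCommGroup (densitySubmodule n p))

instance (p : N) : Module ℝ (Density n p) := inferInstanceAs (Module ℝ (densitySubmodule n p))

namespace Density

variable {p : N}

/-- The value of a density on an `n`-form. -/
def eval (f : Density n p) (η : TN n p [⋀^Fin n]→ₗ[ℝ] ℝ) : ℝ := f.1 η

@[ext] theorem ext {f g : Density n p} (h : ∀ η, f.eval η = g.eval η) : f = g :=
  Subtype.ext (funext h)

theorem eval_smul_form (f : Density n p) (c : ℝ) (η : TN n p [⋀^Fin n]→ₗ[ℝ] ℝ) :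
    f.eval (c • η) = |c| ^ (1 / ((n : ℝ) + 1)) * f.eval η := f.2 c η

@[simp] theorem eval_add (f g : Density n p) (η) : (f + g).eval η = f.eval η + g.eval η := rfl

@[simp] theorem eval_smul (a : ℝ) (f : Density n p) (η) : (a • f).eval η = a * f.eval η := rfl

@[simp] theorem eval_zero (η) : (0 : Density n p).eval η = 0 := rfl

@[simp] theorem eval_sum {κ : Type*} (s : Finset κ) (f : κ → Density n p) (η) :
    (∑ i ∈ s, f i).eval η = ∑ i ∈ s, (f i).eval η :=
  map_sum (⟨⟨fun f : Density n p => f.eval η, rfl⟩, fun _ _ => rfl⟩ : Density n p →+ ℝ) f s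

end Density

variable (n) in
/-- The density at `p` with value `1` on forms with `η(b₁, …, bₙ) = 1`, for a frame `b`. -/
def frameDensity (p : N) (b : Fin n → TN n p) : Density n p :=
  ⟨fun η => |η b| ^ (1 / ((n : ℝ) + 1)), by
    intro c η
    simp only [AlternatingMap.smul_apply, smul_eq_mul, abs_mul]
    rw [Real.mul_rpow (abs_nonneg _) (abs_nonneg _)]⟩

@[simp] theorem frameDensity_eval (p : N) (b : Fin n → TN n p) (η) :
    (frameDensity n p b).eval η = |η b| ^ (1 / ((n : ℝ) + 1)) := rfl

variable (n) in
/-- The standard basis of `T_pN` (with `T_pN` identified with `ℝⁿ` by the preferred chart at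
`p`). -/
def stdBasis (p : N) : Module.Basis (Fin n) ℝ (TN n p) :=
  (Pi.basisFun ℝ (Fin n) : Module.Basis (Fin n) ℝ (Rn n))

variable (n) in
/-- A fixed nonzero element of `ΛⁿT*_pN`. -/
def stdVol (p : N) : TN n p [⋀^Fin n]→ₗ[ℝ] ℝ := (stdBasis n p).det

variable (n) in
/-- A fixed nonzero density at `p`. -/
def stdDensity (p : N) : Density n p := frameDensity n p (stdBasis n p)

/-- The quotient `a / b` of two elements of the line `𝓔(1)_p`, a real number (for `b ≠ 0` it does
not depend on the form used to evaluate). -/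
def Density.ratio {p : N} (a b : Density n p) : ℝ := a.eval (stdVol n p) / b.eval (stdVol n p)

theorem Density.eq_smul_frameDensity {p : N} (b : Module.Basis (Fin n) ℝ (TN n p))
    (f : Density n p) : f = f.eval b.det • frameDensity n p b := by
  ext η
  have h := f.eval_smul_form (η b) b.det
  rw [← AlternatingMap.eq_smul_basis_det] at h
  rw [h]
  simp [frameDensity_eval, mul_comm]

theorem stdDensity_stdVol (p : N) : (stdDensity n p).eval (stdVol n p) = 1 := by
  simp [stdDensity, stdVol, frameDensity_eval, Module.Basis.det_self]

theorem Density.eq_smul_std {p : N} (f : Density n p) :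
    f = f.eval (stdVol n p) • stdDensity n p :=
  Density.eq_smul_frameDensity (stdBasis n p) f

theorem Density.stdVol_ne {p : N} {f : Density n p} (h : f ≠ 0) : f.eval (stdVol n p) ≠ 0 := by
  intro h0
  apply h
  rw [Density.eq_smul_std f, h0, zero_smul]

/-! ### Connections and projective structures -/

variable [IsManifold 𝓘(ℝ, Rn n) ∞ N]

variable (n N) in
/-- A smooth torsion-free affine connection on `N`. -/
structure AffineConnection where
  /-- The covariant derivative; `cov Y p v` is `∇_v Y` at `p`. -/
  cov : CovariantDerivative 𝓘(ℝ, Rn n) (Rn n) (TangentSpace 𝓘(ℝ, Rn n) : N → Type)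
  smooth : cov.ContMDiffCovariantDerivative ∞
  torsion_free : cov.torsion = 0

/-- `∇'_v Y = ∇_v Y + Υ(v) Y + Υ(Y) v` for some smooth one-form `Υ`. -/
structure IsProjectiveChange (D D' : AffineConnection n N) (Υ : ∀ p : N, TN n p →L[ℝ] ℝ) :
    Prop where
  smooth : ContMDiff 𝓘(ℝ, Rn n) (𝓘(ℝ, Rn n).prod 𝓘(ℝ, Rn n →L[ℝ] ℝ)) ∞
    (fun p : N => TotalSpace.mk' (Rn n →L[ℝ] ℝ)
      (E := fun p : N => (TangentSpace 𝓘(ℝ, Rn n) p →L[ℝ] Bundle.Trivial N ℝ p)) p (Υ p))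
  change : ∀ (Y : ∀ p : N, TN n p) (p : N),
    MDifferentiableAt 𝓘(ℝ, Rn n) (𝓘(ℝ, Rn n).prod 𝓘(ℝ, Rn n))
      (fun q => (⟨q, Y q⟩ : TangentBundle 𝓘(ℝ, Rn n) N)) p →
    ∀ v : TN n p, D'.cov Y p v = D.cov Y p v + Υ p v • Y p + Υ p (Y p) • v

variable (n N) in
/-- A projective structure on `N`: a full projective equivalence class of smooth torsion-free
affine connections. -/
structure ProjectiveStructure where
  reps : Set (AffineConnection n N)
  nonempty : reps.Nonempty
  mem_iff : ∀ D ∈ reps, ∀ D', D' ∈ reps ↔ ∃ Υ, IsProjectiveChange D D' Υ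

/-- The connection coefficients `Γᵏᵢⱼ = dxᵏ(∇_∂ᵢ ∂ⱼ)` in a chart `e`, as functions of the
coordinates. -/
def christoffel (D : AffineConnection n N) (e : OpenPartialHomeomorph N (Rn n)) (i j k : Fin n)
    (x : Rn n) : ℝ :=
  coordForm e k (e.symm x) (D.cov (coordField e j) (e.symm x) (coordField e i (e.symm x)))

/-- The projective Schouten tensor of a torsion-free connection in a chart:
`P₍ᵢⱼ₎ = R₍ᵢⱼ₎ / (n - 1)` and `P₍[ᵢⱼ]₎ = R₍[ᵢⱼ]₎ / (n + 1)`. -/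
def schouten (D : AffineConnection n N) (e : OpenPartialHomeomorph N (Rn n)) (i j : Fin n)
    (x : Rn n) : ℝ :=
  (ricciOf (christoffel D e) i j x + ricciOf (christoffel D e) j i x) / (2 * ((n : ℝ) - 1))
    + (ricciOf (christoffel D e) i j x - ricciOf (christoffel D e) j i x) / (2 * ((n : ℝ) + 1))

/-! ### Cotractors -/

/-- The families of pairs `[V]_∇ = (σ, μ)` which transform by `(σ, μ) ↦ (σ, μ + σ Υ)`. -/
def cotractorSubmodule (P : ProjectiveStructure n N) (p : N) :
    Submodule ℝ (P.reps → Density n p × (TN n p →ₗ[ℝ] Density n p)) where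
  carrier := {V | ∀ (D D' : P.reps) (Υ : ∀ q : N, TN n q →L[ℝ] ℝ),
    IsProjectiveChange D.1 D'.1 Υ →
      V D' = ((V D).1, (V D).2 + (Υ p).toLinearMap.smulRight (V D).1)}
  add_mem' := by
    intro V W hV hW D D' Υ h
    simp only [Pi.add_apply, hV D D' Υ h, hW D D' Υ h]
    ext <;> simp
    ring
  zero_mem' := by
    intro D D' Υ h
    ext <;> simp
  smul_mem' := by
    intro a V hV D D' Υ h
    simp only [Pi.smul_apply, hV D D' Υ h]
    ext <;> simp
    ring

/-- The fibre at `p` of the cotractor bundle `𝒯*`. A cotractor `V` is given by its representations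
`[V]_∇ = (σ, μ) ∈ 𝓔(1)_p ⊕ T*_pN(1)` with respect to all connections `∇` of the projective class,
subject to `[V]_∇' = (σ, μ + σ Υ)` whenever `∇'` is the projective change of `∇` by `Υ`. Here
`T*_pN(1) = T*_pN ⊗ 𝓔(1)_p` is `Hom(T_pN, 𝓔(1)_p)`. -/
def Cotractor (P : ProjectiveStructure n N) (p : N) : Type _ := cotractorSubmodule P p

instance (P : ProjectiveStructure n N) (p : N) : AddCommGroup (Cotractor P p) :=
  inferInstanceAs (AddCommGroup (cotractorSubmodule P p))

instance (P : ProjectiveStructure n N) (p : N) : Module ℝ (Cotractor P p) :=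
  inferInstanceAs (Module ℝ (cotractorSubmodule P p))

/-- The representation `[V]_∇ = (σ, μ)` of a cotractor. -/
def Cotractor.split {P : ProjectiveStructure n N} {p : N} (V : Cotractor P p) (D : P.reps) :
    Density n p × (TN n p →ₗ[ℝ] Density n p) := V.1 D

/-! Basic facts about densities and projective changes. -/

theorem IsProjectiveChange.unique {D D' : AffineConnection n N} {Υ Υ' : ∀ p : N, TN n p →L[ℝ] ℝ}
    (p : N)
    (h : ∀ (Y : ∀ p : N, TN n p),
      MDifferentiableAt 𝓘(ℝ, Rn n) (𝓘(ℝ, Rn n).prod 𝓘(ℝ, Rn n))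
        (fun q => (⟨q, Y q⟩ : TangentBundle 𝓘(ℝ, Rn n) N)) p →
      ∀ v : TN n p, D'.cov Y p v = D.cov Y p v + Υ p v • Y p + Υ p (Y p) • v)
    (h' : ∀ (Y : ∀ p : N, TN n p),
      MDifferentiableAt 𝓘(ℝ, Rn n) (𝓘(ℝ, Rn n).prod 𝓘(ℝ, Rn n))
        (fun q => (⟨q, Y q⟩ : TangentBundle 𝓘(ℝ, Rn n) N)) p →
      ∀ v : TN n p, D'.cov Y p v = D.cov Y p v + Υ' p v • Y p + Υ' p (Y p) • v) :
    Υ p = Υ' p := by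
  ext v
  have hY := FiberBundle.mdifferentiableAt_extend (V := fun q : N => TN n q) 𝓘(ℝ, Rn n) (Rn n) v
  have e1 := h _ hY v
  have e2 := h' _ hY v
  rw [e1] at e2
  simp only [FiberBundle.extend_apply_self] at e2
  have e3 : ((Υ p v - Υ' p v) + (Υ p v - Υ' p v)) • v = 0 := by
    have : Υ p v • v + Υ p v • v = Υ' p v • v + Υ' p v • v := by
      have := e2
      rw [add_assoc, add_assoc] at this
      exact add_left_cancel this
    rw [add_smul, sub_smul, ← sub_eq_zero.mpr this]; abel
  rcases smul_eq_zero.mp e3 with h0 | h0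
  · linarith
  · simp [h0]

namespace ProjectiveStructure

variable (P : ProjectiveStructure n N)

/-- Any two connections of the class are related by a one-form. -/
theorem exists_change (D D' : P.reps) : ∃ Υ, IsProjectiveChange D.1 D'.1 Υ :=
  (P.mem_iff D.1 D.2 D'.1).mp D'.2

/-- The one-form `Υ` with `∇' = ∇ + Υ`. -/
def change (D D' : P.reps) : ∀ p : N, TN n p →L[ℝ] ℝ := (P.exists_change D D').choose

theorem change_spec (D D' : P.reps) : IsProjectiveChange D.1 D'.1 (P.change D D') :=
  (P.exists_change D D').choose_spec

theorem change_add {D₀ D D' : P.reps} {Υ : ∀ p : N, TN n p →L[ℝ] ℝ}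
    (h : IsProjectiveChange D.1 D'.1 Υ) (p : N) :
    P.change D₀ D' p = P.change D₀ D p + Υ p := by
  refine IsProjectiveChange.unique (D := D₀.1) (D' := D'.1)
    (Υ' := fun q => P.change D₀ D q + Υ q) p
    (fun Y hY v => (P.change_spec D₀ D').change Y p hY v) ?_
  intro Y hY v
  rw [h.change Y p hY v, (P.change_spec D₀ D).change Y p hY v]
  simp only [add_apply]
  module

theorem change_self (D : P.reps) (p : N) : P.change D D p = 0 := by
  have := P.change_add (D₀ := D) (P.change_spec D D) p
  simpa using this

end ProjectiveStructure

namespace Cotractor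

variable {P : ProjectiveStructure n N} {p : N}

/-- The cotractor with `[V]_∇ = (σ, μ)`. -/
def ofPair (D : P.reps) (σ : Density n p) (μ : TN n p →ₗ[ℝ] Density n p) : Cotractor P p :=
  ⟨fun D' => (σ, μ + (P.change D D' p).toLinearMap.smulRight σ), by
    intro D₁ D₂ Υ h
    beta_reduce
    rw [P.change_add h p]
    ext <;> simp
    ring⟩

theorem ofPair_split (D D' : P.reps) (σ : Density n p) (μ : TN n p →ₗ[ℝ] Density n p) :
    (ofPair (P := P) D σ μ).split D' = (σ, μ + (P.change D D' p).toLinearMap.smulRight σ) := rfl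

theorem split_smul (a : ℝ) (V : Cotractor P p) (D : P.reps) : (a • V).split D = a • V.split D :=
  rfl

theorem ofPair_self (D : P.reps) (σ : Density n p) (μ : TN n p →ₗ[ℝ] Density n p) :
    (ofPair (P := P) D σ μ).split D = (σ, μ) := by
  change (σ, μ + (P.change D D p).toLinearMap.smulRight σ) = (σ, μ)
  rw [P.change_self]
  ext <;> simp

theorem change_apply (V : Cotractor P p) (D D' : P.reps) :
    V.split D' = ((V.split D).1, (V.split D).2 + (P.change D D' p).toLinearMap.smulRight (V.split D).1) :=
  V.2 D D' _ (P.change_spec D D')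

theorem ext_at {V W : Cotractor P p} (D : P.reps) (h : V.split D = W.split D) : V = W := by
  apply Subtype.ext
  funext D'
  exact (change_apply V D D').trans ((change_apply W D D').trans (by rw [h])).symm

/-- The pairing `τ(V) = X ⌟ V ∈ 𝓔(1)_p` with the canonical tractor `X`: the component `σ`, which
is the same for every connection in the class. -/
def tau : Cotractor P p →ₗ[ℝ] Density n p where
  toFun V := (V.split ⟨_, P.nonempty.some_mem⟩).1
  map_add' _ _ := rfl
  map_smul' _ _ := rfl

theorem tau_eq (V : Cotractor P p) (D : P.reps) : tau V = (V.split D).1 := by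
  have := change_apply V D ⟨_, P.nonempty.some_mem⟩
  have h2 : (V.split ⟨_, P.nonempty.some_mem⟩).1 = (V.split D).1 := by rw [this]
  exact h2

end Cotractor

/-! ### The total spaces -/

/-- The total space of the cotractor bundle `𝒯* → N`. -/
structure CotractorBundle (P : ProjectiveStructure n N) where
  base : N
  vec : Cotractor P base

open scoped LinearAlgebra.Projectivization in
/-- The complement `ℙ(𝒯*) ∖ 𝒵(τ)` of the zero locus of `τ` in the fibrewise projectivisation of
the cotractor bundle. -/
structure ProjCotractorBundle (P : ProjectiveStructure n N) where
  base : N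
  line : ℙ ℝ (Cotractor P base)
  tau_ne : Cotractor.tau line.rep ≠ 0

variable {P : ProjectiveStructure n N}

theorem ProjCotractorBundle.mk_tau_ne {p : N} {V : Cotractor P p} (h : Cotractor.tau V ≠ 0)
    (h0 : V ≠ 0) : Cotractor.tau (Projectivization.mk ℝ V h0).rep ≠ 0 := by
  obtain ⟨a, ha⟩ := Projectivization.exists_smul_eq_mk_rep ℝ V h0
  rw [← ha]
  intro h1
  apply h
  have : (a : ℝ) • Cotractor.tau V = 0 := by rw [← map_smul]; exact h1
  exact (smul_eq_zero.mp this).resolve_left a.ne_zero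

/-- The class `[V]` of a cotractor with `τ(V) ≠ 0`. -/
def ProjCotractorBundle.mk' {p : N} (V : Cotractor P p) (h : Cotractor.tau V ≠ 0) :
    ProjCotractorBundle P :=
  have h0 : V ≠ 0 := fun e => h (by rw [e, map_zero])
  ⟨p, Projectivization.mk ℝ V h0, ProjCotractorBundle.mk_tau_ne h h0⟩

theorem Cotractor.tau_ofPair_std_ne {p : N} (D : P.reps) (μ : TN n p →ₗ[ℝ] Density n p) :
    Cotractor.tau (Cotractor.ofPair (P := P) D (stdDensity n p) μ) ≠ 0 := by
  rw [Cotractor.tau_eq _ D, Cotractor.ofPair_self]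
  intro h
  have := stdDensity_stdVol (n := n) p
  change stdDensity n p = 0 at h
  rw [h] at this
  simp at this

open Classical in
/-- The projectivisation map `κ`, `U ↦ [U]`, on the set `τ(U) ≠ 0` (an arbitrary point of the same
fibre is assigned where `τ(U) = 0`). -/
def kappa (U : CotractorBundle P) : ProjCotractorBundle P :=
  if h : Cotractor.tau U.vec ≠ 0 then ProjCotractorBundle.mk' U.vec h
  else ProjCotractorBundle.mk' _ (Cotractor.tau_ofPair_std_ne (p := U.base)
    ⟨_, P.nonempty.some_mem⟩ 0)

/-- Coordinates `(x, V₀, Vᵢ)` on `𝒯*`: for `[U]_∇ = (σ, μ)`, `V₀` and `Vᵢ` are the components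
of `σ` and `μ(∂ᵢ)` in the trivialisation of `𝓔(1)` by the coordinate volume form. -/
def cotractorCoord (D : P.reps) (e : OpenPartialHomeomorph N (Rn n)) (U : CotractorBundle P) :
    Rn n × ℝ × Rn n :=
  (e U.base, (U.vec.split D).1.eval (coordVol e U.base),
    fun i => ((U.vec.split D).2 (coordField e i U.base)).eval (coordVol e U.base))

/-- Coordinates `(xⁱ, ξᵢ)` on `ℙ(𝒯*) ∖ 𝒵(τ)`: for `[U]_∇ = (σ, μ)`, `ξᵢ = μ(∂ᵢ) / σ`. -/
def projCoord (D : P.reps) (e : OpenPartialHomeomorph N (Rn n)) (m : ProjCotractorBundle P) :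
    Fin n ⊕ Fin n → ℝ :=
  Sum.elim (e m.base) fun i =>
    Density.ratio ((m.line.rep.split D).2 (coordField e i m.base)) (m.line.rep.split D).1


/-! ### Charts of the total spaces -/

section ChartLemmas

variable {e e' : OpenPartialHomeomorph N (Rn n)}

set_option linter.unusedSectionVars false in
theorem mdiff_of_maximal (he : e ∈ IsManifold.maximalAtlas 𝓘(ℝ, Rn n) ∞ N) :
    e.MDifferentiable 𝓘(ℝ, Rn n) 𝓘(ℝ, Rn n) :=
  ⟨(contMDiffOn_of_mem_maximalAtlas he).mdifferentiableOn (by simp),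
    (contMDiffOn_symm_of_mem_maximalAtlas he).mdifferentiableOn (by simp)⟩

theorem mfderiv_coordField (he : e ∈ IsManifold.maximalAtlas 𝓘(ℝ, Rn n) ∞ N)
    (he' : e' ∈ IsManifold.maximalAtlas 𝓘(ℝ, Rn n) ∞ N) {p : N} (hp : p ∈ e.source)
    (hp' : p ∈ e'.source) (i : Fin n) :
    (mfderiv 𝓘(ℝ, Rn n) 𝓘(ℝ, Rn n) e' p (coordField e i p) : Rn n)
      = fderiv ℝ (e' ∘ e.symm) (e p) (Pi.single i 1) := by
  have h1 : MDifferentiableAt 𝓘(ℝ, Rn n) 𝓘(ℝ, Rn n) e.symm (e p) :=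
    (mdiff_of_maximal he).mdifferentiableAt_symm (e.map_source hp)
  have h2 : MDifferentiableAt 𝓘(ℝ, Rn n) 𝓘(ℝ, Rn n) e' p :=
    (mdiff_of_maximal he').mdifferentiableAt hp'
  have h3 := h2
  rw [← e.left_inv hp] at h3
  rw [← mfderiv_eq_fderiv, mfderiv_comp _ h3 h1]
  simp only [coordField]
  have key : ∀ q : N, q = p → (mfderiv 𝓘(ℝ, Rn n) 𝓘(ℝ, Rn n) e' p : Rn n →L[ℝ] Rn n)
      = (mfderiv 𝓘(ℝ, Rn n) 𝓘(ℝ, Rn n) e' q : Rn n →L[ℝ] Rn n) := by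
    rintro q rfl; rfl
  exact congrArg (fun A : Rn n →L[ℝ] Rn n =>
    A (mfderiv 𝓘(ℝ, Rn n) 𝓘(ℝ, Rn n) e.symm (e p) (Pi.single i 1 : Rn n))) (key _ (e.left_inv hp))

theorem mfderiv_coordField_self (he : e ∈ IsManifold.maximalAtlas 𝓘(ℝ, Rn n) ∞ N) {p : N}
    (hp : p ∈ e.source) (i : Fin n) :
    (mfderiv 𝓘(ℝ, Rn n) 𝓘(ℝ, Rn n) e p (coordField e i p) : Rn n) = Pi.single i 1 := by
  rw [mfderiv_coordField he he hp hp]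
  have : (e ∘ e.symm) =ᶠ[nhds (e p)] id := by
    filter_upwards [e.open_target.mem_nhds (e.map_source hp)] with y hy
    exact e.right_inv hy
  rw [this.fderiv_eq, fderiv_id]
  rfl

theorem coordForm_coordField_self (he : e ∈ IsManifold.maximalAtlas 𝓘(ℝ, Rn n) ∞ N) {p : N}
    (hp : p ∈ e.source) (i j : Fin n) :
    coordForm e j p (coordField e i p) = (Pi.single i (1 : ℝ) : Rn n) j := by
  rw [← mfderiv_coordField_self he hp i]
  rfl

/-- The coordinate vectors of a chart as a basis of the tangent space. -/
def coordBasis (he : e ∈ IsManifold.maximalAtlas 𝓘(ℝ, Rn n) ∞ N) {p : N}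
    (hp : p ∈ e.source) : Module.Basis (Fin n) ℝ (TN n p) :=
  Module.Basis.map (Pi.basisFun ℝ (Fin n))
    ((mdiff_of_maximal he).mfderiv hp).symm.toLinearEquiv

theorem coordBasis_apply (he : e ∈ IsManifold.maximalAtlas 𝓘(ℝ, Rn n) ∞ N) {p : N}
    (hp : p ∈ e.source) (i : Fin n) : coordBasis he hp i = coordField e i p := by
  have h := mfderiv_coordField_self he hp i
  have h2 : ((mdiff_of_maximal he).mfderiv hp) (coordField e i p) = (Pi.single i 1 : Rn n) := h
  change ((mdiff_of_maximal he).mfderiv hp).symm (Pi.basisFun ℝ (Fin n) i) = _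
  rw [Pi.basisFun_apply]
  exact (ContinuousLinearEquiv.symm_apply_eq _).mpr h2.symm

theorem coordVol_coordField (he : e ∈ IsManifold.maximalAtlas 𝓘(ℝ, Rn n) ∞ N) {p : N}
    (hp : p ∈ e.source) : coordVol e p (fun i => coordField e i p) = 1 := by
  have : coordVol e p (fun i => coordField e i p)
      = (Pi.basisFun ℝ (Fin n)).det (fun i => (Pi.single i 1 : Rn n)) := by
    simp only [← mfderiv_coordField_self he hp]
    rfl
  rw [this]
  have h := (Pi.basisFun ℝ (Fin n)).det_self
  rwa [show (⇑(Pi.basisFun ℝ (Fin n)) : Fin n → Rn n) = fun i => Pi.single i 1 from by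
    ext i; simp] at h

theorem coordBasis_det (he : e ∈ IsManifold.maximalAtlas 𝓘(ℝ, Rn n) ∞ N) {p : N}
    (hp : p ∈ e.source) : (coordBasis he hp).det = coordVol e p := by
  have h := AlternatingMap.eq_smul_basis_det (coordBasis he hp) (coordVol e p)
  have h1 : (⇑(coordBasis he hp) : Fin n → TN n p) = fun i => coordField e i p :=
    funext (coordBasis_apply he hp)
  rw [h1, coordVol_coordField he hp, one_smul] at h
  exact h.symm

theorem Density.eq_smul_coord (he : e ∈ IsManifold.maximalAtlas 𝓘(ℝ, Rn n) ∞ N) {p : N}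
    (hp : p ∈ e.source) (f : Density n p) :
    f = f.eval (coordVol e p) • frameDensity n p (fun i => coordField e i p) := by
  have h := Density.eq_smul_frameDensity (coordBasis he hp) f
  have h1 : (⇑(coordBasis he hp) : Fin n → TN n p) = fun i => coordField e i p :=
    funext (coordBasis_apply he hp)
  rwa [coordBasis_det, h1] at h

theorem coordVol_eq_det (he : e ∈ IsManifold.maximalAtlas 𝓘(ℝ, Rn n) ∞ N)
    (he' : e' ∈ IsManifold.maximalAtlas 𝓘(ℝ, Rn n) ∞ N) {p : N} (hp : p ∈ e.source)
    (hp' : p ∈ e'.source) :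
    coordVol e' p (fun i => coordField e i p)
      = Matrix.det (Matrix.of fun j i : Fin n => fderiv ℝ (e' ∘ e.symm) (e p) (Pi.single i 1) j) := by
  have : coordVol e' p (fun i => coordField e i p)
      = (Pi.basisFun ℝ (Fin n)).det
        (fun i => (fderiv ℝ (e' ∘ e.symm) (e p) (Pi.single i 1) : Rn n)) := by
    simp only [← mfderiv_coordField he he' hp hp']
    rfl
  rw [this, Module.Basis.det_apply]
  congr 1

theorem coordVol_ne_zero (he : e ∈ IsManifold.maximalAtlas 𝓘(ℝ, Rn n) ∞ N)
    (he' : e' ∈ IsManifold.maximalAtlas 𝓘(ℝ, Rn n) ∞ N) {p : N} (hp : p ∈ e.source)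
    (hp' : p ∈ e'.source) : coordVol e' p (fun i => coordField e i p) ≠ 0 := by
  rw [← coordBasis_det he' hp', ← funext (coordBasis_apply he hp)]
  exact (Module.Basis.isUnit_det _ _).ne_zero

theorem coordForm_coordField (he : e ∈ IsManifold.maximalAtlas 𝓘(ℝ, Rn n) ∞ N)
    (he' : e' ∈ IsManifold.maximalAtlas 𝓘(ℝ, Rn n) ∞ N) {p : N} (hp : p ∈ e.source)
    (hp' : p ∈ e'.source) (i j : Fin n) :
    coordForm e i p (coordField e' j p)
      = fderiv ℝ (e ∘ e'.symm) (e' p) (Pi.single j 1) i := by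
  rw [← mfderiv_coordField he' he hp' hp]
  rfl

/-- Every linear map on `T_pN` is determined by its values on coordinate vectors. -/
theorem linearMap_eq_sum (he : e ∈ IsManifold.maximalAtlas 𝓘(ℝ, Rn n) ∞ N) {p : N}
    (hp : p ∈ e.source) {W : Type*} [AddCommGroup W] [Module ℝ W] (μ : TN n p →ₗ[ℝ] W) :
    μ = ∑ i, (coordForm e i p).smulRight (μ (coordField e i p)) := by
  refine (coordBasis he hp).ext fun j => ?_
  rw [coordBasis_apply, LinearMap.sum_apply]
  simp only [LinearMap.smulRight_apply, coordForm_coordField_self he hp]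
  simp [Pi.single_apply]

set_option linter.unusedSectionVars false in
theorem transition_contDiffOn (he : e ∈ IsManifold.maximalAtlas 𝓘(ℝ, Rn n) ∞ N)
    (he' : e' ∈ IsManifold.maximalAtlas 𝓘(ℝ, Rn n) ∞ N) :
    ContDiffOn ℝ ∞ (e' ∘ e.symm) (e.symm.trans e').source := by
  rw [← contMDiffOn_iff_contDiffOn]
  refine (contMDiffOn_of_mem_maximalAtlas he').comp
    ((contMDiffOn_symm_of_mem_maximalAtlas he).mono ?_) ?_
  · intro x hx
    simp only [mfld_simps] at hx
    exact hx.1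
  · intro x hx
    simp only [mfld_simps] at hx
    exact hx.2

theorem transition_fderiv_contDiffOn (he : e ∈ IsManifold.maximalAtlas 𝓘(ℝ, Rn n) ∞ N)
    (he' : e' ∈ IsManifold.maximalAtlas 𝓘(ℝ, Rn n) ∞ N) (i j : Fin n) :
    ContDiffOn ℝ ∞ (fun x => fderiv ℝ (e' ∘ e.symm) x (Pi.single i 1) j)
      (e.symm.trans e').source := by
  have h := ((transition_contDiffOn he he').fderiv_of_isOpen (m := ∞)
    (e.symm.trans e').open_source (by simp)).clm_apply
      (contDiffOn_const (c := (Pi.single i 1 : Rn n)))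
  exact contDiffOn_pi.mp h j

theorem form_coordField_contDiffOn (he : e ∈ IsManifold.maximalAtlas 𝓘(ℝ, Rn n) ∞ N)
    {D D' : AffineConnection n N} {Υ : ∀ p : N, TN n p →L[ℝ] ℝ} (h : IsProjectiveChange D D' Υ)
    (i : Fin n) :
    ContDiffOn ℝ ∞ (fun x => Υ (e.symm x) (coordField e i (e.symm x))) e.target := by
  rw [← contMDiffOn_iff_contDiffOn]
  have hs := contMDiffOn_symm_of_mem_maximalAtlas he
  have h1 : ContMDiffOn 𝓘(ℝ, Rn n) (𝓘(ℝ, Rn n).prod 𝓘(ℝ, Rn n)) ∞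
      (fun x : Rn n => (⟨e.symm x, coordField e i (e.symm x)⟩ : TangentBundle 𝓘(ℝ, Rn n) N))
      e.target := by
    have h2 := hs.contMDiffOn_tangentMapWithin (m := ∞) (by simp) e.open_target.uniqueMDiffOn
    have h3 : ContMDiffOn 𝓘(ℝ, Rn n) (𝓘(ℝ, Rn n).prod 𝓘(ℝ, Rn n)) ∞
        (fun x : Rn n => (⟨x, (Pi.single i 1 : Rn n)⟩ : TangentBundle 𝓘(ℝ, Rn n) (Rn n)))
        e.target :=
      (contMDiffOn_vectorSpace_iff_contDiffOn
        (V := fun x : Rn n => ((Pi.single i 1 : Rn n) : TangentSpace 𝓘(ℝ, Rn n) x))).2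
          contDiffOn_const
    have h4 := h2.comp h3 (fun x hx => hx)
    refine h4.congr fun x hx => ?_
    have h5 : mfderivWithin 𝓘(ℝ, Rn n) 𝓘(ℝ, Rn n) e.symm e.target x
        = mfderiv 𝓘(ℝ, Rn n) 𝓘(ℝ, Rn n) e.symm x :=
      mfderivWithin_of_isOpen e.open_target hx
    have key : ∀ y : Rn n, y = x →
        (mfderiv 𝓘(ℝ, Rn n) 𝓘(ℝ, Rn n) e.symm y (Pi.single i 1 : Rn n) : Rn n)
          = (mfderiv 𝓘(ℝ, Rn n) 𝓘(ℝ, Rn n) e.symm x (Pi.single i 1 : Rn n) : Rn n) := by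
      rintro y rfl; rfl
    simp only [Function.comp_apply, tangentMapWithin, h5, coordField]
    exact congrArg (fun v : Rn n => (⟨e.symm x, v⟩ : TangentBundle 𝓘(ℝ, Rn n) N))
      (key _ (e.right_inv hx))
  have h2 : ContMDiffOn 𝓘(ℝ, Rn n) (𝓘(ℝ, Rn n).prod 𝓘(ℝ, Rn n →L[ℝ] ℝ)) ∞
    (fun x : Rn n => TotalSpace.mk' (Rn n →L[ℝ] ℝ)
      (E := fun p : N => (TangentSpace 𝓘(ℝ, Rn n) p →L[ℝ] Bundle.Trivial N ℝ p)) (e.symm x)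
        (Υ (e.symm x))) e.target := h.smooth.comp_contMDiffOn hs
  have h3 := h2.clm_bundle_apply (F₁ := Rn n) (F₂ := ℝ) (E₁ := fun p : N => TN n p)
    (E₂ := Bundle.Trivial N ℝ) h1
  intro x hx
  have h4 := (Bundle.contMDiffWithinAt_totalSpace.1 (h3 x hx)).2
  simpa using h4

end ChartLemmas

section Charts

/-- The cotractor at `p` with coordinates `(V₀, Vᵢ)`. -/
def cotractorAt (D : P.reps) (e : OpenPartialHomeomorph N (Rn n)) (p : N) (y : ℝ × Rn n) :
    Cotractor P p :=
  let ρ := frameDensity n p (fun i => coordField e i p)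
  Cotractor.ofPair D (y.1 • ρ) (∑ i, (coordForm e i p).smulRight (y.2 i • ρ))

/-- The inverse of `cotractorCoord`. -/
def cotractorOfCoord (D : P.reps) (e : OpenPartialHomeomorph N (Rn n)) (y : Rn n × ℝ × Rn n) :
    CotractorBundle P :=
  ⟨e.symm y.1, cotractorAt D e (e.symm y.1) y.2⟩

/-- The point of `ℙ(𝒯*_p) ∖ 𝒵(τ)` with affine coordinates `ξᵢ`, the class of `(1, ξᵢ)`. -/
def projAt (D : P.reps) (e : OpenPartialHomeomorph N (Rn n)) (p : N) (ξ : Rn n) :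
    ProjCotractorBundle P :=
  ProjCotractorBundle.mk' _ (Cotractor.tau_ofPair_std_ne (P := P) (p := p) D
    (∑ i, (coordForm e i p).smulRight (ξ i • stdDensity n p)))

/-- The inverse of `projCoord`. -/
def projOfCoord (D : P.reps) (e : OpenPartialHomeomorph N (Rn n)) (y : Fin n ⊕ Fin n → ℝ) :
    ProjCotractorBundle P :=
  projAt D e (e.symm (fun i => y (Sum.inl i))) (fun i => y (Sum.inr i))

variable {e e' : OpenPartialHomeomorph N (Rn n)}

theorem cotractorAt_eq (he : e ∈ IsManifold.maximalAtlas 𝓘(ℝ, Rn n) ∞ N) (D : P.reps) {p : N}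
    (hp : p ∈ e.source) (V : Cotractor P p) :
    cotractorAt D e p ((V.split D).1.eval (coordVol e p),
      fun i => ((V.split D).2 (coordField e i p)).eval (coordVol e p)) = V := by
  apply Cotractor.ext_at D
  simp only [cotractorAt]
  rw [Cotractor.ofPair_self]
  simp only [← Density.eq_smul_coord he hp]
  rw [← linearMap_eq_sum he hp]

theorem cotractorCoord_cotractorAt (D D' : P.reps) (p : N) (y : ℝ × Rn n) :
    cotractorCoord D' e' ⟨p, cotractorAt D e p y⟩ = (e' p,
      |coordVol e' p (fun i => coordField e i p)| ^ (1 / ((n : ℝ) + 1)) * y.1,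
      fun j => |coordVol e' p (fun i => coordField e i p)| ^ (1 / ((n : ℝ) + 1)) *
        (∑ i, coordForm e i p (coordField e' j p) * y.2 i
          + P.change D D' p (coordField e' j p) * y.1)) := by
  simp only [cotractorCoord, cotractorAt, Cotractor.ofPair_split, Density.eval_smul,
    frameDensity_eval, LinearMap.add_apply, LinearMap.sum_apply, LinearMap.smulRight_apply,
    Density.eval_add, Density.eval_sum]
  refine Prod.ext rfl (Prod.ext (mul_comm _ _) (funext fun j => ?_))
  simp only [mul_add, Finset.mul_sum, ContinuousLinearMap.coe_coe]
  congr 1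
  · exact Finset.sum_congr rfl fun i _ => by ring
  · ring

theorem cotractorCoord_cotractorAt_self (he : e ∈ IsManifold.maximalAtlas 𝓘(ℝ, Rn n) ∞ N)
    (D : P.reps) {p : N} (hp : p ∈ e.source) (y : ℝ × Rn n) :
    cotractorCoord D e ⟨p, cotractorAt D e p y⟩ = (e p, y) := by
  rw [cotractorCoord_cotractorAt, P.change_self]
  simp [coordVol_coordField he hp, coordForm_coordField_self he hp, Pi.single_apply]

theorem ratio_mk' (D : P.reps) {p : N} (V : Cotractor P p) (h : Cotractor.tau V ≠ 0)
    (v : TN n p) :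
    Density.ratio (((ProjCotractorBundle.mk' V h).line.rep.split D).2 v)
      ((ProjCotractorBundle.mk' V h).line.rep.split D).1
      = Density.ratio ((V.split D).2 v) (V.split D).1 := by
  have h0 : V ≠ 0 := fun e => h (by rw [e, map_zero])
  obtain ⟨a, ha⟩ := Projectivization.exists_smul_eq_mk_rep ℝ V h0
  change Density.ratio (((Projectivization.mk ℝ V h0).rep.split D).2 v)
    ((Projectivization.mk ℝ V h0).rep.split D).1 = _
  have hs : (Projectivization.mk ℝ V h0).rep.split D = (a : ℝ) • V.split D := by
    rw [← ha]; rfl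
  rw [hs]
  simp only [Density.ratio, Prod.smul_fst, Prod.smul_snd, LinearMap.smul_apply, Density.eval_smul]
  exact mul_div_mul_left _ _ a.ne_zero

theorem projCoord_projAt (D D' : P.reps) (p : N) (ξ : Rn n) :
    projCoord D' e' (projAt D e p ξ) = Sum.elim (e' p)
      (fun j => ∑ i, coordForm e i p (coordField e' j p) * ξ i
          + P.change D D' p (coordField e' j p)) := by
  have h : projCoord D' e' (projAt D e p ξ) = Sum.elim (e' p) (fun j => _) :=
    congrArg (Sum.elim (e' p)) (funext fun j => ratio_mk' D' _ _ (coordField e' j p))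
  rw [h]
  congr 1
  funext j
  simp only [Density.ratio, Cotractor.ofPair_split, Density.eval_smul,
    LinearMap.add_apply, LinearMap.sum_apply, LinearMap.smulRight_apply,
    Density.eval_add, Density.eval_sum, stdDensity_stdVol, mul_one, div_one,
    ContinuousLinearMap.coe_coe]

theorem projCoord_projAt_self (he : e ∈ IsManifold.maximalAtlas 𝓘(ℝ, Rn n) ∞ N)
    (D : P.reps) {p : N} (hp : p ∈ e.source) (ξ : Rn n) :
    projCoord D e (projAt D e p ξ) = Sum.elim (e p) ξ := by
  rw [projCoord_projAt, P.change_self]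
  simp [coordForm_coordField_self he hp, Pi.single_apply]

theorem projAt_eq (he : e ∈ IsManifold.maximalAtlas 𝓘(ℝ, Rn n) ∞ N) (D : P.reps)
    (m : ProjCotractorBundle P) (hm : m.base ∈ e.source) :
    projAt D e m.base (fun i =>
      Density.ratio ((m.line.rep.split D).2 (coordField e i m.base)) (m.line.rep.split D).1)
      = m := by
  obtain ⟨p, ℓ, hℓ⟩ := m
  have hσ : (ℓ.rep.split D).1.eval (stdVol n p) ≠ 0 := by
    apply Density.stdVol_ne
    rw [← Cotractor.tau_eq]
    exact hℓ
  simp only [projAt, ProjCotractorBundle.mk', ProjCotractorBundle.mk.injEq, heq_eq_eq, true_and]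
  conv_rhs => rw [← ℓ.mk_rep]
  rw [Projectivization.mk_eq_mk_iff']
  refine ⟨((ℓ.rep.split D).1.eval (stdVol n p))⁻¹, ?_⟩
  apply Cotractor.ext_at D
  rw [Cotractor.ofPair_self, Cotractor.split_smul]
  refine Prod.ext ?_ ?_
  · rw [Prod.smul_fst]
    ext η
    have h := congrArg (fun f => Density.eval f η) (Density.eq_smul_std (ℓ.rep.split D).1)
    simp only [Density.eval_smul] at h
    rw [Density.eval_smul, h, ← mul_assoc, inv_mul_cancel₀ hσ, one_mul]
  · conv_lhs => rw [Prod.smul_snd, linearMap_eq_sum he hm (ℓ.rep.split D).2]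
    rw [Finset.smul_sum]
    refine Finset.sum_congr rfl fun i _ => ?_
    ext v : 1
    simp only [LinearMap.smul_apply, LinearMap.smulRight_apply, Density.ratio]
    rw [smul_comm]
    congr 1
    ext η
    have h := congrArg (fun f => Density.eval f η)
      (Density.eq_smul_std ((ℓ.rep.split D).2 (coordField e i p)))
    simp only [Density.eval_smul] at h
    simp only [Density.eval_smul]
    rw [h, div_eq_inv_mul, mul_assoc]

/-- The chart `(x, V₀, Vᵢ)` of `𝒯*` given by a chart `e` of `N` and a connection of the class. -/
def cotractorChart (D : P.reps) (e : OpenPartialHomeomorph N (Rn n))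
    (he : e ∈ IsManifold.maximalAtlas 𝓘(ℝ, Rn n) ∞ N) :
    PartialEquiv (CotractorBundle P) (Rn n × ℝ × Rn n) where
  toFun := cotractorCoord D e
  invFun := cotractorOfCoord D e
  source := {U | U.base ∈ e.source}
  target := {y | y.1 ∈ e.target}
  map_source' := fun _ hU => e.map_source hU
  map_target' := fun _ hy => e.map_target hy
  left_inv' := by
    rintro ⟨p, V⟩ hp
    have h : cotractorOfCoord D e (cotractorCoord D e ⟨p, V⟩)
        = ⟨p, cotractorAt D e p (cotractorCoord D e ⟨p, V⟩).2⟩ :=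
      congrArg (fun q => (⟨q, cotractorAt D e q (cotractorCoord D e ⟨p, V⟩).2⟩ :
        CotractorBundle P)) (e.left_inv hp)
    rw [h]
    exact congrArg _ (cotractorAt_eq he D hp V)
  right_inv' := by
    rintro y hy
    rw [cotractorOfCoord, cotractorCoord_cotractorAt_self he D (e.map_target hy), e.right_inv hy]

/-- The chart `(xⁱ, ξᵢ)` of `ℙ(𝒯*) ∖ 𝒵(τ)` given by a chart `e` of `N` and a connection of the
class. -/
def projChart (D : P.reps) (e : OpenPartialHomeomorph N (Rn n))
    (he : e ∈ IsManifold.maximalAtlas 𝓘(ℝ, Rn n) ∞ N) :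
    PartialEquiv (ProjCotractorBundle P) (Fin n ⊕ Fin n → ℝ) where
  toFun := projCoord D e
  invFun := projOfCoord D e
  source := {m | m.base ∈ e.source}
  target := {y | (fun i => y (Sum.inl i)) ∈ e.target}
  map_source' := fun _ hm => e.map_source hm
  map_target' := fun _ hy => e.map_target hy
  left_inv' := by
    rintro m hm
    have h : projOfCoord D e (projCoord D e m)
        = projAt D e m.base (fun i => projCoord D e m (Sum.inr i)) :=
      congrArg (fun q => projAt D e q (fun i => projCoord D e m (Sum.inr i))) (e.left_inv hm)
    rw [h]
    exact projAt_eq he D m hm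
  right_inv' := by
    rintro y hy
    rw [projOfCoord, projCoord_projAt_self he D (e.map_target hy), e.right_inv hy]
    funext a
    cases a <;> rfl

theorem cotractorChart_transition (he : e ∈ IsManifold.maximalAtlas 𝓘(ℝ, Rn n) ∞ N)
    (he' : e' ∈ IsManifold.maximalAtlas 𝓘(ℝ, Rn n) ∞ N) (D D' : P.reps) :
    ContDiffOn ℝ ∞ ((cotractorChart D e he).symm.trans (cotractorChart D' e' he'))
      ((cotractorChart D e he).symm.trans (cotractorChart D' e' he')).source := by
  set S := ((cotractorChart D e he).symm.trans (cotractorChart D' e' he')).source with hS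
  have hfst : MapsTo Prod.fst S (e.symm.trans e').source := fun y hy => hy
  have hfst' : ContDiffOn ℝ ∞ (Prod.fst : Rn n × ℝ × Rn n → Rn n) S := contDiff_fst.contDiffOn
  have h1 : ContDiffOn ℝ ∞ (fun y : Rn n × ℝ × Rn n => (e' ∘ e.symm) y.1) S :=
    (transition_contDiffOn he he').comp hfst' hfst
  have hdet : ContDiffOn ℝ ∞ (fun y : Rn n × ℝ × Rn n =>
      coordVol e' (e.symm y.1) (fun i => coordField e i (e.symm y.1))) S := by
    have : ContDiffOn ℝ ∞ (fun x : Rn n =>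
        Matrix.det (Matrix.of fun j i : Fin n => fderiv ℝ (e' ∘ e.symm) x (Pi.single i 1) j))
        (e.symm.trans e').source := by
      simp only [Matrix.det_apply, Matrix.of_apply]
      refine ContDiffOn.sum fun σ _ => ContDiffOn.const_smul _ (contDiffOn_prod fun i _ => ?_)
      exact transition_fderiv_contDiffOn he he' _ _
    refine (this.comp hfst' hfst).congr fun y hy => ?_
    have hy1 : y.1 ∈ e.target := hy.1
    rw [coordVol_eq_det he he' (e.map_target hy1) hy.2, e.right_inv hy1]
    rfl
  have hρ : ContDiffOn ℝ ∞ (fun y : Rn n × ℝ × Rn n =>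
      |coordVol e' (e.symm y.1) (fun i => coordField e i (e.symm y.1))| ^ (1 / ((n : ℝ) + 1)))
      S := by
    have hne : ∀ y ∈ S, coordVol e' (e.symm y.1) (fun i => coordField e i (e.symm y.1)) ≠ 0 :=
      fun y hy => coordVol_ne_zero he he' (e.map_target hy.1) hy.2
    exact (hdet.abs hne).rpow_const_of_ne fun y hy => abs_ne_zero.mpr (hne y hy)
  have hA : ∀ i j : Fin n, ContDiffOn ℝ ∞ (fun y : Rn n × ℝ × Rn n =>
      coordForm e i (e.symm y.1) (coordField e' j (e.symm y.1))) S := by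
    intro i j
    refine ((transition_fderiv_contDiffOn he' he j i).comp h1 ?_).congr fun y hy => ?_
    · intro y hy
      have hy1 : y.1 ∈ e.target := hy.1
      have hy2 : e.symm y.1 ∈ e'.source := hy.2
      simp only [mfld_simps, hy2, e'.left_inv hy2, e.map_target hy1]
    · exact coordForm_coordField he he' (e.map_target hy.1) hy.2 i j
  have hΥ : ∀ j : Fin n, ContDiffOn ℝ ∞ (fun y : Rn n × ℝ × Rn n =>
      P.change D D' (e.symm y.1) (coordField e' j (e.symm y.1))) S := by
    intro j
    refine ((form_coordField_contDiffOn he' (P.change_spec D D') j).comp h1 ?_).congr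
      fun y hy => ?_
    · intro y hy
      exact e'.map_source hy.2
    · have hy2 : e.symm y.1 ∈ e'.source := hy.2
      exact congrArg (fun q => P.change D D' q (coordField e' j q)) (e'.left_inv hy2).symm
  have key : ∀ y, ((cotractorChart D e he).symm.trans (cotractorChart D' e' he')) y = _ :=
    fun y => cotractorCoord_cotractorAt (e := e) (e' := e') D D' (e.symm y.1) y.2
  refine ContDiffOn.congr ?_ fun y _ => key y
  refine h1.prodMk ((hρ.mul (contDiff_fst.comp contDiff_snd).contDiffOn).prodMk ?_)
  refine contDiffOn_pi.mpr fun j => hρ.mul (ContDiffOn.add (ContDiffOn.sum fun i _ => ?_) ?_)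
  · exact (hA i j).mul
      ((contDiff_apply ℝ ℝ i).comp (contDiff_snd.comp contDiff_snd)).contDiffOn
  · exact (hΥ j).mul (contDiff_fst.comp contDiff_snd).contDiffOn

theorem projChart_transition (he : e ∈ IsManifold.maximalAtlas 𝓘(ℝ, Rn n) ∞ N)
    (he' : e' ∈ IsManifold.maximalAtlas 𝓘(ℝ, Rn n) ∞ N) (D D' : P.reps) :
    ContDiffOn ℝ ∞ ((projChart D e he).symm.trans (projChart D' e' he'))
      ((projChart D e he).symm.trans (projChart D' e' he')).source := by
  set S := ((projChart D e he).symm.trans (projChart D' e' he')).source with hS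
  let b : (Fin n ⊕ Fin n → ℝ) → Rn n := fun y i => y (Sum.inl i)
  have hfst : MapsTo b S (e.symm.trans e').source := fun y hy => hy
  have hfst' : ContDiffOn ℝ ∞ b S :=
    (contDiff_pi.mpr fun i => contDiff_apply ℝ ℝ (Sum.inl i)).contDiffOn
  have h1 : ContDiffOn ℝ ∞ (fun y => (e' ∘ e.symm) (b y)) S :=
    (transition_contDiffOn he he').comp hfst' hfst
  have hA : ∀ i j : Fin n, ContDiffOn ℝ ∞ (fun y =>
      coordForm e i (e.symm (b y)) (coordField e' j (e.symm (b y)))) S := by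
    intro i j
    refine ((transition_fderiv_contDiffOn he' he j i).comp h1 ?_).congr fun y hy => ?_
    · intro y hy
      have hy1 : b y ∈ e.target := hy.1
      have hy2 : e.symm (b y) ∈ e'.source := hy.2
      simp only [mfld_simps, hy2, e'.left_inv hy2, e.map_target hy1]
    · exact coordForm_coordField he he' (e.map_target hy.1) hy.2 i j
  have hΥ : ∀ j : Fin n, ContDiffOn ℝ ∞ (fun y =>
      P.change D D' (e.symm (b y)) (coordField e' j (e.symm (b y)))) S := by
    intro j
    refine ((form_coordField_contDiffOn he' (P.change_spec D D') j).comp h1 ?_).congr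
      fun y hy => ?_
    · intro y hy
      exact e'.map_source hy.2
    · have hy2 : e.symm (b y) ∈ e'.source := hy.2
      exact congrArg (fun q => P.change D D' q (coordField e' j q)) (e'.left_inv hy2).symm
  have key : ∀ y, ((projChart D e he).symm.trans (projChart D' e' he')) y = _ :=
    fun y => projCoord_projAt (e := e) (e' := e') D D' (e.symm (b y)) (fun i => y (Sum.inr i))
  refine ContDiffOn.congr ?_ fun y _ => key y
  refine contDiffOn_pi.mpr ?_
  rintro (j | j)
  · exact contDiffOn_pi.mp h1 j
  · refine ContDiffOn.add (ContDiffOn.sum fun i _ => ?_) (hΥ j)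
    exact (hA i j).mul (contDiff_apply ℝ ℝ (Sum.inr i)).contDiffOn

variable (P) in
/-- The charts of `𝒯*`. -/
def cotractorCore : ChartedSpaceCore (Rn n × ℝ × Rn n) (CotractorBundle P) where
  atlas := {φ | ∃ (D : P.reps) (e : OpenPartialHomeomorph N (Rn n))
    (he : e ∈ IsManifold.maximalAtlas 𝓘(ℝ, Rn n) ∞ N), φ = cotractorChart D e he}
  chartAt U := cotractorChart ⟨_, P.nonempty.some_mem⟩ (chartAt (Rn n) U.base)
    (IsManifold.chart_mem_maximalAtlas U.base)
  mem_chart_source U := mem_chart_source (Rn n) U.base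
  chart_mem_atlas U := ⟨_, _, _, rfl⟩
  open_source := by
    rintro _ _ ⟨D, e, he, rfl⟩ ⟨D', e', he', rfl⟩
    exact (e.symm.trans e').open_source.preimage continuous_fst
  continuousOn_toFun := by
    rintro _ _ ⟨D, e, he, rfl⟩ ⟨D', e', he', rfl⟩
    exact (cotractorChart_transition he he' D D').continuousOn

variable (P) in
/-- The charts of `ℙ(𝒯*) ∖ 𝒵(τ)`. -/
def projCore : ChartedSpaceCore (Fin n ⊕ Fin n → ℝ) (ProjCotractorBundle P) where
  atlas := {φ | ∃ (D : P.reps) (e : OpenPartialHomeomorph N (Rn n))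
    (he : e ∈ IsManifold.maximalAtlas 𝓘(ℝ, Rn n) ∞ N), φ = projChart D e he}
  chartAt m := projChart ⟨_, P.nonempty.some_mem⟩ (chartAt (Rn n) m.base)
    (IsManifold.chart_mem_maximalAtlas m.base)
  mem_chart_source m := mem_chart_source (Rn n) m.base
  chart_mem_atlas m := ⟨_, _, _, rfl⟩
  open_source := by
    rintro _ _ ⟨D, e, he, rfl⟩ ⟨D', e', he', rfl⟩
    have hc : Continuous (fun (y : Fin n ⊕ Fin n → ℝ) (i : Fin n) => y (Sum.inl i)) :=
      continuous_pi fun i => continuous_apply (Sum.inl i)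
    exact (e.symm.trans e').open_source.preimage hc
  continuousOn_toFun := by
    rintro _ _ ⟨D, e, he, rfl⟩ ⟨D', e', he', rfl⟩
    exact (projChart_transition he he' D D').continuousOn

instance : TopologicalSpace (CotractorBundle P) := (cotractorCore P).toTopologicalSpace

instance : ChartedSpace (Rn n × ℝ × Rn n) (CotractorBundle P) := (cotractorCore P).toChartedSpace

instance : TopologicalSpace (ProjCotractorBundle P) := (projCore P).toTopologicalSpace

instance : ChartedSpace (Fin n ⊕ Fin n → ℝ) (ProjCotractorBundle P) :=
  (projCore P).toChartedSpace

theorem cotractor_mem_atlas {φ : OpenPartialHomeomorph (CotractorBundle P) (Rn n × ℝ × Rn n)}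
    (h : φ ∈ atlas (Rn n × ℝ × Rn n) (CotractorBundle P)) :
    ∃ (D : P.reps) (e : OpenPartialHomeomorph N (Rn n))
      (he : e ∈ IsManifold.maximalAtlas 𝓘(ℝ, Rn n) ∞ N),
      φ.toPartialEquiv = cotractorChart D e he := by
  obtain ⟨ψ, hψ⟩ := mem_iUnion.mp h
  obtain ⟨hψ', h2⟩ := mem_iUnion.mp hψ
  obtain ⟨D, e, he, rfl⟩ := hψ'
  refine ⟨D, e, he, ?_⟩
  rw [mem_singleton_iff.mp h2]
  rfl

theorem proj_mem_atlas
    {φ : OpenPartialHomeomorph (ProjCotractorBundle P) (Fin n ⊕ Fin n → ℝ)}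
    (h : φ ∈ atlas (Fin n ⊕ Fin n → ℝ) (ProjCotractorBundle P)) :
    ∃ (D : P.reps) (e : OpenPartialHomeomorph N (Rn n))
      (he : e ∈ IsManifold.maximalAtlas 𝓘(ℝ, Rn n) ∞ N),
      φ.toPartialEquiv = projChart D e he := by
  obtain ⟨ψ, hψ⟩ := mem_iUnion.mp h
  obtain ⟨hψ', h2⟩ := mem_iUnion.mp hψ
  obtain ⟨D, e, he, rfl⟩ := hψ'
  refine ⟨D, e, he, ?_⟩
  rw [mem_singleton_iff.mp h2]
  rfl

instance : IsManifold 𝓘(ℝ, Rn n × ℝ × Rn n) ∞ (CotractorBundle P) := by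
  apply isManifold_of_contDiffOn
  intro φ φ' hφ hφ'
  obtain ⟨D, e, he, h⟩ := cotractor_mem_atlas hφ
  obtain ⟨D', e', he', h'⟩ := cotractor_mem_atlas hφ'
  have hs : (φ.symm.trans φ').toPartialEquiv
      = (cotractorChart D e he).symm.trans (cotractorChart D' e' he') := by rw [← h, ← h']; rfl
  have key := cotractorChart_transition he he' D D'
  rw [← hs] at key
  simpa using! key

instance : IsManifold 𝓘(ℝ, Fin n ⊕ Fin n → ℝ) ∞ (ProjCotractorBundle P) := by
  apply isManifold_of_contDiffOn
  intro φ φ' hφ hφ'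
  obtain ⟨D, e, he, h⟩ := proj_mem_atlas hφ
  obtain ⟨D', e', he', h'⟩ := proj_mem_atlas hφ'
  have hs : (φ.symm.trans φ').toPartialEquiv
      = (projChart D e he).symm.trans (projChart D' e' he') := by rw [← h, ← h']; rfl
  have key := projChart_transition he he' D D'
  rw [← hs] at key
  simpa using! key

end Charts

/-! ### The tractor connection and the splitting of `T(𝒯*)` -/

section Tractor

variable (P) in
/-- Tangent vectors to the total space of the cotractor bundle. -/
abbrev TCotractor (U : CotractorBundle P) : Type := TangentSpace 𝓘(ℝ, Rn n × ℝ × Rn n) U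

variable (P) in
/-- Tangent vectors to `ℙ(𝒯*) ∖ 𝒵(τ)`. -/
abbrev TProj (m : ProjCotractorBundle P) : Type := TangentSpace 𝓘(ℝ, Fin n ⊕ Fin n → ℝ) m

/-- The tractor connection: the components in a chart `e`, in the splitting given by `∇`, of
`∇^𝒯_∂ᵢ s = (∇ᵢσ - μᵢ, ∇ᵢμⱼ + Pᵢⱼσ)`, where `[s]_∇ = (σ, μ)`. Densities are trivialised by the
coordinate volume form, so that `∇ᵢσ = ∂ᵢσ + Γᵏᵢₖ σ / (n+1)` and
`∇ᵢμⱼ = ∂ᵢμⱼ - Γᵏᵢⱼ μₖ + Γᵏᵢₖ μⱼ / (n+1)`. -/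
def tractorDeriv (D : P.reps) (e : OpenPartialHomeomorph N (Rn n)) (s : ∀ q : N, Cotractor P q)
    (i : Fin n) (x : Rn n) : ℝ × Rn n :=
  let σ : Rn n → ℝ := fun y =>
    ((s (e.symm y)).split D).1.eval (coordVol e (e.symm y))
  let μ : Fin n → Rn n → ℝ := fun j y =>
    (((s (e.symm y)).split D).2 (coordField e j (e.symm y))).eval (coordVol e (e.symm y))
  let Γ := christoffel D.1 e
  (pd i σ x + (∑ k, Γ i k k x) / ((n : ℝ) + 1) * σ x - μ i x,
    fun j => pd i (μ j) x - ∑ k, Γ i j k x * μ k x + (∑ k, Γ i k k x) / ((n : ℝ) + 1) * μ j x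
      + schouten D.1 e i j x * σ x)

/-- The section `s` is parallel for the tractor connection at the point `p`. -/
def IsParallelAt (s : ∀ q : N, Cotractor P q) (p : N) : Prop :=
  ∀ (D : P.reps), ∀ e ∈ IsManifold.maximalAtlas 𝓘(ℝ, Rn n) ∞ N, p ∈ e.source →
    ∀ i, tractorDeriv D e s i (e p) = 0

/-- The horizontal subspace of `T_U(𝒯*)` of the tractor connection: the tangent vectors of
sections through `U` which are parallel at the base point of `U`. -/
def IsHorizontal (U : CotractorBundle P) (h : TCotractor P U) : Prop :=
  ∃ s : ∀ q : N, Cotractor P q, s U.base = U.vec ∧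
    MDifferentiableAt 𝓘(ℝ, Rn n) 𝓘(ℝ, Rn n × ℝ × Rn n)
      (fun q : N => (⟨q, s q⟩ : CotractorBundle P)) U.base ∧
    IsParallelAt s U.base ∧
    ∃ v : TN n U.base, h = mfderiv 𝓘(ℝ, Rn n) 𝓘(ℝ, Rn n × ℝ × Rn n)
      (fun q : N => (⟨q, s q⟩ : CotractorBundle P)) U.base v

/-- The identification of `𝒯*_p` with the vertical subspace of `T_U(𝒯*)`: `W` is sent to the
velocity of `t ↦ U + t W` at `t = 0`. -/
def vertical (U : CotractorBundle P) (W : Cotractor P U.base) : TCotractor P U :=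
  mfderiv 𝓘(ℝ, ℝ) 𝓘(ℝ, Rn n × ℝ × Rn n)
    (fun t : ℝ => (⟨U.base, U.vec + t • W⟩ : CotractorBundle P)) 0 (1 : ℝ)

/-- The push-forward `κ_* : T_U(𝒯*) → T_[U](ℙ(𝒯*) ∖ 𝒵(τ))`. -/
def kappaPush (U : CotractorBundle P) : TCotractor P U →L[ℝ] TProj P (kappa U) :=
  mfderiv 𝓘(ℝ, Rn n × ℝ × Rn n) 𝓘(ℝ, Fin n ⊕ Fin n → ℝ) kappa U

/-- The projection `π_* : T_U(𝒯*) → TN`. -/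
def basePush (U : CotractorBundle P) : TCotractor P U →L[ℝ] TN n U.base :=
  mfderiv 𝓘(ℝ, Rn n × ℝ × Rn n) 𝓘(ℝ, Rn n) CotractorBundle.base U

/-- The component in `T*_pN(1) = ker X` of `W ∈ 𝒯*_p` in the splitting
`𝒯*_p = T*_pN(1) ⊕ ⟨U⟩` given by `U` (for `τ(U) ≠ 0`). -/
def formPart (U : CotractorBundle P) (W : Cotractor P U.base) : Cotractor P U.base :=
  W - Density.ratio (Cotractor.tau W) (Cotractor.tau U.vec) • U.vec

/-- The canonical pairing of `v ∈ T_pN` with the form part of `W`, a density in `𝓔(1)_p`, divided by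
`τ(U)`. -/
def pairing (D : P.reps) (U : CotractorBundle P) (v : TN n U.base) (W : Cotractor P U.base) : ℝ :=
  Density.ratio (((formPart U W).split D).2 v) (Cotractor.tau U.vec)

variable (P) in
/-- Covariant `2`-tensors on `ℙ(𝒯*) ∖ 𝒵(τ)`. -/
abbrev ProjTensor : Type _ := ∀ m : ProjCotractorBundle P, LinearMap.BilinForm ℝ (TProj P m)

/-- `g = τ⁻¹ 𝐠` for the canonical pairing
`𝐠(w₁, w₂) = ½ (Π_H(w₁) ⌟ Π_V(w₂) + Π_H(w₂) ⌟ Π_V(w₁))`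
of the horizontal and vertical parts of `w = κ_*(h + W)`, `h` horizontal and `W` vertical. -/
def IsPairingMetric (g : ProjTensor P) : Prop :=
  ∀ U : CotractorBundle P, Cotractor.tau U.vec ≠ 0 → ∀ D : P.reps,
  ∀ h₁ h₂ : TCotractor P U, IsHorizontal U h₁ → IsHorizontal U h₂ →
  ∀ W₁ W₂ : Cotractor P U.base,
    g (kappa U) (kappaPush U (h₁ + vertical U W₁)) (kappaPush U (h₂ + vertical U W₂))
      = (pairing D U (basePush U h₁) W₂ + pairing D U (basePush U h₂) W₁) / 2

/-- `Ω = τ⁻¹ 𝛀` for the skew pairing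
`𝛀(w₁, w₂) = ½ (Π_H(w₁) ⌟ Π_V(w₂) - Π_H(w₂) ⌟ Π_V(w₁))`. -/
def IsPairingForm (Ω : ProjTensor P) : Prop :=
  ∀ U : CotractorBundle P, Cotractor.tau U.vec ≠ 0 → ∀ D : P.reps,
  ∀ h₁ h₂ : TCotractor P U, IsHorizontal U h₁ → IsHorizontal U h₂ →
  ∀ W₁ W₂ : Cotractor P U.base,
    Ω (kappa U) (kappaPush U (h₁ + vertical U W₁)) (kappaPush U (h₂ + vertical U W₂))
      = (pairing D U (basePush U h₁) W₂ - pairing D U (basePush U h₂) W₁) / 2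

end Tractor

/-! ### The explicit coordinate form -/

section Explicit

variable (D : P.reps) (e : OpenPartialHomeomorph N (Rn n)) (m : ProjCotractorBundle P)

/-- The coordinate differential `dxⁱ` on `ℙ(𝒯*) ∖ 𝒵(τ)`. -/
def dx (i : Fin n) (w : TProj P m) : ℝ :=
  (mfderiv 𝓘(ℝ, Fin n ⊕ Fin n → ℝ) 𝓘(ℝ, Fin n ⊕ Fin n → ℝ) (projCoord D e) m w :
    Fin n ⊕ Fin n → ℝ) (Sum.inl i)

/-- The coordinate differential `dξᵢ` on `ℙ(𝒯*) ∖ 𝒵(τ)`. -/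
def dxi (i : Fin n) (w : TProj P m) : ℝ :=
  (mfderiv 𝓘(ℝ, Fin n ⊕ Fin n → ℝ) 𝓘(ℝ, Fin n ⊕ Fin n → ℝ) (projCoord D e) m w :
    Fin n ⊕ Fin n → ℝ) (Sum.inr i)

/-- `dξⱼ - (Γᵏᵢⱼ ξₖ - ξᵢ ξⱼ - P₍ᵢⱼ₎) dxⁱ`. -/
def theta (j : Fin n) (w : TProj P m) : ℝ :=
  let x := e m.base
  let ξ : Rn n := fun i => projCoord D e m (Sum.inr i)
  dxi D e m j w - ∑ i, (∑ k, christoffel D.1 e i j k x * ξ k - ξ i * ξ j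
    - (schouten D.1 e i j x + schouten D.1 e j i x) / 2) * dx D e m i w

/-- `(dξⱼ - (Γᵏᵢⱼ ξₖ - ξᵢ ξⱼ - P₍ᵢⱼ₎) dxⁱ) ⊙ dxʲ`, where `α ⊙ β = ½ (α ⊗ β + β ⊗ α)`. -/
def explicitMetric (w₁ w₂ : TProj P m) : ℝ :=
  ∑ j, (theta D e m j w₁ * dx D e m j w₂ + dx D e m j w₁ * theta D e m j w₂) / 2

/-- `dξᵢ ∧ dxⁱ + P₍[ᵢⱼ]₎ dxⁱ ∧ dxʲ`, where `α ∧ β = ½ (α ⊗ β - β ⊗ α)`. -/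
def explicitForm (w₁ w₂ : TProj P m) : ℝ :=
  let x := e m.base
  ∑ i, (dxi D e m i w₁ * dx D e m i w₂ - dx D e m i w₁ * dxi D e m i w₂) / 2
    + ∑ i, ∑ j, (schouten D.1 e i j x - schouten D.1 e j i x) / 2
      * ((dx D e m i w₁ * dx D e m j w₂ - dx D e m j w₁ * dx D e m i w₂) / 2)

end Explicit

end Projective

/-! ### Pseudo-Riemannian and symplectic geometry -/

section Tensors

variable {ι : Type*} [Fintype ι] [DecidableEq ι]
  {X : Type*} [TopologicalSpace X] [ChartedSpace (ι → ℝ) X]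

/-- The components `g_ab = g(∂ₐ, ∂_b)` of a covariant `2`-tensor in a chart, as functions of the
coordinates. -/
def component (g : ∀ q : X, LinearMap.BilinForm ℝ (TangentSpace 𝓘(ℝ, ι → ℝ) q))
    (φ : OpenPartialHomeomorph X (ι → ℝ)) (a b : ι) (y : ι → ℝ) : ℝ :=
  g (φ.symm y) (coordField φ a (φ.symm y)) (coordField φ b (φ.symm y))

/-- Smoothness of a covariant `2`-tensor. -/
def IsSmoothTensor (g : ∀ q : X, LinearMap.BilinForm ℝ (TangentSpace 𝓘(ℝ, ι → ℝ) q)) : Prop :=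
  ∀ φ ∈ atlas (ι → ℝ) X, ∀ a b, ContDiffOn ℝ ∞ (component g φ a b) φ.target

/-- The inverse metric `g^{ab}`. -/
def inverseMetric (g : ∀ q : X, LinearMap.BilinForm ℝ (TangentSpace 𝓘(ℝ, ι → ℝ) q))
    (φ : OpenPartialHomeomorph X (ι → ℝ)) (y : ι → ℝ) : Matrix ι ι ℝ :=
  (Matrix.of fun a b => component g φ a b y)⁻¹

/-- The Christoffel symbols `Γᶜₐᵦ` of the Levi-Civita connection of `g` in a chart. -/
def leviCivita (g : ∀ q : X, LinearMap.BilinForm ℝ (TangentSpace 𝓘(ℝ, ι → ℝ) q))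
    (φ : OpenPartialHomeomorph X (ι → ℝ)) (a b c : ι) (y : ι → ℝ) : ℝ :=
  1 / 2 * ∑ d, inverseMetric g φ y c d *
    (pd a (component g φ b d) y + pd b (component g φ a d) y - pd d (component g φ a b) y)

/-- The components of the Ricci tensor of `g` in a chart. -/
def metricRicci (g : ∀ q : X, LinearMap.BilinForm ℝ (TangentSpace 𝓘(ℝ, ι → ℝ) q))
    (φ : OpenPartialHomeomorph X (ι → ℝ)) (a b : ι) (y : ι → ℝ) : ℝ :=
  ricciOf (leviCivita g φ) a b y

/-- The scalar curvature of `g` in a chart. -/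
def scalarCurvature (g : ∀ q : X, LinearMap.BilinForm ℝ (TangentSpace 𝓘(ℝ, ι → ℝ) q))
    (φ : OpenPartialHomeomorph X (ι → ℝ)) (y : ι → ℝ) : ℝ :=
  ∑ a, ∑ b, inverseMetric g φ y a b * metricRicci g φ a b y

/-- `g` is Einstein with scalar curvature the constant `S`: `Ric = (S / dim) g`. -/
def IsEinstein (g : ∀ q : X, LinearMap.BilinForm ℝ (TangentSpace 𝓘(ℝ, ι → ℝ) q)) (S : ℝ) : Prop :=
  ∀ φ ∈ atlas (ι → ℝ) X, ∀ y ∈ φ.target, scalarCurvature g φ y = S ∧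
    ∀ a b, metricRicci g φ a b y = S / Fintype.card ι * component g φ a b y

/-- `Ω` is a symplectic form: a smooth, alternating, nondegenerate, closed `2`-form. -/
structure IsSymplectic (Ω : ∀ q : X, LinearMap.BilinForm ℝ (TangentSpace 𝓘(ℝ, ι → ℝ) q)) :
    Prop where
  smooth : IsSmoothTensor Ω
  alternating : ∀ q v, Ω q v v = 0
  nondegenerate : ∀ q v, (∀ w, Ω q v w = 0) → v = 0
  closed : ∀ φ ∈ atlas (ι → ℝ) X, ∀ y ∈ φ.target, ∀ a b c,
    pd a (component Ω φ b c) y + pd b (component Ω φ c a) y + pd c (component Ω φ a b) y = 0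

/-- The form `B` has neutral signature `(k, k)`: in some basis it is
`diag(1, …, 1, -1, …, -1)`. -/
def IsNeutral (k : ℕ) {V : Type*} [AddCommGroup V] [Module ℝ V] (B : LinearMap.BilinForm ℝ V) :
    Prop :=
  ∃ b : Module.Basis (Fin k ⊕ Fin k) ℝ V, ∀ i j,
    B (b i) (b j) = if i = j then Sum.elim (fun _ => 1) (fun _ => -1) i else 0

end Tensors

end TractorGeometry

end

open TractorGeometry

/-! The manifold `M` is covered by charts (x, ξ), each given by a chart of `N` and a connection of
the class, and one computation in such a chart governs everything. Along a horizontal vector h over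
v the tractor connection prescribes dσ = vⁱ(μᵢ - tᵢσ) and dμⱼ = vⁱ(Γᵏᵢⱼμₖ - tᵢμⱼ - Pᵢⱼσ), where tᵢ =
Γᵏᵢₖ/(n+1) comes from the density weight. In the quotient ξⱼ = μⱼ/σ the tᵢ cancel, so κ_*(h + W) has
dxⁱ = vⁱ and dξⱼ = Wⱼ + vⁱ(Γᵏᵢⱼξₖ - ξᵢξⱼ - Pᵢⱼ), with Wⱼ the components of the form part of W
divided by τ(U) (`dxi_kappaPush`). The pairing of v and W is vʲWⱼ. Solving for Wⱼ and then
symmetrising or skew-symmetrising gives the two coordinate expressions: the skew part of P drops out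
of the metric, while Γ, ξᵢξⱼ and the symmetric part of P drop out of the two-form
(`explicitMetric_kappaPush`, `explicitForm_kappaPush`).

Uniqueness holds because every tangent vector of `M` is of the form κ_*(h + W)
(`exists_eq_kappaPush`). This needs enough horizontal vectors. Horizontality asks for a section that
is parallel at the point in all charts and all splittings at once, so the tractor connection has to
be shown projectively invariant and covariant under coordinate changes
(`tractorOf_projectiveChange`, `tractorOf_pullback`); this rests on the transformation laws of the
connection coefficients, of their traces and of the Schouten tensor. The pairing does not depend on
the splitting (`pairing_congr`), so the explicit expressions of all charts and connections satisfy
the same defining identity. By spanning they agree on overlaps, which gives global tensors and their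
coordinate form together.

In these charts g is a Walker metric Aᵢⱼdxⁱdxʲ + dξᵢ⊙dxⁱ: the fibres are null and the inverse matrix
is affine in A, so the Ricci tensor is an explicit polynomial in A and its derivatives. For A =
-Γᵏᵢⱼξₖ + ξᵢξⱼ + P₍ᵢⱼ₎ the mixed components are (n+1)δᵢⱼ, which is 2(n+1) times the metric
coefficient ½δᵢⱼ. In the base components the Ricci tensor of Γ appears as Rᵢⱼ + Rⱼᵢ = 2(n-1)P₍ᵢⱼ₎
and combines with the other terms to 2(n+1)Aᵢⱼ (`ricciOf_walkerConnection_metricCoeff`). Neutral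
signature is visible from the coframe of the θⱼ and dxʲ. The two-form is closed because the skew
part of the Ricci tensor of a torsion-free connection is the curl of the trace of its coefficients
(`schoutenOf_closed`). -/

noncomputable section

namespace TractorGeometry

set_option linter.unusedSectionVars false

/-! ### Calculus of partial derivatives in coordinates. -/

section PartialDerivatives

variable {ι : Type*} [Fintype ι] [DecidableEq ι] {f g : (ι → ℝ) → ℝ} {y : ι → ℝ}

theorem pd_congr (i : ι) (h : f =ᶠ[nhds y] g) : pd i f y = pd i g y := by
  rw [pd, pd, h.fderiv_eq]

theorem pd_add (i : ι) (hf : DifferentiableAt ℝ f y) (hg : DifferentiableAt ℝ g y) :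
    pd i (fun z => f z + g z) y = pd i f y + pd i g y := by
  simp [pd, fderiv_fun_add hf hg]

theorem pd_sub (i : ι) (hf : DifferentiableAt ℝ f y) (hg : DifferentiableAt ℝ g y) :
    pd i (fun z => f z - g z) y = pd i f y - pd i g y := by
  simp [pd, fderiv_fun_sub hf hg]

theorem pd_neg (i : ι) : pd i (fun z => -f z) y = -pd i f y := by
  simp [pd, fderiv_fun_neg]

theorem pd_mul (i : ι) (hf : DifferentiableAt ℝ f y) (hg : DifferentiableAt ℝ g y) :
    pd i (fun z => f z * g z) y = pd i f y * g y + f y * pd i g y := by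
  simp [pd, fderiv_fun_mul hf hg]; ring

theorem pd_sum {κ : Type*} (s : Finset κ) {F : κ → (ι → ℝ) → ℝ} (i : ι)
    (hF : ∀ k ∈ s, DifferentiableAt ℝ (F k) y) :
    pd i (fun z => ∑ k ∈ s, F k z) y = ∑ k ∈ s, pd i (F k) y := by
  simp [pd, fderiv_fun_sum hF]

@[simp] theorem pd_const (i : ι) (c : ℝ) : pd i (fun _ => c) y = 0 := by simp [pd]

theorem pd_const_mul (i : ι) (c : ℝ) (hf : DifferentiableAt ℝ f y) :
    pd i (fun z => c * f z) y = c * pd i f y := by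
  rw [pd_mul i (by fun_prop) hf]; simp

theorem pd_div_const (i : ι) (c : ℝ) : pd i (fun z => f z / c) y = pd i f y / c := by
  have h : (fun z => f z / c) = c⁻¹ • f := by
    ext z
    simp [div_eq_inv_mul]
  rw [h, pd, fderiv_const_smul_field, div_eq_inv_mul]
  rfl

theorem pd_coord (i j : ι) : pd i (fun z => z j) y = if j = i then 1 else 0 := by
  have : (fun z : ι → ℝ => z j) = (ContinuousLinearMap.proj j : (ι → ℝ) →L[ℝ] ℝ) := rfl
  rw [pd, this, ContinuousLinearMap.fderiv]
  simp [Pi.single_apply]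

/-- The chain rule in coordinates. -/
theorem pd_comp {κ : Type*} [Fintype κ] [DecidableEq κ] {h : (κ → ℝ) → ℝ} {φ : (ι → ℝ) → κ → ℝ}
    (i : ι) (hh : DifferentiableAt ℝ h (φ y)) (hφ : DifferentiableAt ℝ φ y) :
    pd i (fun z => h (φ z)) y = ∑ a, pd i (fun z => φ z a) y * pd a h (φ y) := by
  have h1 : fderiv ℝ (fun z => h (φ z)) y = (fderiv ℝ h (φ y)).comp (fderiv ℝ φ y) :=
    fderiv_comp y hh hφ
  have h2 : ∀ a, pd i (fun z => φ z a) y = fderiv ℝ φ y (Pi.single i 1) a := by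
    intro a
    rw [pd, fderiv_apply hφ]
    rfl
  simp only [h2]
  rw [pd, h1, ContinuousLinearMap.comp_apply]
  conv_lhs => rw [pi_eq_sum_univ' (fderiv ℝ φ y (Pi.single i 1)), map_sum]
  refine Finset.sum_congr rfl fun a _ => ?_
  rw [map_smul, smul_eq_mul, pd]

theorem pd_eq_fderiv_apply {κ : Type*} [Fintype κ] {φ : (ι → ℝ) → κ → ℝ}
    (i : ι) (a : κ) (hφ : DifferentiableAt ℝ φ y) :
    pd i (fun z => φ z a) y = fderiv ℝ φ y (Pi.single i 1) a := by
  rw [pd, fderiv_apply hφ]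
  rfl

theorem fderiv_eq_sum_pd (v : ι → ℝ) : fderiv ℝ f y v = ∑ i, v i * pd i f y := by
  conv_lhs => rw [pi_eq_sum_univ' v, map_sum]
  refine Finset.sum_congr rfl fun a _ => ?_
  rw [map_smul, smul_eq_mul, pd]

theorem contDiffOn_pd {S : Set (ι → ℝ)} (hS : IsOpen S) (hf : ContDiffOn ℝ ∞ f S) (i : ι) :
    ContDiffOn ℝ ∞ (pd i f) S :=
  (hf.fderiv_of_isOpen (m := ∞) hS (by simp)).clm_apply contDiffOn_const

theorem pd_comm {S : Set (ι → ℝ)} (hS : IsOpen S) (hf : ContDiffOn ℝ ∞ f S) (hy : y ∈ S)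
    (i j : ι) : pd i (pd j f) y = pd j (pd i f) y := by
  have h1 : ContDiffAt ℝ ∞ f y := hf.contDiffAt (hS.mem_nhds hy)
  have h2 : IsSymmSndFDerivAt ℝ f y := by
    refine h1.isSymmSndFDerivAt ?_
    simp only [minSmoothness_of_isRCLikeNormedField]
    exact WithTop.coe_le_coe.2 le_top
  have h3 : DifferentiableAt ℝ (fderiv ℝ f) y :=
    ((hf.fderiv_of_isOpen (m := ∞) hS (by simp)).contDiffAt (hS.mem_nhds hy)).differentiableAt
      (by simp)
  have key : ∀ i j, pd i (pd j f) y = fderiv ℝ (fderiv ℝ f) y (Pi.single i 1) (Pi.single j 1) := by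
    intro i j
    have : pd j f = fun z => fderiv ℝ f z (Pi.single j 1) := rfl
    rw [pd, this, fderiv_clm_apply h3 (by fun_prop)]
    simp
  rw [key, key, h2.eq]

theorem _root_.ContDiffOn.diffAt {S : Set (ι → ℝ)} (hf : ContDiffOn ℝ ∞ f S) (hS : IsOpen S)
    (hy : y ∈ S) : DifferentiableAt ℝ f y :=
  (hf.contDiffAt (hS.mem_nhds hy)).differentiableAt (by simp)

theorem ricciOf_congr {Γ Γ' : ι → ι → ι → (ι → ℝ) → ℝ}
    (h : ∀ i j k, Γ i j k =ᶠ[nhds y] Γ' i j k) (i j : ι) : ricciOf Γ i j y = ricciOf Γ' i j y := by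
  simp only [ricciOf, fun i j k => (h i j k).eq_of_nhds, fun a i j k => pd_congr a (h i j k)]

theorem contDiffOn_ricciOf {S : Set (ι → ℝ)} (hS : IsOpen S) {Γ : ι → ι → ι → (ι → ℝ) → ℝ}
    (hΓ : ∀ i j k, ContDiffOn ℝ ∞ (Γ i j k) S) (i j : ι) :
    ContDiffOn ℝ ∞ (ricciOf Γ i j) S := by
  refine ContDiffOn.add (ContDiffOn.sum fun k _ => ?_)
    (ContDiffOn.sum fun k _ => ContDiffOn.sum fun l _ => ?_)
  · exact (contDiffOn_pd hS (hΓ _ _ _) _).sub (contDiffOn_pd hS (hΓ _ _ _) _)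
  · exact ((hΓ _ _ _).mul (hΓ _ _ _)).sub ((hΓ _ _ _).mul (hΓ _ _ _))

end PartialDerivatives

/-! ### Matrix-valued one-forms and their curvature. -/

section MatrixCalculus

variable {ι : Type*} [Fintype ι] [DecidableEq ι] {κ : Type*} [Fintype κ] [DecidableEq κ]

/-- The entrywise partial derivative of a matrix-valued function. -/
def mpd (i : ι) (F : (ι → ℝ) → Matrix κ κ ℝ) (y : ι → ℝ) : Matrix κ κ ℝ :=
  Matrix.of fun a b => pd i (fun z => F z a b) y

variable {F G : (ι → ℝ) → Matrix κ κ ℝ} {y : ι → ℝ}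

theorem mpd_congr (i : ι) (h : F =ᶠ[nhds y] G) : mpd i F y = mpd i G y := by
  ext a b
  exact pd_congr i (h.mono fun z hz => congrFun (congrFun hz a) b)

theorem mpd_add (i : ι) (hF : ∀ a b, DifferentiableAt ℝ (fun z => F z a b) y)
    (hG : ∀ a b, DifferentiableAt ℝ (fun z => G z a b) y) :
    mpd i (fun z => F z + G z) y = mpd i F y + mpd i G y := by
  ext a b
  exact pd_add i (hF a b) (hG a b)

theorem mpd_mul (i : ι) (hF : ∀ a b, DifferentiableAt ℝ (fun z => F z a b) y)
    (hG : ∀ a b, DifferentiableAt ℝ (fun z => G z a b) y) :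
    mpd i (fun z => F z * G z) y = mpd i F y * G y + F y * mpd i G y := by
  ext a b
  simp only [mpd, Matrix.of_apply, Matrix.mul_apply, Matrix.add_apply]
  rw [pd_sum (F := fun c z => F z a c * G z c b) _ _ fun c _ => (hF a c).mul (hG c b),
    ← Finset.sum_add_distrib]
  exact Finset.sum_congr rfl fun c _ => pd_mul i (hF a c) (hG c b)

theorem mul_apply_differentiableAt (hF : ∀ a b, DifferentiableAt ℝ (fun z => F z a b) y)
    (hG : ∀ a b, DifferentiableAt ℝ (fun z => G z a b) y) (a b : κ) :
    DifferentiableAt ℝ (fun z => (F z * G z) a b) y := by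
  simp only [Matrix.mul_apply]
  exact DifferentiableAt.fun_sum fun c _ => (hF a c).mul (hG c b)

/-- The curvature `∂ᵢAⱼ - ∂ⱼAᵢ + [Aᵢ, Aⱼ]` of a matrix-valued one-form. -/
def curvatureOf (A : ι → (ι → ℝ) → Matrix κ κ ℝ) (i j : ι) (y : ι → ℝ) : Matrix κ κ ℝ :=
  mpd i (A j) y - mpd j (A i) y + (A i y * A j y - A j y * A i y)

/-- The matrix-valued one-form `(Aᵢ)ₖₗ = Γᵏᵢₗ`. -/
def connectionMatrix (Γ : ι → ι → ι → (ι → ℝ) → ℝ) (i : ι) (y : ι → ℝ) : Matrix ι ι ℝ :=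
  Matrix.of fun k l => Γ i l k y

/-- The Ricci tensor contracts the upper index of the curvature with its first form index. In matrix
form its tensoriality splits into conjugation of the endomorphism part and pull-back of the form
part. -/
theorem ricciOf_eq_sum_curvatureOf (Γ : ι → ι → ι → (ι → ℝ) → ℝ) (i j : ι) (y : ι → ℝ) :
    ricciOf Γ i j y = ∑ k, curvatureOf (connectionMatrix Γ) k i y k j := by
  simp only [ricciOf, curvatureOf, connectionMatrix, mpd, Matrix.add_apply, Matrix.sub_apply,
    Matrix.mul_apply, Matrix.of_apply, Finset.sum_add_distrib, Finset.sum_sub_distrib]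

/-- Gauge transformation of the curvature. -/
theorem curvature_gauge {A B : ι → (ι → ℝ) → Matrix κ κ ℝ} {J : (ι → ℝ) → Matrix κ κ ℝ}
    (hA : ∀ i a b, DifferentiableAt ℝ (fun z => A i z a b) y)
    (hB : ∀ i a b, DifferentiableAt ℝ (fun z => B i z a b) y)
    (hJ : ∀ a b, DifferentiableAt ℝ (fun z => J z a b) y)
    (hJ' : ∀ i a b, DifferentiableAt ℝ (fun z => mpd i J z a b) y)
    (hsymm : ∀ i j, mpd i (mpd j J) y = mpd j (mpd i J) y)
    (h : ∀ i, (fun z => J z * A i z) =ᶠ[nhds y] fun z => B i z * J z + mpd i J z) (i j : ι) :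
    J y * curvatureOf A i j y = curvatureOf B i j y * J y := by
  have h0 : ∀ i, mpd i J y = J y * A i y - B i y * J y := fun i =>
    (sub_eq_of_eq_add' (h i).eq_of_nhds).symm
  -- The gauge relation J Aⱼ = Bⱼ J + ∂ⱼJ is differentiated along i. Skew-symmetrising in i, j
  -- removes the second derivatives of J, and `h0` eliminates the first ones.
  have h1 : ∀ i j, mpd i J y * A j y + J y * mpd i (A j) y
      = mpd i (B j) y * J y + B j y * mpd i J y + mpd i (mpd j J) y := by
    intro i j
    have := mpd_congr i (h j)
    rw [mpd_mul i hJ (hA j), mpd_add i (mul_apply_differentiableAt (hB j) hJ) (hJ' j),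
      mpd_mul i (hB j) hJ] at this
    exact this
  have e1 := h1 i j
  have e2 := h1 j i
  rw [hsymm j i] at e2
  simp only [h0] at e1 e2
  simp only [curvatureOf]
  linear_combination (norm := noncomm_ring) e1 - e2

end MatrixCalculus

/-! ### Transformation of connection coefficients and of the Ricci tensor under coordinate changes.
-/

section CoordinateChange

variable {ι : Type*} [Fintype ι] [DecidableEq ι]

/-- The Jacobian matrix of a map `φ`, with entries `∂φᵃ/∂yⁱ`. -/
def jacobian (φ : (ι → ℝ) → ι → ℝ) (y : ι → ℝ) : Matrix ι ι ℝ :=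
  Matrix.of fun a i => fderiv ℝ φ y (Pi.single i 1) a

/-- The transformation law of connection coefficients under the change of coordinates `φ`. -/
def IsConnectionPullback (φ : (ι → ℝ) → ι → ℝ) (Γ Γ' : ι → ι → ι → (ι → ℝ) → ℝ)
    (S : Set (ι → ℝ)) : Prop :=
  ∀ y ∈ S, ∀ i j c, ∑ k, jacobian φ y c k * Γ i j k y
    = ∑ b, (∑ a, jacobian φ y a i * Γ' a b c (φ y)) * jacobian φ y b j
      + pd i (fun z => jacobian φ z c j) y

variable {φ : (ι → ℝ) → ι → ℝ} {Γ Γ' : ι → ι → ι → (ι → ℝ) → ℝ} {S T : Set (ι → ℝ)}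
  {y : ι → ℝ}

theorem contDiffOn_jacobian (hS : IsOpen S) (hφ : ContDiffOn ℝ ∞ φ S) (a i : ι) :
    ContDiffOn ℝ ∞ (fun z => jacobian φ z a i) S :=
  contDiffOn_pi.mp ((hφ.fderiv_of_isOpen (m := ∞) hS (by simp)).clm_apply
    (contDiffOn_const (c := (Pi.single i 1 : ι → ℝ)))) a

theorem pd_eq_jacobian (hS : IsOpen S) (hφ : ContDiffOn ℝ ∞ φ S) (hy : y ∈ S) (a i : ι) :
    pd i (fun z => φ z a) y = jacobian φ y a i :=
  pd_eq_fderiv_apply i a ((hφ.contDiffAt (hS.mem_nhds hy)).differentiableAt (by simp))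

theorem pd_jacobian_comm (hS : IsOpen S) (hφ : ContDiffOn ℝ ∞ φ S) (hy : y ∈ S) (a i j : ι) :
    pd i (fun z => jacobian φ z a j) y = pd j (fun z => jacobian φ z a i) y := by
  have h : ∀ i j, pd i (fun z => jacobian φ z a j) y = pd i (pd j fun z => φ z a) y := by
    intro i j
    refine pd_congr i ?_
    filter_upwards [hS.mem_nhds hy] with z hz
    exact (pd_eq_jacobian hS hφ hz a j).symm
  rw [h, h, pd_comm hS (contDiffOn_pi.mp hφ a) hy]

/-- The matrix-valued one-form `Σₐ Jᵃᵢ Γ'ₐ` pulled back from the target coordinates. -/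
def pullbackMatrix (φ : (ι → ℝ) → ι → ℝ) (Γ' : ι → ι → ι → (ι → ℝ) → ℝ) (i : ι) (y : ι → ℝ) :
    Matrix ι ι ℝ :=
  Matrix.of fun c b => ∑ a, jacobian φ y a i * Γ' a b c (φ y)

theorem IsConnectionPullback.matrix (h : IsConnectionPullback φ Γ Γ' S) (hy : y ∈ S) (i : ι) :
    jacobian φ y * connectionMatrix Γ i y
      = pullbackMatrix φ Γ' i y * jacobian φ y + mpd i (jacobian φ) y := by
  ext c j
  simpa only [Matrix.mul_apply, Matrix.add_apply, connectionMatrix, pullbackMatrix, mpd,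
    Matrix.of_apply] using h y hy i j c

theorem contDiffOn_pullbackMatrix (hS : IsOpen S) (hφ : ContDiffOn ℝ ∞ φ S)
    (hST : MapsTo φ S T) (hΓ' : ∀ i j k, ContDiffOn ℝ ∞ (Γ' i j k) T) (i c b : ι) :
    ContDiffOn ℝ ∞ (fun z => pullbackMatrix φ Γ' i z c b) S := by
  simp only [pullbackMatrix, Matrix.of_apply]
  exact ContDiffOn.sum fun a _ =>
    (contDiffOn_jacobian hS hφ a i).mul ((hΓ' a b c).comp hφ hST)

/-- The product rule produces second derivatives of `φ`; they are symmetric in the two form indices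
(`pd_jacobian_comm`) and cancel in the curvature, so the form part pulls back tensorially. -/
theorem curvatureOf_pullbackMatrix (hS : IsOpen S) (hT : IsOpen T) (hφ : ContDiffOn ℝ ∞ φ S)
    (hST : MapsTo φ S T) (hΓ' : ∀ i j k, ContDiffOn ℝ ∞ (Γ' i j k) T) (hy : y ∈ S) (i j c d : ι) :
    curvatureOf (pullbackMatrix φ Γ') i j y c d = ∑ a, ∑ b, jacobian φ y a i * jacobian φ y b j *
      curvatureOf (connectionMatrix Γ') a b (φ y) c d := by
  have hφy : DifferentiableAt ℝ φ y :=
    (hφ.contDiffAt (hS.mem_nhds hy)).differentiableAt (by simp)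
  have hΓd : ∀ i j k, DifferentiableAt ℝ (Γ' i j k) (φ y) := fun i j k =>
    (hΓ' i j k).diffAt hT (hST hy)
  have hd : ∀ i j, mpd i (pullbackMatrix φ Γ' j) y c d
      = ∑ b, pd i (fun z => jacobian φ z b j) y * Γ' b d c (φ y)
        + ∑ a, ∑ b, jacobian φ y a i * jacobian φ y b j * pd a (Γ' b d c) (φ y) := by
    intro i j
    simp only [mpd, pullbackMatrix, Matrix.of_apply]
    have hJ := fun b => (contDiffOn_jacobian hS hφ b j).diffAt hS hy
    have hG : ∀ b, DifferentiableAt ℝ (fun z => Γ' b d c (φ z)) y :=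
      fun b => (hΓd b d c).comp y hφy
    rw [pd_sum (F := fun a z => jacobian φ z a j * Γ' a d c (φ z)) _ _
      fun a _ => (hJ a).mul (hG a)]
    rw [Finset.sum_comm (f := fun a b => jacobian φ y a i * jacobian φ y b j *
      pd a (Γ' b d c) (φ y)), ← Finset.sum_add_distrib]
    refine Finset.sum_congr rfl fun b _ => ?_
    rw [pd_mul i (hJ b) (hG b), pd_comp i (hΓd b d c) hφy, Finset.mul_sum]
    refine congrArg _ (Finset.sum_congr rfl fun a _ => ?_)
    rw [pd_eq_jacobian hS hφ hy]
    ring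
  have hm : ∀ i j, (pullbackMatrix φ Γ' i y * pullbackMatrix φ Γ' j y) c d
      = ∑ a, ∑ b, jacobian φ y a i * jacobian φ y b j *
        (connectionMatrix Γ' a (φ y) * connectionMatrix Γ' b (φ y)) c d := by
    intro i j
    simp only [Matrix.mul_apply, pullbackMatrix, connectionMatrix, Matrix.of_apply,
      Finset.sum_mul_sum]
    simp only [Finset.mul_sum]
    rw [Finset.sum_comm]
    refine Finset.sum_congr rfl fun a _ => ?_
    rw [Finset.sum_comm]
    exact Finset.sum_congr rfl fun b _ => Finset.sum_congr rfl fun k _ => by ring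
  simp only [curvatureOf, Matrix.add_apply, Matrix.sub_apply, hd, hm,
    pd_jacobian_comm hS hφ hy _ i j]
  rw [Finset.sum_comm (f := fun a b => jacobian φ y a j * jacobian φ y b i *
    pd a (Γ' b d c) (φ y)), Finset.sum_comm (f := fun a b => jacobian φ y a j *
    jacobian φ y b i * (connectionMatrix Γ' a (φ y) * connectionMatrix Γ' b (φ y)) c d)]
  rw [add_sub_add_left_eq_sub]
  simp only [← Finset.sum_sub_distrib, ← Finset.sum_add_distrib]
  refine Finset.sum_congr rfl fun a _ => Finset.sum_congr rfl fun b _ => ?_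
  simp only [mpd, connectionMatrix, Matrix.of_apply]
  ring

/-- The transformation law of connection coefficients says that the Jacobian is a gauge
transformation between the connection of `Γ` and the pulled-back one. -/
theorem curvatureOf_pullback (hS : IsOpen S) (hφ : ContDiffOn ℝ ∞ φ S)
    (hST : MapsTo φ S T) (hΓ : ∀ i j k, ContDiffOn ℝ ∞ (Γ i j k) S)
    (hΓ' : ∀ i j k, ContDiffOn ℝ ∞ (Γ' i j k) T) (h : IsConnectionPullback φ Γ Γ' S) (hy : y ∈ S)
    (i j : ι) :
    jacobian φ y * curvatureOf (connectionMatrix Γ) i j y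
      = curvatureOf (pullbackMatrix φ Γ') i j y * jacobian φ y := by
  refine curvature_gauge (fun i a b => (hΓ i b a).diffAt hS hy)
    (fun i a b => (contDiffOn_pullbackMatrix hS hφ hST hΓ' i a b).diffAt hS hy)
    (fun a b => (contDiffOn_jacobian hS hφ a b).diffAt hS hy)
    (fun i a b => (contDiffOn_pd hS (contDiffOn_jacobian hS hφ a b) i).diffAt hS hy)
    ?_ ?_ i j
  · intro i j
    ext a b
    exact pd_comm hS (contDiffOn_jacobian hS hφ a b) hy i j
  · intro i
    filter_upwards [hS.mem_nhds hy] with z hz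
    exact h.matrix hz i

/-- The Ricci tensor transforms as a tensor. -/
theorem ricciOf_pullback (hS : IsOpen S) (hT : IsOpen T) (hφ : ContDiffOn ℝ ∞ φ S)
    (hST : MapsTo φ S T) (hΓ : ∀ i j k, ContDiffOn ℝ ∞ (Γ i j k) S)
    (hΓ' : ∀ i j k, ContDiffOn ℝ ∞ (Γ' i j k) T) (h : IsConnectionPullback φ Γ Γ' S) (hy : y ∈ S)
    (hu : IsUnit (jacobian φ y).det) (i j : ι) :
    ricciOf Γ i j y = ∑ a, ∑ b, jacobian φ y a i * jacobian φ y b j * ricciOf Γ' a b (φ y) := by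
  set J := jacobian φ y with hJ
  set F := fun a b => curvatureOf (connectionMatrix Γ') a b (φ y) with hF
  have hc : ∀ k, curvatureOf (connectionMatrix Γ) k i y k j
      = ∑ d, ∑ c, ∑ a, ∑ b, (J a k * J⁻¹ k c) * (J b i * J d j * F a b c d) := by
    intro k
    have h1 := curvatureOf_pullback hS hφ hST hΓ hΓ' h hy k i
    have h2 : curvatureOf (connectionMatrix Γ) k i y
        = J⁻¹ * (curvatureOf (pullbackMatrix φ Γ') k i y * J) := by
      rw [← h1, Matrix.nonsing_inv_mul_cancel_left _ _ hu]
    rw [h2, ← Matrix.mul_assoc, Matrix.mul_apply]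
    refine Finset.sum_congr rfl fun d _ => ?_
    rw [Matrix.mul_apply, Finset.sum_mul]
    refine Finset.sum_congr rfl fun c _ => ?_
    rw [curvatureOf_pullbackMatrix hS hT hφ hST hΓ' hy, Finset.mul_sum, Finset.sum_mul]
    refine Finset.sum_congr rfl fun a _ => ?_
    rw [Finset.mul_sum, Finset.sum_mul]
    exact Finset.sum_congr rfl fun b _ => by ring
  -- Tracing over k pairs the Jacobian of the first form index with the inverse Jacobian of the
  -- upper index, and the two cancel.
  have hI : ∀ a c, ∑ k, J a k * J⁻¹ k c = if a = c then 1 else 0 := by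
    intro a c
    rw [← Matrix.mul_apply, Matrix.mul_nonsing_inv _ hu, Matrix.one_apply]
  rw [ricciOf_eq_sum_curvatureOf]
  simp only [hc]
  rw [Finset.sum_comm, Finset.sum_comm (f := fun a b => J a i * J b j * ricciOf Γ' a b (φ y))]
  refine Finset.sum_congr rfl fun d _ => ?_
  have h3 : ∑ k, ∑ c, ∑ a, ∑ b, (J a k * J⁻¹ k c) * (J b i * J d j * F a b c d)
      = ∑ c, ∑ a, ∑ b, ∑ k, (J a k * J⁻¹ k c) * (J b i * J d j * F a b c d) := by
    rw [Finset.sum_comm]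
    refine Finset.sum_congr rfl fun c _ => ?_
    rw [Finset.sum_comm]
    refine Finset.sum_congr rfl fun a _ => ?_
    rw [Finset.sum_comm]
  rw [h3]
  simp only [← Finset.sum_mul, hI, ite_mul, one_mul, zero_mul]
  have h4 : ∀ c, ∑ a, ∑ b, (if a = c then J b i * J d j * F a b c d else 0)
      = ∑ b, J b i * J d j * F c b c d := by
    intro c
    rw [Finset.sum_comm]
    exact Finset.sum_congr rfl fun b _ => by simp
  simp only [h4]
  rw [Finset.sum_comm]
  refine Finset.sum_congr rfl fun b _ => ?_
  rw [ricciOf_eq_sum_curvatureOf, Finset.mul_sum]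

/-- The transformation law of the traces `Γᵏᵢₖ`. -/
theorem IsConnectionPullback.trace (h : IsConnectionPullback φ Γ Γ' S) (hy : y ∈ S)
    (hu : IsUnit (jacobian φ y).det) (i : ι) :
    ∑ k, Γ i k k y = ∑ a, jacobian φ y a i * ∑ c, Γ' a c c (φ y)
      + ((jacobian φ y)⁻¹ * mpd i (jacobian φ) y).trace := by
  have h1 : connectionMatrix Γ i y = (jacobian φ y)⁻¹ * (pullbackMatrix φ Γ' i y * jacobian φ y)
      + (jacobian φ y)⁻¹ * mpd i (jacobian φ) y := by
    rw [← Matrix.mul_add, ← h.matrix hy, Matrix.nonsing_inv_mul_cancel_left _ _ hu]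
  have h2 := congrArg Matrix.trace h1
  -- Conjugation by the Jacobian does not affect the trace, so beside the pulled-back trace only the
  -- inhomogeneous term remains.
  rw [Matrix.trace_add, Matrix.trace_mul_comm, Matrix.mul_nonsing_inv_cancel_right _ _ hu] at h2
  refine Eq.trans h2 (congrArg (· + _) ?_)
  simp only [Matrix.trace, Matrix.diag_apply, pullbackMatrix, Matrix.of_apply, Finset.mul_sum]
  exact Finset.sum_comm

end CoordinateChange

/-! ### The Schouten tensor of connection coefficients. -/

section Schouten

variable {n : ℕ}

/-- The projective Schouten tensor of connection coefficients. -/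
def schoutenOf (Γ : Fin n → Fin n → Fin n → Rn n → ℝ) (i j : Fin n) (x : Rn n) : ℝ :=
  (ricciOf Γ i j x + ricciOf Γ j i x) / (2 * ((n : ℝ) - 1))
    + (ricciOf Γ i j x - ricciOf Γ j i x) / (2 * ((n : ℝ) + 1))

variable {Γ Γ' : Fin n → Fin n → Fin n → Rn n → ℝ} {S T : Set (Rn n)} {x : Rn n}

theorem contDiffOn_schoutenOf (hS : IsOpen S) (hΓ : ∀ i j k, ContDiffOn ℝ ∞ (Γ i j k) S)
    (i j : Fin n) : ContDiffOn ℝ ∞ (schoutenOf Γ i j) S := by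
  have h := contDiffOn_ricciOf hS hΓ
  exact (((h i j).add (h j i)).div_const _).add (((h i j).sub (h j i)).div_const _)

theorem schoutenOf_congr (h : ∀ i j k, Γ i j k =ᶠ[nhds x] Γ' i j k) (i j : Fin n) :
    schoutenOf Γ i j x = schoutenOf Γ' i j x := by
  simp only [schoutenOf, ricciOf_congr h]

theorem schoutenOf_pullback {φ : Rn n → Rn n} (hS : IsOpen S) (hT : IsOpen T)
    (hφ : ContDiffOn ℝ ∞ φ S) (hST : MapsTo φ S T) (hΓ : ∀ i j k, ContDiffOn ℝ ∞ (Γ i j k) S)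
    (hΓ' : ∀ i j k, ContDiffOn ℝ ∞ (Γ' i j k) T) (h : IsConnectionPullback φ Γ Γ' S) (hx : x ∈ S)
    (hu : IsUnit (jacobian φ x).det) (i j : Fin n) :
    schoutenOf Γ i j x
      = ∑ a, ∑ b, jacobian φ x a i * jacobian φ x b j * schoutenOf Γ' a b (φ x) := by
  have hR := ricciOf_pullback hS hT hφ hST hΓ hΓ' h hx hu
  have hR' : ricciOf Γ j i x
      = ∑ a, ∑ b, jacobian φ x a i * jacobian φ x b j * ricciOf Γ' b a (φ x) := by
    rw [hR, Finset.sum_comm]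
    exact Finset.sum_congr rfl fun a _ => Finset.sum_congr rfl fun b _ => by ring
  simp only [schoutenOf]
  rw [hR', hR]
  simp only [← Finset.sum_add_distrib, ← Finset.sum_sub_distrib, Finset.sum_div]
  exact Finset.sum_congr rfl fun a _ => Finset.sum_congr rfl fun b _ => by ring

end Schouten

/-! ### Ricci and Schouten tensors under a projective change. -/

section ProjectiveChange

variable {n : ℕ} {Γ : Fin n → Fin n → Fin n → Rn n → ℝ} {Υ : Fin n → Rn n → ℝ} {x : Rn n}

/-- The connection coefficients `Γᵏᵢⱼ + Υᵢ δᵏⱼ + Υⱼ δᵏᵢ`. -/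
def projectiveChange (Γ : Fin n → Fin n → Fin n → Rn n → ℝ) (Υ : Fin n → Rn n → ℝ)
    (i j k : Fin n) (x : Rn n) : ℝ :=
  Γ i j k x + (Υ i x * (if k = j then 1 else 0) + Υ j x * (if k = i then 1 else 0))

theorem ricciOf_projectiveChange (hΓ : ∀ i j k, DifferentiableAt ℝ (Γ i j k) x)
    (hΥ : ∀ i, DifferentiableAt ℝ (Υ i) x) (hs : ∀ i j k, Γ i j k x = Γ j i k x) (i j : Fin n) :
    ricciOf (projectiveChange Γ Υ) i j x = ricciOf Γ i j x + pd j (Υ i) x - n * pd i (Υ j) x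
      + (n - 1) * ∑ l, Γ i j l x * Υ l x + (n - 1) * (Υ i x * Υ j x) := by
  have hpd : ∀ a i j k, pd a (projectiveChange Γ Υ i j k) x = pd a (Γ i j k) x +
      (pd a (Υ i) x * (if k = j then 1 else 0) + pd a (Υ j) x * (if k = i then 1 else 0)) := by
    intro a i j k
    have h : ∀ (i : Fin n) (c : ℝ), DifferentiableAt ℝ (fun z => Υ i z * c) x :=
      fun i c => (hΥ i).mul_const c
    have e : projectiveChange Γ Υ i j k = fun x => Γ i j k x +
      (Υ i x * (if k = j then 1 else 0) + Υ j x * (if k = i then 1 else 0)) := rfl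
    rw [e, pd_add a (hΓ i j k) ((h _ _).fun_add (h _ _)), pd_add a (h _ _) (h _ _),
      pd_mul a (hΥ i) (by fun_prop), pd_mul a (hΥ j) (by fun_prop)]
    simp
  have h1 : ∑ k, (pd k (projectiveChange Γ Υ i j k) x - pd i (projectiveChange Γ Υ k j k) x)
      = ∑ k, (pd k (Γ i j k) x - pd i (Γ k j k) x) + pd j (Υ i) x - n * pd i (Υ j) x := by
    simp only [hpd, Finset.sum_sub_distrib, Finset.sum_add_distrib, mul_ite, mul_one, mul_zero,
      Finset.sum_ite_eq', Finset.mem_univ, if_true, Finset.sum_const, Finset.card_univ,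
      Fintype.card_fin, nsmul_eq_mul]
    ring
  -- All products are expanded into Kronecker deltas arranged so that each one collapses a single
  -- summation; the undetermined traces δᵏₖ then produce the factors n.
  have h2 : ∀ k l, projectiveChange Γ Υ k l k x * projectiveChange Γ Υ i j l x
        - projectiveChange Γ Υ i l k x * projectiveChange Γ Υ k j l x
      = (Γ k l k x * Γ i j l x - Γ i l k x * Γ k j l x)
        + (if l = j then Γ k l k x * Υ i x else 0) + (if l = i then Γ k l k x * Υ j x else 0)
        + (if k = l then Υ k x * Γ i j l x else 0) + Υ l x * Γ i j l x
        + (if k = l then (if l = j then Υ k x * Υ i x else 0) else 0)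
        + (if k = l then (if l = i then Υ k x * Υ j x else 0) else 0)
        + (if l = j then Υ l x * Υ i x else 0) + (if l = i then Υ l x * Υ j x else 0)
        - (if l = j then Γ i l k x * Υ k x else 0) - (if l = k then Γ i l k x * Υ j x else 0)
        - (if k = l then Υ i x * Γ k j l x else 0) - (if k = i then Υ l x * Γ k j l x else 0)
        - (if k = l then (if l = j then Υ i x * Υ k x else 0) else 0)
        - (if k = l then Υ i x * Υ j x else 0)
        - (if k = i then (if l = j then Υ l x * Υ k x else 0) else 0)
        - (if k = i then (if l = k then Υ l x * Υ j x else 0) else 0) := by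
    intro k l
    simp only [projectiveChange, if_true, mul_one, eq_comm (a := l) (b := k)]
    split_ifs <;> ring
  have h3 : ∑ k, ∑ l, (projectiveChange Γ Υ k l k x * projectiveChange Γ Υ i j l x
        - projectiveChange Γ Υ i l k x * projectiveChange Γ Υ k j l x)
      = ∑ k, ∑ l, (Γ k l k x * Γ i j l x - Γ i l k x * Γ k j l x)
      + (n - 1) * ∑ l, Γ i j l x * Υ l x + (n - 1) * (Υ i x * Υ j x) := by
    simp only [h2, Finset.sum_sub_distrib, Finset.sum_add_distrib, Finset.sum_ite_eq,
      Finset.sum_ite_eq', Finset.mem_univ, if_true, Finset.sum_const, Finset.card_univ,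
      Fintype.card_fin, nsmul_eq_mul, Finset.sum_ite_irrel, mul_zero]
    have e1 : ∑ k, Γ k j k x * Υ i x = ∑ k, Υ i x * Γ k j k x :=
      Finset.sum_congr rfl fun k _ => mul_comm _ _
    have e2 : ∑ k, Γ k i k x * Υ j x = ∑ k, Υ j x * Γ i k k x :=
      Finset.sum_congr rfl fun k _ => by rw [hs, mul_comm]
    have e4 : ∑ k, Γ i k k x * Υ j x = ∑ k, Υ j x * Γ i k k x :=
      Finset.sum_congr rfl fun k _ => mul_comm _ _
    have e5 : ∑ l, Υ l x * Γ i j l x = ∑ k, Γ i j k x * Υ k x :=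
      Finset.sum_congr rfl fun k _ => mul_comm _ _
    have e3 : ∑ k, Υ k x * Γ i j k x = ∑ k, Γ i j k x * Υ k x :=
      Finset.sum_congr rfl fun k _ => mul_comm _ _
    rw [e1, e2, e3]
    ring_nf
  simp only [ricciOf]
  rw [h1, h3]
  ring

/-- In the change of the Ricci tensor the term ∂ⱼΥᵢ - n∂ᵢΥⱼ has symmetric part -(n-1) and skew part
-(n+1) times that of ∂ᵢΥⱼ. The separate normalisations in the Schouten tensor turn it into -∂ᵢΥⱼ;
the first one needs n ≠ 1. -/
theorem schoutenOf_projectiveChange (hn : 2 ≤ n) (hΓ : ∀ i j k, DifferentiableAt ℝ (Γ i j k) x)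
    (hΥ : ∀ i, DifferentiableAt ℝ (Υ i) x) (hs : ∀ i j k, Γ i j k x = Γ j i k x) (i j : Fin n) :
    schoutenOf (projectiveChange Γ Υ) i j x = schoutenOf Γ i j x
      - (pd i (Υ j) x - ∑ l, Γ i j l x * Υ l x) + Υ i x * Υ j x := by
  have h1 : (n : ℝ) - 1 ≠ 0 := by
    have : (2 : ℝ) ≤ n := by exact_mod_cast hn
    linarith
  have h2 : (n : ℝ) + 1 ≠ 0 := by positivity
  have hΓΥ : ∑ l, Γ j i l x * Υ l x = ∑ l, Γ i j l x * Υ l x :=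
    Finset.sum_congr rfl fun l _ => by rw [hs]
  simp only [schoutenOf, ricciOf_projectiveChange hΓ hΥ hs, hΓΥ]
  field_simp
  ring

end ProjectiveChange

/-! ### Closedness of the skew part of the Schouten tensor. -/

section Closed

variable {n : ℕ} {Γ : Fin n → Fin n → Fin n → Rn n → ℝ} {S : Set (Rn n)} {x : Rn n}

/-- For symmetric connection coefficients the skew part of the Ricci tensor is exact. -/
theorem ricciOf_sub_swap (hS : IsOpen S) (hΓ : ∀ i j k, ContDiffOn ℝ ∞ (Γ i j k) S)
    (hs : ∀ x ∈ S, ∀ i j k, Γ i j k x = Γ j i k x) (hx : x ∈ S) (i j : Fin n) :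
    ricciOf Γ i j x - ricciOf Γ j i x
      = pd j (fun z => ∑ k, Γ k i k z) x - pd i (fun z => ∑ k, Γ k j k z) x := by
  have hd := fun i j k => (hΓ i j k).diffAt hS hx
  have h1 : ∀ i j k a, pd a (Γ i j k) x = pd a (Γ j i k) x := fun i j k a =>
    pd_congr a (by filter_upwards [hS.mem_nhds hx] with z hz using hs z hz i j k)
  -- For symmetric coefficients the quadratic part of the Ricci tensor is symmetric, in its second
  -- term after exchanging the summation indices. Only the curl of the trace survives in the
  -- difference.
  have h2 : ∑ k, ∑ l, (Γ k l k x * Γ i j l x - Γ i l k x * Γ k j l x)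
      = ∑ k, ∑ l, (Γ k l k x * Γ j i l x - Γ j l k x * Γ k i l x) := by
    simp only [Finset.sum_sub_distrib]
    congr 1
    · exact Finset.sum_congr rfl fun k _ => Finset.sum_congr rfl fun l _ => by rw [hs x hx i j]
    · rw [Finset.sum_comm]
      refine Finset.sum_congr rfl fun k _ => Finset.sum_congr rfl fun l _ => ?_
      rw [hs x hx i k, hs x hx l j, mul_comm]
  simp only [ricciOf]
  rw [h2, pd_sum _ _ fun k _ => hd k i k, pd_sum _ _ fun k _ => hd k j k]
  simp only [Finset.sum_sub_distrib, h1 j i]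
  ring

theorem schoutenOf_sub_swap (hS : IsOpen S) (hΓ : ∀ i j k, ContDiffOn ℝ ∞ (Γ i j k) S)
    (hs : ∀ x ∈ S, ∀ i j k, Γ i j k x = Γ j i k x) (hx : x ∈ S) (i j : Fin n) :
    schoutenOf Γ i j x - schoutenOf Γ j i x
      = (pd j (fun z => ∑ k, Γ k i k z) x - pd i (fun z => ∑ k, Γ k j k z) x) / (n + 1) := by
  rw [← ricciOf_sub_swap hS hΓ hs hx]
  have h2 : (n : ℝ) + 1 ≠ 0 := by positivity
  simp only [schoutenOf]
  field_simp
  ring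

/-- The skew part of the Schouten tensor is closed. -/
theorem schoutenOf_closed (hS : IsOpen S) (hΓ : ∀ i j k, ContDiffOn ℝ ∞ (Γ i j k) S)
    (hs : ∀ x ∈ S, ∀ i j k, Γ i j k x = Γ j i k x) (hx : x ∈ S) (a b c : Fin n) :
    pd a (fun z => schoutenOf Γ b c z - schoutenOf Γ c b z) x
      + pd b (fun z => schoutenOf Γ c a z - schoutenOf Γ a c z) x
      + pd c (fun z => schoutenOf Γ a b z - schoutenOf Γ b a z) x = 0 := by
  have ht : ∀ i, ContDiffOn ℝ ∞ (fun z => ∑ k, Γ k i k z) S := fun i =>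
    ContDiffOn.sum fun k _ => hΓ k i k
  have h : ∀ a i j, pd a (fun z => schoutenOf Γ i j z - schoutenOf Γ j i z) x
      = (pd a (pd j fun z => ∑ k, Γ k i k z) x - pd a (pd i fun z => ∑ k, Γ k j k z) x)
        / (n + 1) := by
    intro a i j
    rw [← pd_sub a ((contDiffOn_pd hS (ht i) j).diffAt hS hx)
      ((contDiffOn_pd hS (ht j) i).diffAt hS hx), ← pd_div_const]
    refine pd_congr a ?_
    filter_upwards [hS.mem_nhds hx] with z hz
    exact schoutenOf_sub_swap hS hΓ hs hz i j
  simp only [h]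
  -- The exterior derivative of a curl: six mixed second derivatives of the traces cancel in pairs.
  rw [pd_comm hS (ht c) hx a b, pd_comm hS (ht a) hx b c, pd_comm hS (ht b) hx c a]
  ring

end Closed

open Sum (inl inr)

/-! ### The Levi-Civita connection in terms of metric components. -/

section Metric

variable {ι : Type*} [Fintype ι] [DecidableEq ι]

/-- The Christoffel symbols of the Levi-Civita connection of a metric with components `G`. -/
def leviCivitaOf (G : ι → ι → (ι → ℝ) → ℝ) (a b c : ι) (y : ι → ℝ) : ℝ :=
  1 / 2 * ∑ d, (Matrix.of fun a b => G a b y)⁻¹ c d *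
    (pd a (G b d) y + pd b (G a d) y - pd d (G a b) y)

theorem leviCivitaOf_congr {G G' : ι → ι → (ι → ℝ) → ℝ} {y : ι → ℝ}
    (h : ∀ a b, G a b =ᶠ[nhds y] G' a b) (a b c : ι) :
    leviCivitaOf G a b c y = leviCivitaOf G' a b c y := by
  simp only [leviCivitaOf, fun a b => (h a b).eq_of_nhds, fun a b c => pd_congr c (h a b)]

end Metric

/-! ### Walker metrics: Christoffel symbols and Ricci tensor. -/

section Walker

variable {ι : Type*} [Fintype ι] [DecidableEq ι]

/-- The components of the metric `Aᵢⱼ dxⁱ dxʲ + dξᵢ ⊙ dxⁱ`. -/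
def walkerMetric (A : ι → ι → (ι ⊕ ι → ℝ) → ℝ) : ι ⊕ ι → ι ⊕ ι → (ι ⊕ ι → ℝ) → ℝ
  | inl i, inl j => A i j
  | inl i, inr j => fun _ => if i = j then 1 / 2 else 0
  | inr i, inl j => fun _ => if i = j then 1 / 2 else 0
  | inr _, inr _ => fun _ => 0

/-- The components of the inverse of `walkerMetric`. -/
def walkerInverse (A : ι → ι → (ι ⊕ ι → ℝ) → ℝ) (y : ι ⊕ ι → ℝ) : ι ⊕ ι → ι ⊕ ι → ℝ
  | inl _, inl _ => 0
  | inl i, inr j => if i = j then 2 else 0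
  | inr i, inl j => if i = j then 2 else 0
  | inr i, inr j => -4 * A i j y

/-- The Christoffel symbols of `walkerMetric`. -/
def walkerConnection (A : ι → ι → (ι ⊕ ι → ℝ) → ℝ) :
    ι ⊕ ι → ι ⊕ ι → ι ⊕ ι → (ι ⊕ ι → ℝ) → ℝ
  | inl i, inl j, inl k => fun y => -pd (inr k) (A i j) y
  | inl i, inl j, inr k => fun y => pd (inl i) (A j k) y + pd (inl j) (A i k) y
      - pd (inl k) (A i j) y + 2 * ∑ l, A k l y * pd (inr l) (A i j) y
  | inl i, inr j, inr k => pd (inr j) (A i k)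
  | inr j, inl i, inr k => pd (inr j) (A i k)
  | _, _, _ => fun _ => 0

variable {A : ι → ι → (ι ⊕ ι → ℝ) → ℝ} {y : ι ⊕ ι → ℝ}

theorem walkerMetric_inv (A : ι → ι → (ι ⊕ ι → ℝ) → ℝ) (y : ι ⊕ ι → ℝ) :
    (Matrix.of fun a b => walkerMetric A a b y)⁻¹ = Matrix.of (walkerInverse A y) := by
  refine Matrix.inv_eq_right_inv ?_
  ext a b
  rcases a with i | i <;> rcases b with j | j <;>
    simp [Matrix.mul_apply, walkerMetric, walkerInverse, Matrix.one_apply]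
  ring

/-- All entries except the block A are constant, so only derivatives of A enter, and the inverse
matrix is known explicitly from `walkerMetric_inv`. -/
theorem leviCivitaOf_walkerMetric (hs : ∀ i j, A i j =ᶠ[nhds y] A j i) (a b c : ι ⊕ ι) :
    leviCivitaOf (walkerMetric A) a b c y = walkerConnection A a b c y := by
  have h1 : ∀ i j a, pd a (A i j) y = pd a (A j i) y := fun i j a => pd_congr a (hs i j)
  rw [leviCivitaOf, walkerMetric_inv]
  rcases a with i | i <;> rcases b with j | j <;> rcases c with k | k <;>
    simp [walkerMetric, walkerInverse, walkerConnection]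
  · have h2 : ∑ l, A k l y * pd (inr l) (A i j) y * 2
        = (2 : ℝ)⁻¹ * ∑ l, 4 * A k l y * pd (inr l) (A i j) y := by
      rw [Finset.mul_sum]
      exact Finset.sum_congr rfl fun l _ => by ring
    rw [Finset.mul_sum (a := (2 : ℝ))]
    have h3 : ∀ l, 2 * (A k l y * pd (inr l) (A i j) y) = A k l y * pd (inr l) (A i j) y * 2 :=
      fun l => by ring
    simp only [h3, h2]
    ring

/-- The Ricci tensor of `walkerMetric`. -/
theorem ricciOf_walkerConnection (hs : ∀ i j, A i j =ᶠ[nhds y] A j i) :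
    (∀ i j, ricciOf (walkerConnection A) (inr i) (inr j) y = 0) ∧
    (∀ i j, ricciOf (walkerConnection A) (inl i) (inr j) y
      = ∑ k, pd (inr k) (pd (inr j) (A i k)) y) ∧
    (∀ i j, ricciOf (walkerConnection A) (inr i) (inl j) y
      = ∑ k, pd (inr k) (pd (inr i) (A j k)) y) ∧
    (∀ i j, ricciOf (walkerConnection A) (inl i) (inl j) y
      = ∑ k, (-pd (inl k) (pd (inr k) (A i j)) y
          + pd (inr k) (walkerConnection A (inl i) (inl j) (inr k)) y)
        - ∑ k, ∑ l, (pd (inr k) (A i l) y * pd (inr l) (A k j) y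
          + pd (inr l) (A i k) y * pd (inr k) (A j l) y)) := by
  have h1 : ∀ i j a, pd a (A i j) y = pd a (A j i) y := fun i j a => pd_congr a (hs i j)
  -- The Ricci tensor differentiates A twice, so the symmetry of A is needed in a neighbourhood of
  -- the point and not only at it.
  have h2 : ∀ i j a b, pd a (pd b (A i j)) y = pd a (pd b (A j i)) y := fun i j a b =>
    pd_congr a ((hs i j).eventuallyEq_nhds.mono fun z hz => pd_congr b hz)
  refine ⟨?_, ?_, ?_, ?_⟩ <;> intro i j
  · simp [ricciOf, walkerConnection]
  · simp [ricciOf, walkerConnection]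
  · simp [ricciOf, walkerConnection, h1]
    rw [← Finset.sum_add_distrib]
    exact Finset.sum_eq_zero fun k _ => by rw [pd_neg, h2 k j]; ring
  · have h3 : ∑ k, ∑ l, pd (inr k) (A l k) y * pd (inr l) (A i j) y
        = ∑ k, ∑ l, pd (inr k) (A k l) y * pd (inr l) (A i j) y :=
      Finset.sum_congr rfl fun k _ => Finset.sum_congr rfl fun l _ => by rw [h1 l k]
    have h4 : ∀ b, ∑ k, pd b (pd (inr k) (A k j)) y = ∑ k, pd b (pd (inr k) (A j k)) y :=
      fun b => Finset.sum_congr rfl fun k _ => h2 k j _ _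
    simp [ricciOf, walkerConnection, Finset.sum_add_distrib, pd_neg, h3, h4]
    ring

end Walker

/-! ### The Walker coefficients of a connection and their derivatives. -/

section Fefferman

variable {n : ℕ} {Γ : Fin n → Fin n → Fin n → Rn n → ℝ} {S : Set (Rn n)}
  {y : Fin n ⊕ Fin n → ℝ}

/-- The base coordinates `x` of `(x, ξ)`. -/
def basePart (y : Fin n ⊕ Fin n → ℝ) : Rn n := fun i => y (inl i)

theorem contDiff_basePart : ContDiff ℝ ∞ (basePart : (Fin n ⊕ Fin n → ℝ) → Rn n) :=
  contDiff_pi.mpr fun i => contDiff_apply ℝ ℝ (inl i)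

theorem pd_inl_comp_basePart {f : Rn n → ℝ} (hf : DifferentiableAt ℝ f (basePart y)) (i : Fin n) :
    pd (inl i) (fun z => f (basePart z)) y = pd i f (basePart y) := by
  rw [pd_comp (inl i) hf ((contDiff_basePart.contDiffAt).differentiableAt (by simp))]
  simp [basePart, pd_coord]

theorem pd_inr_comp_basePart {f : Rn n → ℝ} (hf : DifferentiableAt ℝ f (basePart y)) (i : Fin n) :
    pd (inr i) (fun z => f (basePart z)) y = 0 := by
  rw [pd_comp (inr i) hf ((contDiff_basePart.contDiffAt).differentiableAt (by simp))]
  simp [basePart, pd_coord]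

/-- The symmetric part of the Schouten tensor. -/
def schoutenSymm (Γ : Fin n → Fin n → Fin n → Rn n → ℝ) (i j : Fin n) (x : Rn n) : ℝ :=
  (schoutenOf Γ i j x + schoutenOf Γ j i x) / 2

/-- The coefficients `-(Γᵏᵢⱼ ξₖ - ξᵢ ξⱼ - P₍ᵢⱼ₎)` of `dxⁱ dxʲ` in the metric. -/
def metricCoeff (Γ : Fin n → Fin n → Fin n → Rn n → ℝ) (i j : Fin n) (y : Fin n ⊕ Fin n → ℝ) :
    ℝ :=
  -(∑ k, Γ i j k (basePart y) * y (inr k)) + y (inr i) * y (inr j)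
    + schoutenSymm Γ i j (basePart y)

/-- The derivative of `metricCoeff Γ i j` in the direction `∂/∂ξₖ`. -/
def metricCoeffVert (Γ : Fin n → Fin n → Fin n → Rn n → ℝ) (i j k : Fin n)
    (y : Fin n ⊕ Fin n → ℝ) : ℝ :=
  -Γ i j k (basePart y) + ((if i = k then 1 else 0) * y (inr j)
    + (if j = k then 1 else 0) * y (inr i))

/-- The derivative of `metricCoeff Γ i j` in the direction `∂/∂xᵏ`. -/
def metricCoeffHor (Γ : Fin n → Fin n → Fin n → Rn n → ℝ) (i j k : Fin n)
    (y : Fin n ⊕ Fin n → ℝ) : ℝ :=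
  -(∑ l, pd k (Γ i j l) (basePart y) * y (inr l)) + pd k (schoutenSymm Γ i j) (basePart y)

theorem contDiffOn_schoutenSymm (hS : IsOpen S) (hΓ : ∀ i j k, ContDiffOn ℝ ∞ (Γ i j k) S)
    (i j : Fin n) : ContDiffOn ℝ ∞ (schoutenSymm Γ i j) S :=
  ((contDiffOn_schoutenOf hS hΓ i j).add (contDiffOn_schoutenOf hS hΓ j i)).div_const _

theorem metricCoeff_symm (hs : ∀ x ∈ S, ∀ i j k, Γ i j k x = Γ j i k x) (hy : basePart y ∈ S)
    (i j : Fin n) : metricCoeff Γ i j y = metricCoeff Γ j i y := by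
  simp only [metricCoeff, schoutenSymm, hs _ hy i j]
  ring

theorem metricCoeffVert_symm (hs : ∀ x ∈ S, ∀ i j k, Γ i j k x = Γ j i k x) (hy : basePart y ∈ S)
    (i j k : Fin n) : metricCoeffVert Γ i j k y = metricCoeffVert Γ j i k y := by
  simp only [metricCoeffVert, hs _ hy i j]
  ring

theorem differentiableAt_comp_basePart {f : Rn n → ℝ} (hS : IsOpen S) (hf : ContDiffOn ℝ ∞ f S)
    (hy : basePart y ∈ S) : DifferentiableAt ℝ (fun z => f (basePart z)) y :=
  DifferentiableAt.comp y (hf.diffAt hS hy)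
    ((contDiff_basePart.contDiffAt).differentiableAt (by simp))

theorem differentiableAt_sum_mul_fiber {f : Fin n → Rn n → ℝ} (hS : IsOpen S)
    (hf : ∀ k, ContDiffOn ℝ ∞ (f k) S) (hy : basePart y ∈ S) :
    DifferentiableAt ℝ (fun z => -(∑ k, f k (basePart z) * z (inr k))) y :=
  (DifferentiableAt.fun_sum fun k _ =>
    (differentiableAt_comp_basePart hS (hf k) hy).fun_mul (by fun_prop)).fun_neg

theorem pd_inr_sum_mul_fiber {f : Fin n → Rn n → ℝ} (hS : IsOpen S)
    (hf : ∀ k, ContDiffOn ℝ ∞ (f k) S) (hy : basePart y ∈ S) (m : Fin n) :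
    pd (inr m) (fun z => -(∑ k, f k (basePart z) * z (inr k))) y = -f m (basePart y) := by
  have hd := fun k => differentiableAt_comp_basePart hS (hf k) hy
  rw [pd_neg, pd_sum (F := fun k z => f k (basePart z) * z (inr k)) _ _
    fun k _ => (hd k).fun_mul (by fun_prop)]
  simp [pd_mul _ (hd _) (show DifferentiableAt ℝ (fun z : Fin n ⊕ Fin n → ℝ => z (inr _)) y by
    fun_prop), pd_inr_comp_basePart ((hf _).diffAt hS hy), pd_coord]

theorem pd_inl_sum_mul_fiber {f : Fin n → Rn n → ℝ} (hS : IsOpen S)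
    (hf : ∀ k, ContDiffOn ℝ ∞ (f k) S) (hy : basePart y ∈ S) (m : Fin n) :
    pd (inl m) (fun z => -(∑ k, f k (basePart z) * z (inr k))) y
      = -(∑ k, pd m (f k) (basePart y) * y (inr k)) := by
  have hd := fun k => differentiableAt_comp_basePart hS (hf k) hy
  rw [pd_neg, pd_sum (F := fun k z => f k (basePart z) * z (inr k)) _ _
    fun k _ => (hd k).fun_mul (by fun_prop)]
  simp [pd_mul _ (hd _) (show DifferentiableAt ℝ (fun z : Fin n ⊕ Fin n → ℝ => z (inr _)) y by
    fun_prop), pd_inl_comp_basePart ((hf _).diffAt hS hy), pd_coord]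

theorem differentiableAt_metricCoeff (hS : IsOpen S) (hΓ : ∀ i j k, ContDiffOn ℝ ∞ (Γ i j k) S)
    (hy : basePart y ∈ S) (i j : Fin n) : DifferentiableAt ℝ (metricCoeff Γ i j) y :=
  ((differentiableAt_sum_mul_fiber hS (hΓ i j) hy).fun_add
    (by fun_prop : DifferentiableAt ℝ (fun z => z (inr i) * z (inr j)) y)).fun_add
      (differentiableAt_comp_basePart hS (contDiffOn_schoutenSymm hS hΓ i j) hy)

theorem differentiableAt_metricCoeffVert (hS : IsOpen S)
    (hΓ : ∀ i j k, ContDiffOn ℝ ∞ (Γ i j k) S) (hy : basePart y ∈ S) (i j k : Fin n) :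
    DifferentiableAt ℝ (metricCoeffVert Γ i j k) y :=
  (differentiableAt_comp_basePart hS (hΓ i j k) hy).fun_neg.fun_add
    (by fun_prop : DifferentiableAt ℝ (fun z : Fin n ⊕ Fin n → ℝ =>
      (if i = k then 1 else 0) * z (inr j) + (if j = k then 1 else 0) * z (inr i)) y)

theorem differentiableAt_metricCoeffHor (hS : IsOpen S)
    (hΓ : ∀ i j k, ContDiffOn ℝ ∞ (Γ i j k) S) (hy : basePart y ∈ S) (i j k : Fin n) :
    DifferentiableAt ℝ (metricCoeffHor Γ i j k) y :=
  (differentiableAt_sum_mul_fiber hS (fun l => contDiffOn_pd hS (hΓ i j l) k) hy).fun_add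
    (differentiableAt_comp_basePart hS (contDiffOn_pd hS (contDiffOn_schoutenSymm hS hΓ i j) k) hy)

theorem pd_inr_metricCoeff (hS : IsOpen S) (hΓ : ∀ i j k, ContDiffOn ℝ ∞ (Γ i j k) S)
    (hy : basePart y ∈ S) (i j k : Fin n) :
    pd (inr k) (metricCoeff Γ i j) y = metricCoeffVert Γ i j k y := by
  have h1 := differentiableAt_sum_mul_fiber hS (hΓ i j) hy
  have h2 : DifferentiableAt ℝ (fun z => z (inr i) * z (inr j)) y := by fun_prop
  have h3 := differentiableAt_comp_basePart hS (contDiffOn_schoutenSymm hS hΓ i j) hy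
  change pd (inr k) (fun z => -(∑ k, Γ i j k (basePart z) * z (inr k)) + z (inr i) * z (inr j)
    + schoutenSymm Γ i j (basePart z)) y = _
  rw [pd_add _ (h1.fun_add h2) h3, pd_add _ h1 h2, pd_inr_sum_mul_fiber hS (hΓ i j) hy,
    pd_inr_comp_basePart ((contDiffOn_schoutenSymm hS hΓ i j).diffAt hS hy),
    pd_mul _ (by fun_prop) (by fun_prop), pd_coord, pd_coord, metricCoeffVert]
  simp only [Sum.inr.injEq]
  ring

theorem pd_inl_metricCoeff (hS : IsOpen S) (hΓ : ∀ i j k, ContDiffOn ℝ ∞ (Γ i j k) S)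
    (hy : basePart y ∈ S) (i j k : Fin n) :
    pd (inl k) (metricCoeff Γ i j) y = metricCoeffHor Γ i j k y := by
  have h1 := differentiableAt_sum_mul_fiber hS (hΓ i j) hy
  have h2 : DifferentiableAt ℝ (fun z => z (inr i) * z (inr j)) y := by fun_prop
  have h3 := differentiableAt_comp_basePart hS (contDiffOn_schoutenSymm hS hΓ i j) hy
  change pd (inl k) (fun z => -(∑ k, Γ i j k (basePart z) * z (inr k)) + z (inr i) * z (inr j)
    + schoutenSymm Γ i j (basePart z)) y = _
  rw [pd_add _ (h1.fun_add h2) h3, pd_add _ h1 h2, pd_inl_sum_mul_fiber hS (hΓ i j) hy,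
    pd_inl_comp_basePart ((contDiffOn_schoutenSymm hS hΓ i j).diffAt hS hy),
    pd_mul _ (by fun_prop) (by fun_prop), pd_coord, pd_coord, metricCoeffHor]
  simp

theorem pd_inr_metricCoeffVert (hS : IsOpen S) (hΓ : ∀ i j k, ContDiffOn ℝ ∞ (Γ i j k) S)
    (hy : basePart y ∈ S) (i j k l : Fin n) :
    pd (inr l) (metricCoeffVert Γ i j k) y = (if i = k then 1 else 0) * (if j = l then 1 else 0)
      + (if j = k then 1 else 0) * (if i = l then 1 else 0) := by
  have h1 := (differentiableAt_comp_basePart hS (hΓ i j k) hy).fun_neg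
  change pd (inr l) (fun z => -Γ i j k (basePart z) + ((if i = k then 1 else 0) * z (inr j)
    + (if j = k then 1 else 0) * z (inr i))) y = _
  rw [pd_add _ h1 (by fun_prop), pd_neg, pd_inr_comp_basePart ((hΓ i j k).diffAt hS hy),
    pd_add _ (by fun_prop) (by fun_prop), pd_const_mul _ _ (by fun_prop),
    pd_const_mul _ _ (by fun_prop), pd_coord, pd_coord]
  simp only [Sum.inr.injEq]
  ring

theorem pd_inl_metricCoeffVert (hS : IsOpen S) (hΓ : ∀ i j k, ContDiffOn ℝ ∞ (Γ i j k) S)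
    (hy : basePart y ∈ S) (i j k l : Fin n) :
    pd (inl l) (metricCoeffVert Γ i j k) y = -pd l (Γ i j k) (basePart y) := by
  have h1 := (differentiableAt_comp_basePart hS (hΓ i j k) hy).fun_neg
  change pd (inl l) (fun z => -Γ i j k (basePart z) + ((if i = k then 1 else 0) * z (inr j)
    + (if j = k then 1 else 0) * z (inr i))) y = _
  rw [pd_add _ h1 (by fun_prop), pd_neg, pd_inl_comp_basePart ((hΓ i j k).diffAt hS hy),
    pd_add _ (by fun_prop) (by fun_prop), pd_const_mul _ _ (by fun_prop),
    pd_const_mul _ _ (by fun_prop), pd_coord, pd_coord]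
  simp

theorem pd_inr_metricCoeffHor (hS : IsOpen S) (hΓ : ∀ i j k, ContDiffOn ℝ ∞ (Γ i j k) S)
    (hy : basePart y ∈ S) (i j k l : Fin n) :
    pd (inr l) (metricCoeffHor Γ i j k) y = -pd k (Γ i j l) (basePart y) := by
  have h0 := fun l => contDiffOn_pd hS (hΓ i j l) k
  have h1 := contDiffOn_pd hS (contDiffOn_schoutenSymm hS hΓ i j) k
  change pd (inr l) (fun z => -(∑ l, pd k (Γ i j l) (basePart z) * z (inr l))
    + pd k (schoutenSymm Γ i j) (basePart z)) y = _
  rw [pd_add _ (differentiableAt_sum_mul_fiber hS h0 hy) (differentiableAt_comp_basePart hS h1 hy),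
    pd_inr_sum_mul_fiber hS h0 hy, pd_inr_comp_basePart (h1.diffAt hS hy), add_zero]

theorem eventually_basePart_mem (hS : IsOpen S) (hy : basePart y ∈ S) :
    ∀ᶠ z in nhds y, basePart z ∈ S :=
  contDiff_basePart.continuous.continuousAt.eventually_mem (hS.mem_nhds hy)

/-- The divergence term in the base components of the Ricci tensor. The part A·∂A of the connection
contributes, when differentiated along the fibre, a product of first derivatives and A contracted
with the constant Hessian of ξᵢξⱼ. -/
theorem pd_inr_walkerConnection (hS : IsOpen S) (hΓ : ∀ i j k, ContDiffOn ℝ ∞ (Γ i j k) S)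
    (hy : basePart y ∈ S) (i j k : Fin n) :
    pd (inr k) (walkerConnection (metricCoeff Γ) (inl i) (inl j) (inr k)) y
      = -pd i (Γ j k k) (basePart y) - pd j (Γ i k k) (basePart y) + pd k (Γ i j k) (basePart y)
        + 2 * ∑ l, (metricCoeffVert Γ k l k y * metricCoeffVert Γ i j l y
          + metricCoeff Γ k l y * ((if i = l then 1 else 0) * (if j = k then 1 else 0)
            + (if j = l then 1 else 0) * (if i = k then 1 else 0))) := by
  have hA := differentiableAt_metricCoeff hS hΓ hy
  have hV := differentiableAt_metricCoeffVert hS hΓ hy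
  have hH := differentiableAt_metricCoeffHor hS hΓ hy
  have h : walkerConnection (metricCoeff Γ) (inl i) (inl j) (inr k) =ᶠ[nhds y] fun z =>
      metricCoeffHor Γ j k i z + metricCoeffHor Γ i k j z - metricCoeffHor Γ i j k z
        + 2 * ∑ l, metricCoeff Γ k l z * metricCoeffVert Γ i j l z := by
    filter_upwards [eventually_basePart_mem hS hy] with z hz
    simp only [walkerConnection, pd_inl_metricCoeff hS hΓ hz, pd_inr_metricCoeff hS hΓ hz]
  have hAV : ∀ l, DifferentiableAt ℝ
      (fun z => metricCoeff Γ k l z * metricCoeffVert Γ i j l z) y :=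
    fun l => (hA k l).fun_mul (hV i j l)
  rw [pd_congr _ h, pd_add _ (((hH j k i).fun_add (hH i k j)).fun_sub (hH i j k))
    ((DifferentiableAt.fun_sum fun l _ => hAV l).const_mul _),
    pd_sub _ ((hH j k i).fun_add (hH i k j)) (hH i j k), pd_add _ (hH j k i) (hH i k j),
    pd_const_mul _ _ (DifferentiableAt.fun_sum fun l _ => hAV l),
    pd_sum (F := fun l z => metricCoeff Γ k l z * metricCoeffVert Γ i j l z) _ _ fun l _ => hAV l]
  simp only [pd_mul _ (hA k _) (hV i j _), pd_inr_metricCoeff hS hΓ hy,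
    pd_inr_metricCoeffVert hS hΓ hy, pd_inr_metricCoeffHor hS hΓ hy]
  ring

end Fefferman

/-! ### The Einstein equation for the Walker metric of a connection. -/

section Einstein

variable {n : ℕ} {Γ : Fin n → Fin n → Fin n → Rn n → ℝ} {S : Set (Rn n)}
  {y : Fin n ⊕ Fin n → ℝ}

theorem sum_metricCoeffVert (Γ : Fin n → Fin n → Fin n → Rn n → ℝ) (y : Fin n ⊕ Fin n → ℝ)
    (l : Fin n) : ∑ k, metricCoeffVert Γ k l k y
      = -(∑ k, Γ k l k (basePart y)) + (n + 1) * y (inr l) := by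
  simp only [metricCoeffVert, Finset.sum_add_distrib, Finset.sum_neg_distrib, if_true, one_mul,
    ite_mul, zero_mul, Finset.sum_ite_eq, Finset.mem_univ, Finset.sum_const, Finset.card_univ,
    Fintype.card_fin, nsmul_eq_mul]
  ring

/-- The sum over k involves only the first factor and equals -Γᵏₖₗ + (n+1)ξₗ, which reduces the
double sum to a contraction over l. -/
theorem sum_metricCoeffVert_mul (Γ : Fin n → Fin n → Fin n → Rn n → ℝ)
    (y : Fin n ⊕ Fin n → ℝ) (hs : ∀ i j k, Γ i j k (basePart y) = Γ j i k (basePart y))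
    (i j : Fin n) :
    ∑ k, ∑ l, metricCoeffVert Γ k l k y * metricCoeffVert Γ i j l y
      = ∑ k, ∑ l, Γ k l k (basePart y) * Γ i j l (basePart y)
        - (∑ k, Γ i k k (basePart y)) * y (inr j) - (∑ k, Γ j k k (basePart y)) * y (inr i)
        - (n + 1) * ∑ k, Γ i j k (basePart y) * y (inr k)
        + 2 * (n + 1) * (y (inr i) * y (inr j)) := by
  have h1 : ∀ i, ∑ k, Γ k i k (basePart y) = ∑ k, Γ i k k (basePart y) := fun i =>
    Finset.sum_congr rfl fun k _ => hs k i k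
  rw [Finset.sum_comm, Finset.sum_comm (f := fun k l => Γ k l k (basePart y) * _)]
  simp only [← Finset.sum_mul, sum_metricCoeffVert, h1]
  have h2 : ∀ l, (-(∑ k, Γ l k k (basePart y)) + (n + 1) * y (inr l)) * metricCoeffVert Γ i j l y
      = (∑ k, Γ l k k (basePart y)) * Γ i j l (basePart y)
        - (n + 1) * (Γ i j l (basePart y) * y (inr l))
        - (if i = l then (∑ k, Γ l k k (basePart y)) * y (inr j) else 0)
        - (if j = l then (∑ k, Γ l k k (basePart y)) * y (inr i) else 0)
        + (if i = l then (n + 1) * y (inr l) * y (inr j) else 0)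
        + (if j = l then (n + 1) * y (inr l) * y (inr i) else 0) := by
    intro l
    simp only [metricCoeffVert]
    split_ifs <;> ring
  simp only [h2, Finset.sum_add_distrib, Finset.sum_sub_distrib, Finset.sum_ite_eq,
    Finset.mem_univ, if_true, ← Finset.mul_sum]
  ring

/-- Together with `sum_metricCoeffVert_mul` this supplies the two quadratic terms of the Ricci
tensor of Γ. The terms Γᵏᵢₖξⱼ and Γᵏⱼₖξᵢ are the same in both, so they cancel in the difference. -/
theorem sum_metricCoeffVert_mul_swap (Γ : Fin n → Fin n → Fin n → Rn n → ℝ)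
    (y : Fin n ⊕ Fin n → ℝ) (hs : ∀ i j k, Γ i j k (basePart y) = Γ j i k (basePart y))
    (i j : Fin n) :
    ∑ k, ∑ l, metricCoeffVert Γ i l k y * metricCoeffVert Γ k j l y
      = ∑ k, ∑ l, Γ i l k (basePart y) * Γ k j l (basePart y)
        - (∑ k, Γ i k k (basePart y)) * y (inr j) - (∑ k, Γ j k k (basePart y)) * y (inr i)
        - 2 * ∑ k, Γ i j k (basePart y) * y (inr k)
        + (n + 3) * (y (inr i) * y (inr j)) := by
  have h1 : ∑ k, Γ k j k (basePart y) = ∑ k, Γ j k k (basePart y) :=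
    Finset.sum_congr rfl fun k _ => hs k j k
  have h2 : ∀ k l, metricCoeffVert Γ i l k y * metricCoeffVert Γ k j l y
      = Γ i l k (basePart y) * Γ k j l (basePart y)
        - (if k = l then Γ i l k (basePart y) * y (inr j) else 0)
        - (if j = l then Γ i l k (basePart y) * y (inr k) else 0)
        - (if i = k then Γ k j l (basePart y) * y (inr l) else 0)
        - (if l = k then Γ k j l (basePart y) * y (inr i) else 0)
        + (if i = k then (if k = l then y (inr l) * y (inr j) else 0) else 0)
        + (if i = k then (if j = l then y (inr l) * y (inr k) else 0) else 0)
        + (if l = k then y (inr i) * y (inr j) else 0)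
        + (if l = k then (if j = l then y (inr i) * y (inr k) else 0) else 0) := by
    intro k l
    simp only [metricCoeffVert, eq_comm (a := l) (b := k)]
    split_ifs <;> ring
  simp only [h2, Finset.sum_add_distrib, Finset.sum_sub_distrib, Finset.sum_ite_eq,
    Finset.sum_ite_eq', Finset.mem_univ, if_true, Finset.sum_ite_irrel, Finset.sum_const,
    Finset.card_univ, Fintype.card_fin, nsmul_eq_mul, mul_zero, ← Finset.sum_mul, h1]
  ring

/-- The metric with coefficients `metricCoeff` is Einstein. -/
theorem ricciOf_walkerConnection_metricCoeff (hn : 2 ≤ n) (hS : IsOpen S)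
    (hΓ : ∀ i j k, ContDiffOn ℝ ∞ (Γ i j k) S) (hs : ∀ x ∈ S, ∀ i j k, Γ i j k x = Γ j i k x)
    (hy : basePart y ∈ S) (a b : Fin n ⊕ Fin n) :
    ricciOf (walkerConnection (metricCoeff Γ)) a b y
      = 2 * (n + 1) * walkerMetric (metricCoeff Γ) a b y := by
  have hsA : ∀ i j, metricCoeff Γ i j =ᶠ[nhds y] metricCoeff Γ j i := fun i j => by
    filter_upwards [eventually_basePart_mem hS hy] with z hz using metricCoeff_symm hs hz i j
  have hV : ∀ i j k, pd (inr k) (metricCoeff Γ i j) =ᶠ[nhds y] metricCoeffVert Γ i j k :=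
    fun i j k => by
    filter_upwards [eventually_basePart_mem hS hy] with z hz using
      pd_inr_metricCoeff hS hΓ hz i j k
  -- The source of the Einstein constant: the traced fibre Hessian of ξᵢξₖ is (n+1)δᵢⱼ, while the
  -- corresponding metric coefficient is ½δᵢⱼ.
  have hVV : ∀ i j, ∑ k, pd (inr k) (pd (inr j) (metricCoeff Γ i k)) y
      = (n + 1) * (if i = j then 1 else 0) := by
    intro i j
    simp only [fun k => pd_congr (inr k) (hV i k j), pd_inr_metricCoeffVert hS hΓ hy]
    simp [Finset.sum_add_distrib]
    split_ifs <;> ring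
  obtain ⟨h1, h2, h3, h4⟩ := ricciOf_walkerConnection hsA
  rcases a with i | i <;> rcases b with j | j
  · rw [h4]
    have hq1 := sum_metricCoeffVert_mul_swap Γ y (hs _ hy) i j
    have hq2 : ∑ k, ∑ l, metricCoeffVert Γ i k l y * metricCoeffVert Γ j l k y
        = ∑ k, ∑ l, metricCoeffVert Γ i l k y * metricCoeffVert Γ k j l y := by
      rw [Finset.sum_comm]
      exact Finset.sum_congr rfl fun k _ => Finset.sum_congr rfl fun l _ => by
        rw [metricCoeffVert_symm hs hy j k l]
    have hd : ∀ i j k a, pd a (Γ i j k) (basePart y) = pd a (Γ j i k) (basePart y) :=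
      fun i j k a => pd_congr a
        (by filter_upwards [hS.mem_nhds hy] with z hz using hs z hz i j k)
    have hR : ∀ i j, ricciOf Γ i j (basePart y)
        = ∑ k, pd k (Γ i j k) (basePart y) - ∑ k, pd i (Γ j k k) (basePart y)
          + (∑ k, ∑ l, Γ k l k (basePart y) * Γ i j l (basePart y)
            - ∑ k, ∑ l, Γ i l k (basePart y) * Γ k j l (basePart y)) := by
      intro i j
      simp only [ricciOf, Finset.sum_sub_distrib, hd _ j]
    have hR' : ricciOf Γ j i (basePart y)
        = ∑ k, pd k (Γ i j k) (basePart y) - ∑ k, pd j (Γ i k k) (basePart y)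
          + (∑ k, ∑ l, Γ k l k (basePart y) * Γ i j l (basePart y)
            - ∑ k, ∑ l, Γ i l k (basePart y) * Γ k j l (basePart y)) := by
      rw [hR]
      congr 1
      · simp only [hd j i]
      · congr 1
        · exact Finset.sum_congr rfl fun k _ => Finset.sum_congr rfl fun l _ => by
            rw [hs _ hy j i]
        · rw [Finset.sum_comm]
          exact Finset.sum_congr rfl fun k _ => Finset.sum_congr rfl fun l _ => by
            rw [hs _ hy j k, hs _ hy l i, mul_comm]
    have hP : 2 * ((n : ℝ) - 1) * schoutenSymm Γ i j (basePart y)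
        = ricciOf Γ i j (basePart y) + ricciOf Γ j i (basePart y) := by
      have e1 : (n : ℝ) - 1 ≠ 0 := by
        have : (2 : ℝ) ≤ n := by exact_mod_cast hn
        linarith
      have e2 : (n : ℝ) + 1 ≠ 0 := by positivity
      simp only [schoutenSymm, schoutenOf]
      field_simp
      ring
    -- With the factor 2 in front of it in the connection, this contraction contributes 4Aᵢⱼ.
    have hA : ∑ k, ∑ l, metricCoeff Γ k l y * ((if i = l then 1 else 0) * (if j = k then 1 else 0)
        + (if j = l then 1 else 0) * (if i = k then 1 else 0)) = 2 * metricCoeff Γ i j y := by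
      simp only [mul_add, Finset.sum_add_distrib, mul_ite, mul_one, mul_zero]
      simp [metricCoeff_symm hs hy j i]
      ring
    simp only [fun k => pd_congr (inl k) (hV i j k), pd_inl_metricCoeffVert hS hΓ hy,
      pd_inr_walkerConnection hS hΓ hy, fun i j k => (hV i j k).eq_of_nhds,
      Finset.sum_add_distrib, Finset.sum_sub_distrib, Finset.sum_neg_distrib, ← Finset.mul_sum,
      hA, hq2, hq1, sum_metricCoeffVert_mul Γ y (hs _ hy)]
    simp only [walkerMetric]
    rw [hR, hR'] at hP
    simp only [metricCoeff]
    -- The remaining curvature terms are Rᵢⱼ + Rⱼᵢ = 2(n-1)P₍ᵢⱼ₎. With the 4P₍ᵢⱼ₎ contained in 4Aᵢⱼ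
    -- they give 2(n+1)P₍ᵢⱼ₎, and the terms in Γξ and ξξ acquire the same factor 2(n+1).
    linear_combination -hP
  · rw [h2, hVV]
    simp only [walkerMetric]
    split_ifs <;> ring
  · rw [h3, hVV]
    simp only [walkerMetric, eq_comm (a := j)]
    split_ifs <;> ring
  · rw [h1]
    simp [walkerMetric]

end Einstein

/-! ### Coordinate vector fields: smoothness, change of frame, brackets. -/

section CoordinateFields

variable {n : ℕ} {N : Type*} [TopologicalSpace N] [ChartedSpace (Rn n) N]
  [IsManifold 𝓘(ℝ, Rn n) ∞ N] {e e' : OpenPartialHomeomorph N (Rn n)} {p : N}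

theorem coordField_symm_contMDiffOn (he : e ∈ IsManifold.maximalAtlas 𝓘(ℝ, Rn n) ∞ N)
    (i : Fin n) : ContMDiffOn 𝓘(ℝ, Rn n) (𝓘(ℝ, Rn n).prod 𝓘(ℝ, Rn n)) ∞
      (fun x : Rn n => (⟨e.symm x, coordField e i (e.symm x)⟩ : TangentBundle 𝓘(ℝ, Rn n) N))
      e.target := by
  have hs := contMDiffOn_symm_of_mem_maximalAtlas he
  have h2 := hs.contMDiffOn_tangentMapWithin (m := ∞) (by simp) e.open_target.uniqueMDiffOn
  have h3 : ContMDiffOn 𝓘(ℝ, Rn n) (𝓘(ℝ, Rn n).prod 𝓘(ℝ, Rn n)) ∞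
      (fun x : Rn n => (⟨x, (Pi.single i 1 : Rn n)⟩ : TangentBundle 𝓘(ℝ, Rn n) (Rn n)))
      e.target :=
    (contMDiffOn_vectorSpace_iff_contDiffOn
      (V := fun x : Rn n => ((Pi.single i 1 : Rn n) : TangentSpace 𝓘(ℝ, Rn n) x))).2
        contDiffOn_const
  refine (h2.comp h3 (fun x hx => hx)).congr fun x hx => ?_
  have h5 : mfderivWithin 𝓘(ℝ, Rn n) 𝓘(ℝ, Rn n) e.symm e.target x
      = mfderiv 𝓘(ℝ, Rn n) 𝓘(ℝ, Rn n) e.symm x :=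
    mfderivWithin_of_isOpen e.open_target hx
  have key : ∀ y : Rn n, y = x →
      (mfderiv 𝓘(ℝ, Rn n) 𝓘(ℝ, Rn n) e.symm y (Pi.single i 1 : Rn n) : Rn n)
        = (mfderiv 𝓘(ℝ, Rn n) 𝓘(ℝ, Rn n) e.symm x (Pi.single i 1 : Rn n) : Rn n) := by
    rintro y rfl; rfl
  simp only [Function.comp_apply, tangentMapWithin, h5, coordField]
  exact congrArg (fun v : Rn n => (⟨e.symm x, v⟩ : TangentBundle 𝓘(ℝ, Rn n) N))
    (key _ (e.right_inv hx))

theorem coordField_contMDiffOn (he : e ∈ IsManifold.maximalAtlas 𝓘(ℝ, Rn n) ∞ N) (i : Fin n) :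
    ContMDiffOn 𝓘(ℝ, Rn n) (𝓘(ℝ, Rn n).prod 𝓘(ℝ, Rn n)) ∞
      (fun q : N => (⟨q, coordField e i q⟩ : TangentBundle 𝓘(ℝ, Rn n) N)) e.source := by
  refine ((coordField_symm_contMDiffOn he i).comp (contMDiffOn_of_mem_maximalAtlas he)
    fun q hq => e.map_source hq).congr fun q hq => ?_
  exact congrArg (fun r => (⟨r, coordField e i r⟩ : TangentBundle 𝓘(ℝ, Rn n) N))
    (e.left_inv hq).symm

theorem coordField_mdifferentiableAt (he : e ∈ IsManifold.maximalAtlas 𝓘(ℝ, Rn n) ∞ N)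
    (hp : p ∈ e.source) (i : Fin n) :
    MDifferentiableAt 𝓘(ℝ, Rn n) (𝓘(ℝ, Rn n).prod 𝓘(ℝ, Rn n))
      (fun q : N => (⟨q, coordField e i q⟩ : TangentBundle 𝓘(ℝ, Rn n) N)) p :=
  ((coordField_contMDiffOn he i).contMDiffAt (e.open_source.mem_nhds hp)).mdifferentiableAt
    (by simp)

theorem tangent_eq_sum (he : e ∈ IsManifold.maximalAtlas 𝓘(ℝ, Rn n) ∞ N) (hp : p ∈ e.source)
    (v : TN n p) : v = ∑ k, coordForm e k p v • coordField e k p := by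
  have h := linearMap_eq_sum he hp (LinearMap.id : TN n p →ₗ[ℝ] TN n p)
  conv_lhs => rw [← LinearMap.id_apply (R := ℝ) v, h]
  simp [LinearMap.sum_apply]

theorem coordField_eq_sum (he : e ∈ IsManifold.maximalAtlas 𝓘(ℝ, Rn n) ∞ N)
    (he' : e' ∈ IsManifold.maximalAtlas 𝓘(ℝ, Rn n) ∞ N) (hp : p ∈ e.source) (hp' : p ∈ e'.source)
    (j : Fin n) :
    coordField e j p = ∑ b, jacobian (e' ∘ e.symm) (e p) b j • coordField e' b p := by
  conv_lhs => rw [tangent_eq_sum he' hp' (coordField e j p)]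
  exact Finset.sum_congr rfl fun b _ => by
    rw [coordForm_coordField he' he hp' hp]
    rfl

/-- Coordinate fields are pull-backs of constant fields on ℝⁿ, whose brackets vanish, and the
bracket is natural under pull-back. Torsion-freeness thereby becomes symmetry of the Christoffel
symbols. -/
theorem mlieBracket_coordField (he : e ∈ IsManifold.maximalAtlas 𝓘(ℝ, Rn n) ∞ N)
    (hp : p ∈ e.source) (i j : Fin n) :
    VectorField.mlieBracket 𝓘(ℝ, Rn n) (coordField e i) (coordField e j) p = 0 := by
  have : IsManifold 𝓘(ℝ, Rn n) 2 N := IsManifold.of_le (n := ∞) (WithTop.coe_le_coe.2 le_top)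
  have : IsManifold 𝓘(ℝ, Rn n) (minSmoothness ℝ 3) N := by
    rw [minSmoothness_of_isRCLikeNormedField]
    exact IsManifold.of_le (n := ∞) (WithTop.coe_le_coe.2 le_top)
  let c : ∀ i : Fin n, ∀ x : Rn n, TangentSpace 𝓘(ℝ, Rn n) x := fun i _ => (Pi.single i 1 : Rn n)
  have h1 : ∀ i, coordField e i =ᶠ[nhds p]
      VectorField.mpullback 𝓘(ℝ, Rn n) 𝓘(ℝ, Rn n) e (c i) := by
    intro i
    filter_upwards [e.open_source.mem_nhds hp] with q hq
    rw [VectorField.mpullback_apply, ← coordBasis_apply he hq]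
    have : mfderiv 𝓘(ℝ, Rn n) 𝓘(ℝ, Rn n) e q = ((mdiff_of_maximal he).mfderiv hq :
      TN n q ≃L[ℝ] TangentSpace 𝓘(ℝ, Rn n) (e q)) := rfl
    rw [this, ContinuousLinearMap.inverse_equiv]
    change ((mdiff_of_maximal he).mfderiv hq).symm (Pi.basisFun ℝ (Fin n) i) = _
    rw [Pi.basisFun_apply]
    rfl
  have hc : ∀ i, MDifferentiableAt 𝓘(ℝ, Rn n) (𝓘(ℝ, Rn n).prod 𝓘(ℝ, Rn n))
      (fun x : Rn n => (⟨x, c i x⟩ : TangentBundle 𝓘(ℝ, Rn n) (Rn n))) (e p) := by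
    intro i
    have : ContMDiff 𝓘(ℝ, Rn n) (𝓘(ℝ, Rn n).prod 𝓘(ℝ, Rn n)) 1
        (fun x : Rn n => (⟨x, c i x⟩ : TangentBundle 𝓘(ℝ, Rn n) (Rn n))) :=
      contMDiff_vectorSpace_iff_contDiff.2 contDiff_const
    exact this.contMDiffAt.mdifferentiableAt (by simp)
  rw [(h1 i).mlieBracket_vectorField_eq (h1 j), ← VectorField.mpullback_mlieBracket (n := ∞) (hc i)
    (hc j) ((contMDiffOn_of_mem_maximalAtlas he).contMDiffAt (e.open_source.mem_nhds hp))
    (by rw [minSmoothness_of_isRCLikeNormedField]; exact WithTop.coe_le_coe.2 le_top)]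
  rw [VectorField.mpullback_apply, ← VectorField.mlieBracketWithin_univ,
    VectorField.mlieBracketWithin_eq_lieBracketWithin, VectorField.lieBracketWithin_univ]
  have : VectorField.lieBracket ℝ (c i) (c j) (e p) = 0 := by
    simp [VectorField.lieBracket, c]
  rw [this]
  exact map_zero (mfderiv 𝓘(ℝ, Rn n) 𝓘(ℝ, Rn n) e p).inverse

end CoordinateFields

/-! ### Connection coefficients of an affine connection in charts. -/

section Christoffel

variable {n : ℕ} {N : Type*} [TopologicalSpace N] [ChartedSpace (Rn n) N]
  [IsManifold 𝓘(ℝ, Rn n) ∞ N] {e e' : OpenPartialHomeomorph N (Rn n)} {p : N}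

theorem coordForm_symm_contDiffAt (he : e ∈ IsManifold.maximalAtlas 𝓘(ℝ, Rn n) ∞ N) {x : Rn n}
    (hx : x ∈ e.target) {v : ∀ q : N, TN n q}
    (hv : ContMDiffAt 𝓘(ℝ, Rn n) (𝓘(ℝ, Rn n).prod 𝓘(ℝ, Rn n)) ∞
      (fun x : Rn n => (⟨e.symm x, v (e.symm x)⟩ : TangentBundle 𝓘(ℝ, Rn n) N)) x) (k : Fin n) :
    ContDiffAt ℝ ∞ (fun x => coordForm e k (e.symm x) (v (e.symm x))) x := by
  have h1 := (contMDiffOn_of_mem_maximalAtlas he).contMDiffOn_tangentMapWithin (m := ∞) (by simp)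
    e.open_source.uniqueMDiffOn
  have h2 : ContMDiffAt 𝓘(ℝ, Rn n) (𝓘(ℝ, Rn n).prod 𝓘(ℝ, Rn n)) ∞
      (fun x : Rn n => tangentMapWithin 𝓘(ℝ, Rn n) 𝓘(ℝ, Rn n) e e.source
        (⟨e.symm x, v (e.symm x)⟩ : TangentBundle 𝓘(ℝ, Rn n) N)) x := by
    refine ContMDiffAt.comp (g := tangentMapWithin 𝓘(ℝ, Rn n) 𝓘(ℝ, Rn n) e e.source) x
      (h1.contMDiffAt ?_) hv
    exact (e.open_source.preimage (FiberBundle.continuous_proj (Rn n)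
      (TangentSpace 𝓘(ℝ, Rn n)))).mem_nhds (e.map_target hx)
  have h3 : ContMDiffAt 𝓘(ℝ, Rn n) (𝓘(ℝ, Rn n).prod 𝓘(ℝ, Rn n)) ∞
      (fun x : Rn n => (⟨x, (mfderiv 𝓘(ℝ, Rn n) 𝓘(ℝ, Rn n) e (e.symm x) (v (e.symm x)) : Rn n)⟩ :
        TangentBundle 𝓘(ℝ, Rn n) (Rn n))) x := by
    refine h2.congr_of_eventuallyEq ?_
    filter_upwards [e.open_target.mem_nhds hx] with z hz
    simp only [tangentMapWithin]
    rw [mfderivWithin_of_isOpen e.open_source (e.map_target hz)]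
    exact congrArg (fun r => (⟨r, (mfderiv 𝓘(ℝ, Rn n) 𝓘(ℝ, Rn n) e (e.symm z)
      (v (e.symm z)) : Rn n)⟩ : TangentBundle 𝓘(ℝ, Rn n) (Rn n))) (e.right_inv hz).symm
  have h4 : ContDiffAt ℝ ∞ (fun x => (mfderiv 𝓘(ℝ, Rn n) 𝓘(ℝ, Rn n) e (e.symm x)
      (v (e.symm x)) : Rn n)) x := contMDiffAt_vectorSpace_iff_contDiffAt.1 h3
  exact contDiffAt_pi.1 h4 k

/-- Smoothness of the connection is used for sections smooth on all of `N`, so the coordinate field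
is multiplied by a bump function with closed support in the chart domain. The function is 1 near the
given point, and locality of the covariant derivative returns the original coefficients there. -/
theorem christoffel_contDiffOn [T2Space N] (D : AffineConnection n N)
    (he : e ∈ IsManifold.maximalAtlas 𝓘(ℝ, Rn n) ∞ N) (i j k : Fin n) :
    ContDiffOn ℝ ∞ (christoffel D e i j k) e.target := by
  intro x hx
  refine ContDiffAt.contDiffWithinAt ?_
  obtain ⟨ψ, hψ, -⟩ := (SmoothBumpFunction.nhds_basis_support (I := 𝓘(ℝ, Rn n))
    (e.open_source.mem_nhds (e.map_target hx))).mem_iff.1 (e.open_source.mem_nhds (e.map_target hx))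
  let Y : ∀ q : N, TN n q := (ψ : N → ℝ) • coordField e j
  have hY : ContMDiff 𝓘(ℝ, Rn n) (𝓘(ℝ, Rn n).prod 𝓘(ℝ, Rn n)) ∞
      (fun q : N => (⟨q, Y q⟩ : TangentBundle 𝓘(ℝ, Rn n) N)) :=
    ContMDiffOn.smul_section_of_tsupport (V := fun q : N => TN n q) ψ.contMDiff.contMDiffOn
      e.open_source hψ (coordField_contMDiffOn he j)
  have hcov := (D.smooth.contMDiff.contMDiff (σ := Y) (by simpa using! hY.contMDiffOn))
  rw [contMDiffOn_univ] at hcov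
  have hs := (contMDiffOn_symm_of_mem_maximalAtlas he).contMDiffAt (e.open_target.mem_nhds hx)
  have h1 : ContMDiffAt 𝓘(ℝ, Rn n) (𝓘(ℝ, Rn n).prod 𝓘(ℝ, Rn n)) ∞
      (fun x : Rn n => (⟨e.symm x, D.cov Y (e.symm x) (coordField e i (e.symm x))⟩ :
        TangentBundle 𝓘(ℝ, Rn n) N)) x :=
    (hcov.contMDiffAt.comp x hs).clm_bundle_apply (F₁ := Rn n) (F₂ := Rn n)
      (E₁ := fun p : N => TN n p) (E₂ := fun p : N => TN n p)
      ((coordField_symm_contMDiffOn he i).contMDiffAt (e.open_target.mem_nhds hx))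
  refine (coordForm_symm_contDiffAt he hx
    (v := fun q => D.cov Y q (coordField e i q)) h1 k).congr_of_eventuallyEq ?_
  have h2 : ∀ᶠ q in nhds (e.symm x), ψ q = 1 := ψ.eventuallyEq_one
  have h3 : ∀ᶠ q in nhds (e.symm x), ∀ᶠ r in nhds q, ψ r = 1 := h2.eventually_nhds
  filter_upwards [(e.continuousAt_symm hx).eventually h3, e.open_target.mem_nhds hx] with z hz hz'
  simp only [christoffel]
  rw [D.cov.isCovariantDerivativeOnUniv.congr_of_eventuallyEq
    (coordField_mdifferentiableAt he (e.map_target hz') j)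
    (hY.contMDiffAt.mdifferentiableAt (by simp)) Filter.univ_mem]
  filter_upwards [hz] with r hr
  simp [Y, hr]

theorem christoffel_symm (D : AffineConnection n N)
    (he : e ∈ IsManifold.maximalAtlas 𝓘(ℝ, Rn n) ∞ N) {x : Rn n} (hx : x ∈ e.target)
    (i j k : Fin n) : christoffel D e i j k x = christoffel D e j i k x := by
  have hp := e.map_target hx
  have : IsManifold 𝓘(ℝ, Rn n) 2 N := IsManifold.of_le (n := ∞) (WithTop.coe_le_coe.2 le_top)
  have h := D.cov.torsion_eq_zero_iff.1 D.torsion_free (coordField_mdifferentiableAt he hp i)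
    (coordField_mdifferentiableAt he hp j)
  rw [mlieBracket_coordField he hp, sub_eq_zero] at h
  simp only [christoffel]
  rw [h]

theorem christoffel_eq_projectiveChange {D D' : AffineConnection n N}
    {Υ : ∀ p : N, TN n p →L[ℝ] ℝ} (h : IsProjectiveChange D D' Υ)
    (he : e ∈ IsManifold.maximalAtlas 𝓘(ℝ, Rn n) ∞ N) {x : Rn n} (hx : x ∈ e.target)
    (i j k : Fin n) : christoffel D' e i j k x = projectiveChange (christoffel D e)
      (fun i x => Υ (e.symm x) (coordField e i (e.symm x))) i j k x := by
  have hp := e.map_target hx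
  simp only [christoffel, projectiveChange]
  rw [h.change _ _ (coordField_mdifferentiableAt he hp j), map_add, map_add, map_smul, map_smul,
    coordForm_coordField_self he hp, coordForm_coordField_self he hp, add_assoc]
  simp only [Pi.single_apply, smul_eq_mul]

theorem cov_coordField (D : AffineConnection n N)
    (he : e ∈ IsManifold.maximalAtlas 𝓘(ℝ, Rn n) ∞ N) {x : Rn n} (hx : x ∈ e.target)
    (i j : Fin n) : D.cov (coordField e j) (e.symm x) (coordField e i (e.symm x))
      = ∑ k, christoffel D e i j k x • coordField e k (e.symm x) :=
  tangent_eq_sum he (e.map_target hx) _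

/-- The additivity rule requires differentiable sections, so differentiability of the partial sums
is carried through the same induction as the Leibniz formula. -/
theorem cov_sum_smul (D : AffineConnection n N) {κ : Type*} (s : Finset κ) (f : κ → N → ℝ)
    (Y : κ → ∀ q : N, TN n q)
    (hf : ∀ b, MDifferentiableAt 𝓘(ℝ, Rn n) 𝓘(ℝ, ℝ) (f b) p)
    (hY : ∀ b, MDifferentiableAt 𝓘(ℝ, Rn n) (𝓘(ℝ, Rn n).prod 𝓘(ℝ, Rn n))
      (fun q : N => (⟨q, Y b q⟩ : TangentBundle 𝓘(ℝ, Rn n) N)) p) (v : TN n p) :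
    MDifferentiableAt 𝓘(ℝ, Rn n) (𝓘(ℝ, Rn n).prod 𝓘(ℝ, Rn n))
      (fun q : N => (⟨q, (∑ b ∈ s, f b • Y b) q⟩ : TangentBundle 𝓘(ℝ, Rn n) N)) p ∧
    D.cov (∑ b ∈ s, f b • Y b) p v = ∑ b ∈ s, (f b p • D.cov (Y b) p v
      + mvfderiv 𝓘(ℝ, Rn n) (f b) p v • Y b p) := by
  classical
  induction s using Finset.induction_on with
  | empty =>
    refine ⟨?_, ?_⟩
    · simpa using! (contMDiff_zeroSection ℝ (fun q : N => TN n q)).contMDiffAt.mdifferentiableAt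
        one_ne_zero
    · simp
  | insert b s hb ih =>
    have h1 := MDifferentiableAt.smul_section (E := fun q : N => TN n q) (hf b) (hY b)
    have h2 := mdifferentiableAt_add_section h1 ih.1
    simp only [Finset.sum_insert hb]
    refine ⟨h2, ?_⟩
    rw [D.cov.isCovariantDerivativeOnUniv.add h1 ih.1,
      D.cov.isCovariantDerivativeOnUniv.leibniz (hY b) (hf b), ← ih.2]
    simp

/-- The Leibniz rule is applied to ∂ⱼ = Jᵇⱼ∂'ᵦ, and the direction ∂ᵢ is expanded in the second
frame. The derivative of J is the inhomogeneous term. -/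
theorem christoffel_isConnectionPullback (D : AffineConnection n N)
    (he : e ∈ IsManifold.maximalAtlas 𝓘(ℝ, Rn n) ∞ N)
    (he' : e' ∈ IsManifold.maximalAtlas 𝓘(ℝ, Rn n) ∞ N) :
    IsConnectionPullback (e' ∘ e.symm) (christoffel D e) (christoffel D e')
      (e.symm.trans e').source := by
  intro x hx i j c
  have hx1 : x ∈ e.target := hx.1
  have hx2 : e.symm x ∈ e'.source := hx.2
  set p := e.symm x with hp
  have hps : p ∈ e.source := e.map_target hx1
  have hep : e p = x := e.right_inv hx1
  set J := jacobian (e' ∘ e.symm) with hJ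
  have hJd : ∀ a b, ContDiffOn ℝ ∞ (fun z => J z a b) (e.symm.trans e').source :=
    contDiffOn_jacobian (e.symm.trans e').open_source (transition_contDiffOn he he')
  have hed : MDifferentiableAt 𝓘(ℝ, Rn n) 𝓘(ℝ, Rn n) e p :=
    (mdiff_of_maximal he).mdifferentiableAt hps
  have hJx : ∀ a b, DifferentiableAt ℝ (fun z => J z a b) (e p) := fun a b => by
    rw [hep]
    exact (hJd a b).diffAt (e.symm.trans e').open_source hx
  have hf : ∀ b, MDifferentiableAt 𝓘(ℝ, Rn n) 𝓘(ℝ, ℝ) (fun q => J (e q) b j) p := fun b =>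
    (hJx b j).mdifferentiableAt.comp p hed
  obtain ⟨h1, h2⟩ := cov_sum_smul D Finset.univ (fun b q => J (e q) b j)
    (fun b => coordField e' b) hf (fun b => coordField_mdifferentiableAt he' hx2 b)
    (coordField e i p)
  have h3 : D.cov (coordField e j) p = D.cov (∑ b, (fun q => J (e q) b j) • coordField e' b) p := by
    refine D.cov.isCovariantDerivativeOnUniv.congr_of_eventuallyEq
      (coordField_mdifferentiableAt he hps j) h1 Filter.univ_mem ?_
    filter_upwards [e.open_source.mem_nhds hps, e'.open_source.mem_nhds hx2] with q hq hq'
    rw [coordField_eq_sum he he' hq hq']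
    simp [hJ]
  have h4 : ∀ b, mvfderiv 𝓘(ℝ, Rn n) (fun q => J (e q) b j) p (coordField e i p)
      = pd i (fun z => J z b j) x := by
    intro b
    have h5 : mfderiv 𝓘(ℝ, Rn n) 𝓘(ℝ, ℝ) (fun q => J (e q) b j) p
        = (fderiv ℝ (fun z => J z b j) (e p)).comp (mfderiv 𝓘(ℝ, Rn n) 𝓘(ℝ, Rn n) e p) := by
      rw [← mfderiv_eq_fderiv]
      exact mfderiv_comp p (hJx b j).mdifferentiableAt hed
    have h6 : mvfderiv 𝓘(ℝ, Rn n) (fun q => J (e q) b j) p (coordField e i p)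
        = mfderiv 𝓘(ℝ, Rn n) 𝓘(ℝ, ℝ) (fun q => J (e q) b j) p (coordField e i p) := rfl
    rw [h6, h5, pd, ← hep]
    exact congrArg (fderiv ℝ (fun z => J z b j) (e p)) (mfderiv_coordField_self he hps i)
  have h7 : ∀ a b, coordForm e' c p (D.cov (coordField e' b) p (coordField e' a p))
      = christoffel D e' a b c (e' p) := fun a b =>
    congrArg (fun q => coordForm e' c q (D.cov (coordField e' b) q (coordField e' a q)))
      (e'.left_inv hx2).symm
  have h8 := congrArg (coordForm e' c p) h2
  rw [← h3, cov_coordField D he hx1, map_sum, map_sum] at h8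
  have h9 : ∀ k, coordForm e' c p (christoffel D e i j k x • coordField e k p)
      = J x c k * christoffel D e i j k x := by
    intro k
    rw [map_smul, coordForm_coordField he' he hx2 hps, hep, smul_eq_mul, mul_comm]
    rfl
  have h10 : ∀ b, coordForm e' c p (J (e p) b j • D.cov (coordField e' b) p (coordField e i p)
      + mvfderiv 𝓘(ℝ, Rn n) (fun q => J (e q) b j) p (coordField e i p) • coordField e' b p)
      = (∑ a, J x a i * christoffel D e' a b c (e' p)) * J x b j
        + pd i (fun z => J z b j) x * (if c = b then 1 else 0) := by
    intro b
    rw [map_add, map_smul, map_smul, h4, coordForm_coordField_self he' hx2,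
      coordField_eq_sum he he' hps hx2 i, map_sum, map_sum, hep]
    simp only [map_smul, h7, smul_eq_mul, Pi.single_apply]
    rw [mul_comm (J x b j)]
  refine (Finset.sum_congr rfl fun k _ => (h9 k).symm).trans (h8.trans ?_)
  simp only [h10, Finset.sum_add_distrib]
  simp [hp]

end Christoffel

/-! ### Derivatives of determinants and of density factors. -/

section Determinant

variable {ι : Type*} [Fintype ι] [DecidableEq ι] {κ : Type*} [Fintype κ] [DecidableEq κ]

/-- The determinant as a continuous multilinear function of the rows. -/
def detMultilinear (κ : Type*) [Fintype κ] [DecidableEq κ] :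
    ContinuousMultilinearMap ℝ (fun _ : κ => κ → ℝ) ℝ where
  toMultilinearMap := (Matrix.detRowAlternating : (κ → ℝ) [⋀^κ]→ₗ[ℝ] ℝ).toMultilinearMap
  cont := by
    have : Continuous fun M : Matrix κ κ ℝ => M.det := continuous_id.matrix_det
    exact this

/-- Jacobi's formula. -/
theorem pd_det {F : (ι → ℝ) → Matrix κ κ ℝ} {y : ι → ℝ}
    (hF : ∀ a b, DifferentiableAt ℝ (fun z => F z a b) y) (i : ι) :
    pd i (fun z => (F z).det) y = ((F y).adjugate * mpd i F y).trace := by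
  have h1 : HasFDerivAt (fun z => (fun a b => F z a b : κ → κ → ℝ))
      (ContinuousLinearMap.pi fun a => ContinuousLinearMap.pi fun b =>
        fderiv ℝ (fun z => F z a b) y) y :=
    hasFDerivAt_pi.2 fun a => hasFDerivAt_pi.2 fun b => (hF a b).hasFDerivAt
  have h2 : HasFDerivAt (fun z => detMultilinear κ (fun a b => F z a b)) _ y :=
    ((detMultilinear κ).hasFDerivAt (fun a b => F y a b)).comp y h1
  have h3 : (fun z => (F z).det) = fun z => detMultilinear κ (fun a b => F z a b) := rfl
  rw [pd, h3, h2.fderiv, ContinuousLinearMap.comp_apply,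
    ContinuousMultilinearMap.linearDeriv_apply, Matrix.trace_mul_comm, Matrix.trace]
  refine Finset.sum_congr rfl fun a _ => ?_
  have h4 : detMultilinear κ (Function.update (fun a b => F y a b) a (mpd i F y a))
      = ((F y).updateRow a (mpd i F y a)).det := rfl
  rw [Matrix.diag_apply, Matrix.mul_apply]
  refine h4.trans ?_
  -- The determinant with one row replaced is read off from Cramer's rule as a row of cofactors.
  rw [← Matrix.cramer_transpose_apply, Matrix.cramer_eq_adjugate_mulVec,
    ← Matrix.adjugate_transpose]
  simp only [Matrix.mulVec, dotProduct, Matrix.transpose_apply]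
  exact Finset.sum_congr rfl fun b _ => mul_comm _ _

/-- For w = 1/(n+1) this is the factor relating the components of a density of weight one in two
charts. Its logarithmic derivative compensates the inhomogeneous term in the trace of the connection
coefficients. -/
theorem pd_abs_det_rpow {F : (ι → ℝ) → Matrix κ κ ℝ} {y : ι → ℝ}
    (hF : ∀ a b, DifferentiableAt ℝ (fun z => F z a b) y) (h0 : (F y).det ≠ 0) (w : ℝ) (i : ι) :
    DifferentiableAt ℝ (fun z => |(F z).det| ^ w) y ∧
    pd i (fun z => |(F z).det| ^ w) y
      = w * |(F y).det| ^ w * ((F y)⁻¹ * mpd i F y).trace := by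
  have hd : DifferentiableAt ℝ (fun z => (F z).det) y :=
    (((detMultilinear κ).hasFDerivAt (fun a b => F y a b)).comp y
      (hasFDerivAt_pi.2 fun a => hasFDerivAt_pi.2 fun b => (hF a b).hasFDerivAt)).differentiableAt
  have h1 : HasFDerivAt (fun z => |(F z).det|)
      ((SignType.sign (F y).det : ℝ) • fderiv ℝ (fun z => (F z).det) y) y :=
    hd.hasFDerivAt.abs h0
  have h2 : HasFDerivAt (fun z => |(F z).det| ^ w) _ y :=
    h1.rpow_const (p := w) (Or.inl (abs_ne_zero.2 h0))
  refine ⟨h2.differentiableAt, ?_⟩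
  have h3 : ((F y)⁻¹ * mpd i F y).trace = (F y).det⁻¹ * pd i (fun z => (F z).det) y := by
    rw [pd_det hF, Matrix.inv_def, Ring.inverse_eq_inv', Matrix.smul_mul, Matrix.trace_smul,
      smul_eq_mul]
  rw [h3, pd, h2.fderiv]
  simp only [smul_apply, smul_eq_mul]
  rw [← pd, Real.rpow_sub_one (abs_ne_zero.2 h0)]
  have h5 : |(F y).det| ≠ 0 := abs_ne_zero.2 h0
  have h6 : (SignType.sign (F y).det : ℝ) * (F y).det = |(F y).det| := sign_mul_self _
  field_simp
  linear_combination (w * pd i (fun z => (F z).det) y) * h6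

end Determinant

/-! ### The tractor connection in coordinates: projective invariance and covariance. -/

section TractorCoordinates

variable {n : ℕ} {Γ Γ' : Fin n → Fin n → Fin n → Rn n → ℝ} {S T : Set (Rn n)} {x : Rn n}

/-- The tractor connection in coordinates. -/
def tractorOf (Γ : Fin n → Fin n → Fin n → Rn n → ℝ) (σ : Rn n → ℝ) (μ : Fin n → Rn n → ℝ)
    (i : Fin n) (x : Rn n) : ℝ × Rn n :=
  (pd i σ x + (∑ k, Γ i k k x) / ((n : ℝ) + 1) * σ x - μ i x,
    fun j => pd i (μ j) x - ∑ k, Γ i j k x * μ k x + (∑ k, Γ i k k x) / ((n : ℝ) + 1) * μ j x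
      + schoutenOf Γ i j x * σ x)

/-- Projective invariance of the tractor connection. -/
theorem tractorOf_projectiveChange (hn : 2 ≤ n) {Υ : Fin n → Rn n → ℝ} {σ : Rn n → ℝ}
    {μ : Fin n → Rn n → ℝ} (hΓ : ∀ i j k, DifferentiableAt ℝ (Γ i j k) x)
    (hΥ : ∀ i, DifferentiableAt ℝ (Υ i) x) (hs : ∀ i j k, Γ i j k x = Γ j i k x)
    (hσ : DifferentiableAt ℝ σ x) (hμ : ∀ j, DifferentiableAt ℝ (μ j) x) (i : Fin n) :
    tractorOf (projectiveChange Γ Υ) σ (fun j z => μ j z + Υ j z * σ z) i x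
      = ((tractorOf Γ σ μ i x).1,
        fun j => (tractorOf Γ σ μ i x).2 j + Υ j x * (tractorOf Γ σ μ i x).1) := by
  have hn' : (n : ℝ) + 1 ≠ 0 := by positivity
  have ht : (∑ k, projectiveChange Γ Υ i k k x) / ((n : ℝ) + 1)
      = (∑ k, Γ i k k x) / ((n : ℝ) + 1) + Υ i x := by
    have : ∑ k, projectiveChange Γ Υ i k k x = ∑ k, Γ i k k x + ((n : ℝ) + 1) * Υ i x := by
      simp [projectiveChange, Finset.sum_add_distrib]
      ring
    rw [this]
    field_simp
  have hp : ∀ j, pd i (fun z => μ j z + Υ j z * σ z) x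
      = pd i (μ j) x + (pd i (Υ j) x * σ x + Υ j x * pd i σ x) := fun j => by
    rw [pd_add _ (hμ j) ((hΥ j).fun_mul hσ), pd_mul _ (hΥ j) hσ]
  have hg : ∀ j, ∑ k, projectiveChange Γ Υ i j k x * (μ k x + Υ k x * σ x)
      = ∑ k, Γ i j k x * μ k x + (∑ k, Γ i j k x * Υ k x) * σ x
        + Υ i x * (μ j x + Υ j x * σ x) + Υ j x * (μ i x + Υ i x * σ x) := by
    intro j
    have : ∀ k, projectiveChange Γ Υ i j k x * (μ k x + Υ k x * σ x)
        = Γ i j k x * μ k x + Γ i j k x * Υ k x * σ x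
          + (if k = j then Υ i x * (μ k x + Υ k x * σ x) else 0)
          + (if k = i then Υ j x * (μ k x + Υ k x * σ x) else 0) := by
      intro k
      simp only [projectiveChange]
      split_ifs <;> ring
    simp only [this, Finset.sum_add_distrib, Finset.sum_ite_eq', Finset.mem_univ, if_true,
      Finset.sum_mul]
  simp only [tractorOf, ht, hp, hg, schoutenOf_projectiveChange hn hΓ hΥ hs]
  refine Prod.ext ?_ (funext fun j => ?_)
  · ring
  · ring

/-- Covariance of the tractor connection under a change of coordinates. -/
theorem tractorOf_pullback {φ : Rn n → Rn n} (hS : IsOpen S) (hT : IsOpen T)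
    (hφ : ContDiffOn ℝ ∞ φ S) (hST : MapsTo φ S T) (hΓ : ∀ i j k, ContDiffOn ℝ ∞ (Γ i j k) S)
    (hΓ' : ∀ i j k, ContDiffOn ℝ ∞ (Γ' i j k) T) (h : IsConnectionPullback φ Γ Γ' S) (hx : x ∈ S)
    (hu : IsUnit (jacobian φ x).det) {σ σ' : Rn n → ℝ} {μ μ' : Fin n → Rn n → ℝ}
    (hσ : DifferentiableAt ℝ σ x) (hμ : ∀ j, DifferentiableAt ℝ (μ j) x)
    (hσ' : DifferentiableAt ℝ σ' (φ x)) (hμ' : ∀ j, DifferentiableAt ℝ (μ' j) (φ x))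
    (hσσ' : ∀ z ∈ S, σ' (φ z) = |(jacobian φ z).det| ^ (1 / ((n : ℝ) + 1)) * σ z)
    (hμμ' : ∀ z ∈ S, ∀ j, ∑ b, jacobian φ z b j * μ' b (φ z)
      = |(jacobian φ z).det| ^ (1 / ((n : ℝ) + 1)) * μ j z) (i : Fin n) :
    ∑ a, jacobian φ x a i * (tractorOf Γ' σ' μ' a (φ x)).1
      = |(jacobian φ x).det| ^ (1 / ((n : ℝ) + 1)) * (tractorOf Γ σ μ i x).1 ∧
    ∀ j, ∑ b, jacobian φ x b j * ∑ a, jacobian φ x a i * (tractorOf Γ' σ' μ' a (φ x)).2 b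
      = |(jacobian φ x).det| ^ (1 / ((n : ℝ) + 1)) * (tractorOf Γ σ μ i x).2 j := by
  have hJ : ∀ a b, DifferentiableAt ℝ (fun z => jacobian φ z a b) x := fun a b =>
    (contDiffOn_jacobian hS hφ a b).diffAt hS hx
  have hφx : DifferentiableAt ℝ φ x := (hφ.contDiffAt (hS.mem_nhds hx)).differentiableAt (by simp)
  obtain ⟨hr, hr'⟩ := pd_abs_det_rpow hJ hu.ne_zero (1 / ((n : ℝ) + 1)) i
  set r : Rn n → ℝ := fun z => |(jacobian φ z).det| ^ (1 / ((n : ℝ) + 1)) with hrdef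
  have hrx : |(jacobian φ x).det| ^ (1 / ((n : ℝ) + 1)) = r x := rfl
  have htr := h.trace hx hu i
  have h1 : ∑ a, jacobian φ x a i * pd a σ' (φ x) = pd i r x * σ x + r x * pd i σ x := by
    rw [← pd_mul i hr hσ]
    have : pd i (fun z => σ' (φ z)) x = pd i (fun z => r z * σ z) x :=
      pd_congr i (by filter_upwards [hS.mem_nhds hx] with z hz using hσσ' z hz)
    rw [← this, pd_comp i hσ' hφx]
    simp only [pd_eq_jacobian hS hφ hx]
  have h2 : ∀ j, ∑ b, (pd i (fun z => jacobian φ z b j) x * μ' b (φ x)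
      + jacobian φ x b j * ∑ a, jacobian φ x a i * pd a (μ' b) (φ x))
      = pd i r x * μ j x + r x * pd i (μ j) x := by
    intro j
    rw [← pd_mul i hr (hμ j)]
    have : pd i (fun z => ∑ b, jacobian φ z b j * μ' b (φ z)) x = pd i (fun z => r z * μ j z) x :=
      pd_congr i (by filter_upwards [hS.mem_nhds hx] with z hz using hμμ' z hz j)
    have hd : ∀ b, DifferentiableAt ℝ (fun z => μ' b (φ z)) x := fun b => (hμ' b).comp x hφx
    rw [← this, pd_sum (F := fun b z => jacobian φ z b j * μ' b (φ z)) _ _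
      fun b _ => (hJ b j).fun_mul (hd b)]
    refine Finset.sum_congr rfl fun b _ => ?_
    rw [pd_mul _ (hJ b j) (hd b), pd_comp i (hμ' b) hφx]
    simp only [pd_eq_jacobian hS hφ hx]
  -- The trace of J⁻¹∂ᵢJ subtracted here cancels the derivative of |det J|^(1/(n+1)) computed in
  -- `hr'`.
  have hw : ∀ X : ℝ, ∑ a, jacobian φ x a i * ((∑ k, Γ' a k k (φ x)) / ((n : ℝ) + 1) * X)
      = ((∑ k, Γ i k k x) - ((jacobian φ x)⁻¹ * mpd i (jacobian φ) x).trace)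
        / ((n : ℝ) + 1) * X := by
    intro X
    rw [htr, add_sub_cancel_right, Finset.sum_div, Finset.sum_mul]
    exact Finset.sum_congr rfl fun a _ => by ring
  refine ⟨?_, fun j => ?_⟩
  · simp only [tractorOf, mul_add, mul_sub, Finset.sum_add_distrib, Finset.sum_sub_distrib, h1, hw,
      hσσ' x hx, hμμ' x hx, hr', hrx]
    ring
  -- The second derivatives of `φ` in the law of the connection coefficients cancel those from
  -- differentiating the Jacobian in `h2`.
  · have hg : ∑ b, jacobian φ x b j * ∑ a, jacobian φ x a i * ∑ c, Γ' a b c (φ x) * μ' c (φ x)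
        = r x * ∑ k, Γ i j k x * μ k x - ∑ c, pd i (fun z => jacobian φ z c j) x * μ' c (φ x) := by
      have e1 : r x * ∑ k, Γ i j k x * μ k x
          = ∑ c, (∑ k, jacobian φ x c k * Γ i j k x) * μ' c (φ x) := by
        simp only [Finset.sum_mul]
        rw [Finset.sum_comm, Finset.mul_sum]
        refine Finset.sum_congr rfl fun k _ => ?_
        rw [mul_left_comm, ← hμμ' x hx k, Finset.mul_sum]
        exact Finset.sum_congr rfl fun c _ => by ring
      rw [e1, ← Finset.sum_sub_distrib]
      simp only [h x hx i j, add_mul, add_sub_cancel_right, Finset.sum_mul, Finset.mul_sum]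
      rw [Finset.sum_comm]
      conv_rhs => rw [Finset.sum_comm]
      conv_lhs => rw [Finset.sum_comm]
      refine Finset.sum_congr rfl fun b _ => ?_
      rw [Finset.sum_comm]
      exact Finset.sum_congr rfl fun c _ => Finset.sum_congr rfl fun a _ => by ring
    have hP : ∑ b, jacobian φ x b j * ∑ a, jacobian φ x a i * (schoutenOf Γ' a b (φ x) * σ' (φ x))
        = r x * (schoutenOf Γ i j x * σ x) := by
      rw [schoutenOf_pullback hS hT hφ hST hΓ hΓ' h hx hu, hσσ' x hx, hrx, Finset.sum_comm]
      simp only [Finset.sum_mul, Finset.mul_sum]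
      exact Finset.sum_congr rfl fun b _ => Finset.sum_congr rfl fun a _ => by ring
    have hm : ∑ b, jacobian φ x b j * (((∑ k, Γ i k k x)
          - ((jacobian φ x)⁻¹ * mpd i (jacobian φ) x).trace) / ((n : ℝ) + 1) * μ' b (φ x))
        = ((∑ k, Γ i k k x) - ((jacobian φ x)⁻¹ * mpd i (jacobian φ) x).trace)
          / ((n : ℝ) + 1) * (r x * μ j x) := by
      rw [← hμμ' x hx, Finset.mul_sum]
      exact Finset.sum_congr rfl fun b _ => by ring
    have h2j := h2 j
    rw [Finset.sum_add_distrib] at h2j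
    simp only [tractorOf, mul_add, mul_sub, Finset.sum_add_distrib, Finset.sum_sub_distrib, hw,
      hg, hP, hm]
    rw [hr'] at h2j
    linear_combination h2j

end TractorCoordinates

/-! ### Charts of the total spaces and sections parallel at a point. -/

section ParallelSections

variable {n : ℕ} {N : Type*} [TopologicalSpace N] [ChartedSpace (Rn n) N]
  [IsManifold 𝓘(ℝ, Rn n) ∞ N] {P : ProjectiveStructure n N}
  {e e' : OpenPartialHomeomorph N (Rn n)} {p : N}

theorem tractorOf_congr {Γ Γ' : Fin n → Fin n → Fin n → Rn n → ℝ} {σ σ' : Rn n → ℝ}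
    {μ μ' : Fin n → Rn n → ℝ} {x : Rn n} (hΓ : ∀ i j k, Γ i j k =ᶠ[nhds x] Γ' i j k)
    (hσ : σ =ᶠ[nhds x] σ') (hμ : ∀ j, μ j =ᶠ[nhds x] μ' j) (i : Fin n) :
    tractorOf Γ σ μ i x = tractorOf Γ' σ' μ' i x := by
  simp only [tractorOf, pd_congr _ hσ, fun j => pd_congr i (hμ j), schoutenOf_congr hΓ,
    hσ.eq_of_nhds, fun j => (hμ j).eq_of_nhds, fun i j k => (hΓ i j k).eq_of_nhds]

/-- The chart of the cotractor bundle given by a chart of the base and a connection of the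
class. -/
def cotractorHomeomorph (D : P.reps) (he : e ∈ IsManifold.maximalAtlas 𝓘(ℝ, Rn n) ∞ N) :
    OpenPartialHomeomorph (CotractorBundle P) (Rn n × ℝ × Rn n) :=
  (cotractorCore P).openPartialHomeomorph (cotractorChart D e he) ⟨D, e, he, rfl⟩

/-- The chart of `ℙ(𝒯*) ∖ 𝒵(τ)` given by a chart of the base and a connection of the class. -/
def projHomeomorph (D : P.reps) (he : e ∈ IsManifold.maximalAtlas 𝓘(ℝ, Rn n) ∞ N) :
    OpenPartialHomeomorph (ProjCotractorBundle P) (Fin n ⊕ Fin n → ℝ) :=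
  (projCore P).openPartialHomeomorph (projChart D e he) ⟨D, e, he, rfl⟩

theorem cotractorHomeomorph_mem_maximalAtlas (D : P.reps)
    (he : e ∈ IsManifold.maximalAtlas 𝓘(ℝ, Rn n) ∞ N) :
    cotractorHomeomorph D he ∈
      IsManifold.maximalAtlas 𝓘(ℝ, Rn n × ℝ × Rn n) ∞ (CotractorBundle P) :=
  IsManifold.subset_maximalAtlas (mem_iUnion.2 ⟨_, mem_iUnion.2 ⟨⟨D, e, he, rfl⟩, rfl⟩⟩)

theorem projHomeomorph_mem_maximalAtlas (D : P.reps)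
    (he : e ∈ IsManifold.maximalAtlas 𝓘(ℝ, Rn n) ∞ N) :
    projHomeomorph D he ∈
      IsManifold.maximalAtlas 𝓘(ℝ, Fin n ⊕ Fin n → ℝ) ∞ (ProjCotractorBundle P) :=
  IsManifold.subset_maximalAtlas (mem_iUnion.2 ⟨_, mem_iUnion.2 ⟨⟨D, e, he, rfl⟩, rfl⟩⟩)

theorem cotractorCoord_contMDiffAt (D : P.reps)
    (he : e ∈ IsManifold.maximalAtlas 𝓘(ℝ, Rn n) ∞ N) {U : CotractorBundle P}
    (hU : U.base ∈ e.source) :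
    ContMDiffAt 𝓘(ℝ, Rn n × ℝ × Rn n) 𝓘(ℝ, Rn n × ℝ × Rn n) ∞
      (cotractorCoord D e : CotractorBundle P → _) U :=
  contMDiffAt_of_mem_maximalAtlas (cotractorHomeomorph_mem_maximalAtlas D he) (x := U) hU

theorem projCoord_contMDiffAt (D : P.reps)
    (he : e ∈ IsManifold.maximalAtlas 𝓘(ℝ, Rn n) ∞ N) {m : ProjCotractorBundle P}
    (hm : m.base ∈ e.source) :
    ContMDiffAt 𝓘(ℝ, Fin n ⊕ Fin n → ℝ) 𝓘(ℝ, Fin n ⊕ Fin n → ℝ) ∞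
      (projCoord D e : ProjCotractorBundle P → _) m :=
  contMDiffAt_of_mem_maximalAtlas (projHomeomorph_mem_maximalAtlas D he) (x := m) hm

theorem cotractorOfCoord_contMDiffAt (D : P.reps)
    (he : e ∈ IsManifold.maximalAtlas 𝓘(ℝ, Rn n) ∞ N) {y : Rn n × ℝ × Rn n}
    (hy : y.1 ∈ e.target) :
    ContMDiffAt 𝓘(ℝ, Rn n × ℝ × Rn n) 𝓘(ℝ, Rn n × ℝ × Rn n) ∞
      (cotractorOfCoord D e : _ → CotractorBundle P) y :=
  contMDiffAt_symm_of_mem_maximalAtlas (cotractorHomeomorph_mem_maximalAtlas D he) (x := y) hy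

theorem projOfCoord_contMDiffAt (D : P.reps)
    (he : e ∈ IsManifold.maximalAtlas 𝓘(ℝ, Rn n) ∞ N) {y : Fin n ⊕ Fin n → ℝ}
    (hy : (fun i => y (Sum.inl i)) ∈ e.target) :
    ContMDiffAt 𝓘(ℝ, Fin n ⊕ Fin n → ℝ) 𝓘(ℝ, Fin n ⊕ Fin n → ℝ) ∞
      (projOfCoord D e : _ → ProjCotractorBundle P) y :=
  contMDiffAt_symm_of_mem_maximalAtlas (projHomeomorph_mem_maximalAtlas D he) (x := y) hy

/-- The component `σ` of a section of the cotractor bundle in a chart. -/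
def sectionDensity (D : P.reps) (e : OpenPartialHomeomorph N (Rn n)) (s : ∀ q : N, Cotractor P q)
    (y : Rn n) : ℝ :=
  ((s (e.symm y)).split D).1.eval (coordVol e (e.symm y))

/-- The components `μⱼ` of a section of the cotractor bundle in a chart. -/
def sectionForm (D : P.reps) (e : OpenPartialHomeomorph N (Rn n)) (s : ∀ q : N, Cotractor P q)
    (j : Fin n) (y : Rn n) : ℝ :=
  (((s (e.symm y)).split D).2 (coordField e j (e.symm y))).eval (coordVol e (e.symm y))

theorem tractorDeriv_eq_tractorOf (D : P.reps) (s : ∀ q : N, Cotractor P q) (i : Fin n)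
    (x : Rn n) : tractorDeriv D e s i x
      = tractorOf (christoffel D.1 e) (sectionDensity D e s) (sectionForm D e s) i x := rfl

theorem cotractorCoord_section (D : P.reps) (s : ∀ q : N, Cotractor P q) {y : Rn n}
    (hy : y ∈ e.target) : cotractorCoord D e ⟨e.symm y, s (e.symm y)⟩
      = (y, sectionDensity D e s y, fun j => sectionForm D e s j y) :=
  Prod.ext (e.right_inv hy) rfl

theorem differentiableAt_section (D : P.reps) (he : e ∈ IsManifold.maximalAtlas 𝓘(ℝ, Rn n) ∞ N)
    (hp : p ∈ e.source) {s : ∀ q : N, Cotractor P q}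
    (hs : MDifferentiableAt 𝓘(ℝ, Rn n) 𝓘(ℝ, Rn n × ℝ × Rn n)
      (fun q : N => (⟨q, s q⟩ : CotractorBundle P)) p) :
    DifferentiableAt ℝ (sectionDensity D e s) (e p) ∧
      ∀ j, DifferentiableAt ℝ (sectionForm D e s j) (e p) := by
  have h1 : MDifferentiableAt 𝓘(ℝ, Rn n) 𝓘(ℝ, Rn n × ℝ × Rn n)
      (fun q : N => cotractorCoord D e (⟨q, s q⟩ : CotractorBundle P)) p :=
    ((cotractorCoord_contMDiffAt D he (U := ⟨p, s p⟩) hp).mdifferentiableAt (by simp)).comp p hs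
  have h2 : MDifferentiableAt 𝓘(ℝ, Rn n) 𝓘(ℝ, Rn n × ℝ × Rn n)
      (fun y : Rn n => cotractorCoord D e (⟨e.symm y, s (e.symm y)⟩ : CotractorBundle P)) (e p) := by
    rw [← e.left_inv hp] at h1
    exact h1.comp (e p) ((mdiff_of_maximal he).mdifferentiableAt_symm (e.map_source hp))
  have h3 := h2.differentiableAt
  have h4 := h3.snd
  exact ⟨h4.fst, fun j => (differentiableAt_pi.1 h4.snd) j⟩

theorem mdifferentiableAt_section (D : P.reps) (he : e ∈ IsManifold.maximalAtlas 𝓘(ℝ, Rn n) ∞ N)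
    (hp : p ∈ e.source) {s : ∀ q : N, Cotractor P q}
    (hσ : DifferentiableAt ℝ (sectionDensity D e s) (e p))
    (hμ : ∀ j, DifferentiableAt ℝ (sectionForm D e s j) (e p)) :
    MDifferentiableAt 𝓘(ℝ, Rn n) 𝓘(ℝ, Rn n × ℝ × Rn n)
      (fun q : N => (⟨q, s q⟩ : CotractorBundle P)) p := by
  have h1 : DifferentiableAt ℝ
      (fun y : Rn n => (y, sectionDensity D e s y, fun j => sectionForm D e s j y)) (e p) :=
    differentiableAt_id.prodMk (hσ.prodMk (differentiableAt_pi.2 hμ))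
  have h2 := (((cotractorOfCoord_contMDiffAt (P := P) D he (y := (e p, sectionDensity D e s (e p),
    fun j => sectionForm D e s j (e p))) (e.map_source hp)).mdifferentiableAt (by simp)).comp
      (e p) h1.mdifferentiableAt).comp p ((mdiff_of_maximal he).mdifferentiableAt hp)
  refine h2.congr_of_eventuallyEq ?_
  filter_upwards [e.open_source.mem_nhds hp] with q hq
  have h3 := (cotractorChart D e he).left_inv (x := (⟨q, s q⟩ : CotractorBundle P)) hq
  refine h3.symm.trans ?_
  have h4 := cotractorCoord_section D s (e.map_source hq)
  rw [e.left_inv hq] at h4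
  exact congrArg (cotractorOfCoord D e) h4

theorem sectionDensity_change (D D' : P.reps) (s : ∀ q : N, Cotractor P q) :
    sectionDensity D' e s = sectionDensity D e s := by
  funext y
  simp only [sectionDensity, Cotractor.change_apply (s (e.symm y)) D D']

theorem sectionForm_change (D D' : P.reps) (s : ∀ q : N, Cotractor P q) :
    sectionForm D' e s = fun j y => sectionForm D e s j y
      + P.change D D' (e.symm y) (coordField e j (e.symm y)) * sectionDensity D e s y := by
  funext j y
  simp only [sectionForm, sectionDensity, Cotractor.change_apply (s (e.symm y)) D D']
  rfl

/-- Under a projective change the derivative transforms like a cotractor: its first component is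
unchanged and Υ times that component is added to the second. Simultaneous vanishing of both is
therefore preserved. -/
theorem tractorDeriv_eq_zero_of_change [T2Space N] (hn : 2 ≤ n) (D D' : P.reps)
    (he : e ∈ IsManifold.maximalAtlas 𝓘(ℝ, Rn n) ∞ N) (hp : p ∈ e.source)
    {s : ∀ q : N, Cotractor P q}
    (hs : MDifferentiableAt 𝓘(ℝ, Rn n) 𝓘(ℝ, Rn n × ℝ × Rn n)
      (fun q : N => (⟨q, s q⟩ : CotractorBundle P)) p)
    (h : ∀ i, tractorDeriv D e s i (e p) = 0) (i : Fin n) : tractorDeriv D' e s i (e p) = 0 := by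
  have hx := e.map_source hp
  obtain ⟨hσ, hμ⟩ := differentiableAt_section D he hp hs
  have h1 : ∀ i j k, christoffel D'.1 e i j k =ᶠ[nhds (e p)]
      projectiveChange (christoffel D.1 e)
        (fun i x => P.change D D' (e.symm x) (coordField e i (e.symm x))) i j k := fun i j k => by
    filter_upwards [e.open_target.mem_nhds hx] with y hy
    exact christoffel_eq_projectiveChange (P.change_spec D D') he hy i j k
  have h2 := h i
  rw [tractorDeriv_eq_tractorOf] at h2 ⊢
  rw [sectionForm_change D D', sectionDensity_change D D',
    tractorOf_congr h1 .rfl (fun _ => .rfl), tractorOf_projectiveChange hn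
    (fun i j k => (christoffel_contDiffOn D.1 he i j k).diffAt e.open_target hx)
    (fun i => (form_coordField_contDiffOn he (P.change_spec D D') i).diffAt e.open_target hx)
    (christoffel_symm D.1 he hx) hσ hμ, h2]
  simp
  rfl

theorem coordVol_transition (he : e ∈ IsManifold.maximalAtlas 𝓘(ℝ, Rn n) ∞ N)
    (he' : e' ∈ IsManifold.maximalAtlas 𝓘(ℝ, Rn n) ∞ N) (hp : p ∈ e.source) (hp' : p ∈ e'.source) :
    coordVol e' p = (jacobian (e' ∘ e.symm) (e p)).det • coordVol e p := by
  have h := AlternatingMap.eq_smul_basis_det (coordBasis he hp) (coordVol e' p)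
  rw [funext (coordBasis_apply he hp), coordVol_eq_det he he' hp hp', coordBasis_det] at h
  exact h

theorem jacobian_transition_det_ne_zero (he : e ∈ IsManifold.maximalAtlas 𝓘(ℝ, Rn n) ∞ N)
    (he' : e' ∈ IsManifold.maximalAtlas 𝓘(ℝ, Rn n) ∞ N) (hp : p ∈ e.source)
    (hp' : p ∈ e'.source) : (jacobian (e' ∘ e.symm) (e p)).det ≠ 0 := by
  have h := coordVol_ne_zero he he' hp hp'
  rwa [coordVol_eq_det he he' hp hp'] at h

theorem eq_zero_of_sum_mul_eq_zero {ι : Type*} [Fintype ι] [DecidableEq ι] {M : Matrix ι ι ℝ}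
    (hM : M.det ≠ 0) {t : ι → ℝ} (h : ∀ i, ∑ a, M a i * t a = 0) : t = 0 :=
  Matrix.eq_zero_of_vecMul_eq_zero hM (funext fun i => by
    simpa only [Matrix.vecMul, dotProduct, mul_comm] using! h i)

theorem tractorDeriv_eq_zero_of_chart [T2Space N] (D : P.reps)
    (he : e ∈ IsManifold.maximalAtlas 𝓘(ℝ, Rn n) ∞ N)
    (he' : e' ∈ IsManifold.maximalAtlas 𝓘(ℝ, Rn n) ∞ N) (hp : p ∈ e.source) (hp' : p ∈ e'.source)
    {s : ∀ q : N, Cotractor P q}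
    (hs : MDifferentiableAt 𝓘(ℝ, Rn n) 𝓘(ℝ, Rn n × ℝ × Rn n)
      (fun q : N => (⟨q, s q⟩ : CotractorBundle P)) p)
    (h : ∀ i, tractorDeriv D e s i (e p) = 0) (i : Fin n) : tractorDeriv D e' s i (e' p) = 0 := by
  have hx : e p ∈ (e.symm.trans e').source := by
    simp only [mfld_simps, e.left_inv hp, hp', e.map_source hp]
  have hφx : (e' ∘ e.symm) (e p) = e' p := congrArg e' (e.left_inv hp)
  obtain ⟨hσ, hμ⟩ := differentiableAt_section D he hp hs
  obtain ⟨hσ', hμ'⟩ := differentiableAt_section D he' hp' hs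
  have hJ := jacobian_transition_det_ne_zero he he' hp hp'
  rw [← hφx] at hσ' hμ'
  have hvol : ∀ z ∈ (e.symm.trans e').source, ∀ f : Density n (e.symm z),
      f.eval (coordVol e' (e.symm z)) = |(jacobian (e' ∘ e.symm) z).det| ^ (1 / ((n : ℝ) + 1))
        * f.eval (coordVol e (e.symm z)) := by
    intro z hz f
    have hz1 : z ∈ e.target := hz.1
    rw [coordVol_transition he he' (e.map_target hz1) hz.2, Density.eval_smul_form,
      e.right_inv hz1]
  have key : ∀ i, _ ∧ _ := fun i => tractorOf_pullback (e.symm.trans e').open_source e'.open_target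
    (transition_contDiffOn he he') (fun z hz => e'.map_source hz.2)
    (fun i j k => (christoffel_contDiffOn D.1 he i j k).mono fun z hz => hz.1)
    (christoffel_contDiffOn D.1 he') (christoffel_isConnectionPullback D.1 he he') hx hJ.isUnit
    hσ hμ hσ' hμ' (by
      intro z hz
      have : e'.symm ((e' ∘ e.symm) z) = e.symm z := e'.left_inv hz.2
      exact (congrArg (fun q => ((s q).split D).1.eval (coordVol e' q)) this).trans
        (hvol z hz _)) (by
      intro z hz j
      have hz1 : z ∈ e.target := hz.1
      have : e'.symm ((e' ∘ e.symm) z) = e.symm z := e'.left_inv hz.2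
      have h1 : ∀ b, sectionForm D e' s b ((e' ∘ e.symm) z)
          = (((s (e.symm z)).split D).2 (coordField e' b (e.symm z))).eval
            (coordVol e' (e.symm z)) := fun b =>
        congrArg (fun q => (((s q).split D).2 (coordField e' b q)).eval (coordVol e' q)) this
      simp only [h1]
      rw [sectionForm, ← hvol z hz, coordField_eq_sum he he' (e.map_target hz1) hz.2, e.right_inv hz1, map_sum,
        Density.eval_sum]
      simp only [map_smul, Density.eval_smul]) i
  simp only [← tractorDeriv_eq_tractorOf, h, Prod.fst_zero, Prod.snd_zero, Pi.zero_apply, mul_zero,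
    hφx] at key
  -- The invertible Jacobian is removed once from the density slot and twice from the form slot,
  -- which carries two covariant indices.
  have h1 := eq_zero_of_sum_mul_eq_zero hJ fun i => (key i).1
  have h2 : ∀ i, _ = _ := fun i => eq_zero_of_sum_mul_eq_zero hJ fun j => (key i).2 j
  have h3 : ∀ b, _ = _ := fun b => eq_zero_of_sum_mul_eq_zero hJ fun i => congrFun (h2 i) b
  exact Prod.ext (congrFun h1 i) (funext fun b => congrFun (h3 b) i)

/-- Covariance and projective invariance reduce parallelism, which refers to every chart and every
connection of the class, to a check in one of each. -/
theorem isParallelAt_of_tractorDeriv_eq_zero [T2Space N] (hn : 2 ≤ n) (D : P.reps)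
    (he : e ∈ IsManifold.maximalAtlas 𝓘(ℝ, Rn n) ∞ N) (hp : p ∈ e.source)
    {s : ∀ q : N, Cotractor P q}
    (hs : MDifferentiableAt 𝓘(ℝ, Rn n) 𝓘(ℝ, Rn n × ℝ × Rn n)
      (fun q : N => (⟨q, s q⟩ : CotractorBundle P)) p)
    (h : ∀ i, tractorDeriv D e s i (e p) = 0) : IsParallelAt s p := fun D' _ he' hp' =>
  tractorDeriv_eq_zero_of_change hn D D' he' hp' hs
    (tractorDeriv_eq_zero_of_chart D he he' hp hp' hs h)

end ParallelSections

/-- The intermediate point is a separate variable, so that the chain rule applies when it equals `f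
x` only up to a proved equation; tangent vectors are read in the model spaces for the same reason.
-/
theorem mfderiv_comp_apply_at {E E' E'' : Type*} [NormedAddCommGroup E] [NormedSpace ℝ E]
    [NormedAddCommGroup E'] [NormedSpace ℝ E'] [NormedAddCommGroup E''] [NormedSpace ℝ E'']
    {M M' M'' : Type*} [TopologicalSpace M] [ChartedSpace E M] [TopologicalSpace M']
    [ChartedSpace E' M'] [TopologicalSpace M''] [ChartedSpace E'' M''] {f : M → M'} {g : M' → M''}
    {x : M} {y : M'} (hf : MDifferentiableAt 𝓘(ℝ, E) 𝓘(ℝ, E') f x) (hy : f x = y)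
    (hg : MDifferentiableAt 𝓘(ℝ, E') 𝓘(ℝ, E'') g y) (v : E) :
    (mfderiv 𝓘(ℝ, E) 𝓘(ℝ, E'') (g ∘ f) x v : E'')
      = (mfderiv 𝓘(ℝ, E') 𝓘(ℝ, E'') g y : E' →L[ℝ] E'') (mfderiv 𝓘(ℝ, E) 𝓘(ℝ, E') f x v : E') := by
  subst hy
  rw [mfderiv_comp x hg hf]
  rfl

/-! ### Differentials of the bundle coordinates and of the projectivisation. -/

section PushForward

variable {n : ℕ} {N : Type*} [TopologicalSpace N] [ChartedSpace (Rn n) N]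
  [IsManifold 𝓘(ℝ, Rn n) ∞ N] {P : ProjectiveStructure n N}
  {e : OpenPartialHomeomorph N (Rn n)} {U : CotractorBundle P}

/-- The differential of the coordinates `(x, V₀, Vᵢ)` of the cotractor bundle. -/
def cotractorDiff (D : P.reps) (e : OpenPartialHomeomorph N (Rn n)) (U : CotractorBundle P) :
    TCotractor P U →L[ℝ] Rn n × ℝ × Rn n :=
  mfderiv 𝓘(ℝ, Rn n × ℝ × Rn n) 𝓘(ℝ, Rn n × ℝ × Rn n) (cotractorCoord D e) U

theorem cotractorCoord_mdifferentiableAt (D : P.reps)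
    (he : e ∈ IsManifold.maximalAtlas 𝓘(ℝ, Rn n) ∞ N) (hU : U.base ∈ e.source) :
    MDifferentiableAt 𝓘(ℝ, Rn n × ℝ × Rn n) 𝓘(ℝ, Rn n × ℝ × Rn n)
      (cotractorCoord D e : CotractorBundle P → _) U :=
  (cotractorCoord_contMDiffAt D he hU).mdifferentiableAt (by simp)

/-- The curve U + tW is affine in cotractor coordinates. Its differentiability is obtained by
writing it as the inverse chart applied to that line; without it the derivative defining `vertical`
would have the default value zero. -/
theorem cotractorDiff_vertical (D : P.reps) (he : e ∈ IsManifold.maximalAtlas 𝓘(ℝ, Rn n) ∞ N)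
    (hU : U.base ∈ e.source) (W : Cotractor P U.base) :
    cotractorDiff D e U (vertical U W) = (0, (cotractorCoord D e ⟨U.base, W⟩).2) := by
  let c : ℝ → CotractorBundle P := fun t => ⟨U.base, U.vec + t • W⟩
  let l : ℝ → Rn n × ℝ × Rn n := fun t =>
    cotractorCoord D e U + t • (0, (cotractorCoord D e ⟨U.base, W⟩).2)
  have hl : ∀ t, HasDerivAt l (0, (cotractorCoord D e ⟨U.base, W⟩).2) t := fun t => by
    simpa only [one_smul] using ((hasDerivAt_id' t).smul_const
      ((0, (cotractorCoord D e ⟨U.base, W⟩).2) : Rn n × ℝ × Rn n)).const_add (cotractorCoord D e U)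
  have hcl : cotractorCoord D e ∘ c = l := by
    funext t
    refine Prod.ext ?_ (Prod.ext rfl rfl)
    simp [l, c, cotractorCoord]
  have hc : c = cotractorOfCoord D e ∘ l := by
    rw [← hcl]
    funext t
    exact ((cotractorChart D e he).left_inv (x := c t) hU).symm
  have hc0 : c 0 = U := by simp [c]
  have hdc : MDifferentiableAt 𝓘(ℝ, ℝ) 𝓘(ℝ, Rn n × ℝ × Rn n) c 0 := by
    rw [hc]
    refine MDifferentiableAt.comp (0 : ℝ)
      ((cotractorOfCoord_contMDiffAt D he ?_).mdifferentiableAt (by simp))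
      (hl 0).differentiableAt.mdifferentiableAt
    simpa [l, cotractorCoord] using e.map_source hU
  have h := mfderiv_comp_apply_at hdc hc0 (cotractorCoord_mdifferentiableAt D he hU) (1 : ℝ)
  rw [hcl] at h
  refine h.symm.trans ?_
  rw [mfderiv_eq_fderiv]
  exact (hl 0).deriv

theorem section_cotractorDiff (D : P.reps) (he : e ∈ IsManifold.maximalAtlas 𝓘(ℝ, Rn n) ∞ N)
    (hU : U.base ∈ e.source) {s : ∀ q : N, Cotractor P q} (hsU : s U.base = U.vec)
    (hs : MDifferentiableAt 𝓘(ℝ, Rn n) 𝓘(ℝ, Rn n × ℝ × Rn n)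
      (fun q : N => (⟨q, s q⟩ : CotractorBundle P)) U.base) (v : TN n U.base) :
    cotractorDiff D e U (mfderiv 𝓘(ℝ, Rn n) 𝓘(ℝ, Rn n × ℝ × Rn n)
        (fun q : N => (⟨q, s q⟩ : CotractorBundle P)) U.base v : Rn n × ℝ × Rn n)
      = (fun i => coordForm e i U.base v,
        ∑ i, coordForm e i U.base v * pd i (sectionDensity D e s) (e U.base),
        fun j => ∑ i, coordForm e i U.base v * pd i (sectionForm D e s j) (e U.base)) := by
  obtain ⟨hσ, hμ⟩ := differentiableAt_section D he hU hs
  have h := mfderiv_comp_apply_at hs (by simp [hsU]) (cotractorCoord_mdifferentiableAt D he hU) v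
  refine h.symm.trans ?_
  let G : Rn n → Rn n × ℝ × Rn n := fun y =>
    (y, sectionDensity D e s y, fun j => sectionForm D e s j y)
  have hG : HasFDerivAt G ((ContinuousLinearMap.id ℝ (Rn n)).prod
      ((fderiv ℝ (sectionDensity D e s) (e U.base)).prod
        (ContinuousLinearMap.pi fun j => fderiv ℝ (sectionForm D e s j) (e U.base)))) (e U.base) :=
    (hasFDerivAt_id _).prodMk (hσ.hasFDerivAt.prodMk
      (hasFDerivAt_pi.2 fun j => (hμ j).hasFDerivAt))
  have h1 : (cotractorCoord D e ∘ fun q : N => (⟨q, s q⟩ : CotractorBundle P))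
      =ᶠ[nhds U.base] G ∘ e := by
    filter_upwards [e.open_source.mem_nhds hU] with q hq
    have h4 := cotractorCoord_section D s (e.map_source hq)
    rw [e.left_inv hq] at h4
    exact h4
  have h2 := mfderiv_comp_apply_at ((mdiff_of_maximal he).mdifferentiableAt hU) rfl
    hG.differentiableAt.mdifferentiableAt v
  have h3 : ∀ φ : Rn n → ℝ, fderiv ℝ φ (e U.base) (mfderiv 𝓘(ℝ, Rn n) 𝓘(ℝ, Rn n) e U.base v : Rn n)
      = ∑ i, coordForm e i U.base v * pd i φ (e U.base) := fun φ =>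
    fderiv_eq_sum_pd (f := φ) _
  rw [h1.mfderiv_eq]
  refine h2.trans ?_
  rw [mfderiv_eq_fderiv, hG.fderiv]
  exact Prod.ext rfl (Prod.ext (h3 _) (funext fun j => h3 _))

theorem base_mdifferentiableAt (D : P.reps) (he : e ∈ IsManifold.maximalAtlas 𝓘(ℝ, Rn n) ∞ N)
    (hU : U.base ∈ e.source) :
    MDifferentiableAt 𝓘(ℝ, Rn n × ℝ × Rn n) 𝓘(ℝ, Rn n)
      (CotractorBundle.base : CotractorBundle P → N) U := by
  have h1 := (cotractorCoord_mdifferentiableAt D he hU)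
  have h2 : MDifferentiableAt 𝓘(ℝ, Rn n × ℝ × Rn n) 𝓘(ℝ, Rn n)
      (Prod.fst : Rn n × ℝ × Rn n → Rn n) (cotractorCoord D e U) :=
    differentiableAt_fst.mdifferentiableAt
  have h3 := (((mdiff_of_maximal he).mdifferentiableAt_symm (e.map_source hU)).comp
    (cotractorCoord D e U) h2).comp U h1
  refine h3.congr_of_eventuallyEq ?_
  filter_upwards [(cotractorHomeomorph D he).open_source.mem_nhds hU] with V hV
  exact (e.left_inv hV).symm

theorem coordForm_basePush (D : P.reps) (he : e ∈ IsManifold.maximalAtlas 𝓘(ℝ, Rn n) ∞ N)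
    (hU : U.base ∈ e.source) (w : TCotractor P U) (i : Fin n) :
    coordForm e i U.base (basePush U w) = (cotractorDiff D e U w).1 i := by
  have h1 := mfderiv_comp_apply_at (base_mdifferentiableAt D he hU) rfl
    ((mdiff_of_maximal he).mdifferentiableAt hU) w
  have h2 := mfderiv_comp_apply_at (cotractorCoord_mdifferentiableAt D he hU) rfl
    (g := (Prod.fst : Rn n × ℝ × Rn n → Rn n))
    (differentiableAt_fst.mdifferentiableAt) w
  have h3 : (Prod.fst : Rn n × ℝ × Rn n → Rn n) ∘ (cotractorCoord D e : CotractorBundle P → _)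
      = e ∘ CotractorBundle.base := rfl
  rw [h3] at h2
  have h4 := h1.symm.trans h2
  rw [mfderiv_eq_fderiv, fderiv_fst] at h4
  exact congrFun h4 i

/-- The map `κ` in coordinates. -/
def projectivize (V : Rn n × ℝ × Rn n) : Fin n ⊕ Fin n → ℝ :=
  Sum.elim V.1 fun j => V.2.2 j * V.2.1⁻¹

theorem hasFDerivAt_projectivize {V : Rn n × ℝ × Rn n} (hV : V.2.1 ≠ 0) :
    ∃ L : Rn n × ℝ × Rn n →L[ℝ] Fin n ⊕ Fin n → ℝ, HasFDerivAt projectivize L V ∧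
      ∀ w, L w = Sum.elim w.1 fun j => w.2.2 j / V.2.1 - V.2.2 j * w.2.1 / V.2.1 ^ 2 := by
  have h1 : ∀ j, HasFDerivAt (fun V : Rn n × ℝ × Rn n => V.2.2 j)
      (((ContinuousLinearMap.proj j).comp (ContinuousLinearMap.snd ℝ ℝ (Rn n))).comp
        (ContinuousLinearMap.snd ℝ (Rn n) (ℝ × Rn n))) V := fun j =>
    (((ContinuousLinearMap.proj j).comp (ContinuousLinearMap.snd ℝ ℝ (Rn n))).comp
        (ContinuousLinearMap.snd ℝ (Rn n) (ℝ × Rn n))).hasFDerivAt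
  have h2 : HasFDerivAt (fun V : Rn n × ℝ × Rn n => V.2.1)
      ((ContinuousLinearMap.fst ℝ ℝ (Rn n)).comp
        (ContinuousLinearMap.snd ℝ (Rn n) (ℝ × Rn n))) V :=
    ((ContinuousLinearMap.fst ℝ ℝ (Rn n)).comp
        (ContinuousLinearMap.snd ℝ (Rn n) (ℝ × Rn n))).hasFDerivAt
  have h3 : ∀ i, HasFDerivAt (fun V : Rn n × ℝ × Rn n => V.1 i)
      ((ContinuousLinearMap.proj i).comp (ContinuousLinearMap.fst ℝ (Rn n) (ℝ × Rn n))) V :=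
    fun i => ((ContinuousLinearMap.proj i).comp
      (ContinuousLinearMap.fst ℝ (Rn n) (ℝ × Rn n))).hasFDerivAt
  have h4 : ∀ j, HasFDerivAt (fun V : Rn n × ℝ × Rn n => V.2.2 j * V.2.1⁻¹) _ V := fun j =>
    (h1 j).mul ((hasDerivAt_inv hV).comp_hasFDerivAt V h2)
  have h5 : ∀ a, ∃ L : Rn n × ℝ × Rn n →L[ℝ] ℝ, HasFDerivAt (fun V => projectivize V a) L V ∧
      ∀ w, L w = Sum.elim w.1
        (fun j => w.2.2 j / V.2.1 - V.2.2 j * w.2.1 / V.2.1 ^ 2) a := by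
    rintro (i | j)
    · exact ⟨_, h3 i, fun w => rfl⟩
    · refine ⟨_, h4 j, fun w => ?_⟩
      simp
      field_simp
      ring
  choose L hL hL' using h5
  exact ⟨ContinuousLinearMap.pi L, hasFDerivAt_pi.2 hL, fun w => funext fun a => hL' a w⟩

theorem eval_coordVol_ne_zero (he : e ∈ IsManifold.maximalAtlas 𝓘(ℝ, Rn n) ∞ N) {p : N}
    (hp : p ∈ e.source) {f : Density n p} (hf : f ≠ 0) : f.eval (coordVol e p) ≠ 0 := by
  intro h
  apply hf
  rw [Density.eq_smul_coord he hp f, h, zero_smul]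

theorem ratio_eq_coordVol (he : e ∈ IsManifold.maximalAtlas 𝓘(ℝ, Rn n) ∞ N) {p : N}
    (hp : p ∈ e.source) (f g : Density n p) :
    Density.ratio f g = f.eval (coordVol e p) / g.eval (coordVol e p) := by
  have h := coordBasis_det he hp
  have h1 : coordVol e p = coordVol e p (stdBasis n p) • stdVol n p :=
    AlternatingMap.eq_smul_basis_det _ _
  have h2 : coordVol e p (stdBasis n p) ≠ 0 := by
    rw [← h]
    exact (Module.Basis.isUnit_det _ _).ne_zero
  rw [h1, Density.eval_smul_form, Density.eval_smul_form, mul_div_mul_left _ _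
    (Real.rpow_pos_of_pos (abs_pos.2 h2) _).ne']
  rfl

theorem projCoord_kappa (D : P.reps) (he : e ∈ IsManifold.maximalAtlas 𝓘(ℝ, Rn n) ∞ N)
    (hU : U.base ∈ e.source) (h0 : Cotractor.tau U.vec ≠ 0) :
    projCoord D e (kappa U) = projectivize (cotractorCoord D e U) := by
  have h1 : kappa U = ProjCotractorBundle.mk' U.vec h0 := dif_pos h0
  rw [h1]
  refine congrArg (Sum.elim (e U.base)) (funext fun j => ?_)
  refine (ratio_mk' D U.vec h0 _).trans ?_
  rw [ratio_eq_coordVol he hU]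
  rfl

theorem kappa_base (U : CotractorBundle P) : (kappa U).base = U.base := by
  unfold kappa
  split_ifs <;> rfl

/-- The definition of κ by cases is harmless: τ ≠ 0 is an open condition, so near U the map is (V₀,
Vⱼ) ↦ Vⱼ/V₀ in coordinates. -/
theorem kappa_eventuallyEq (D : P.reps) (he : e ∈ IsManifold.maximalAtlas 𝓘(ℝ, Rn n) ∞ N)
    (hU : U.base ∈ e.source) (h0 : Cotractor.tau U.vec ≠ 0) :
    (kappa : CotractorBundle P → _) =ᶠ[nhds U]
        projOfCoord D e ∘ projectivize ∘ cotractorCoord D e ∧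
      projCoord D e ∘ (kappa : CotractorBundle P → _) =ᶠ[nhds U]
        projectivize ∘ cotractorCoord D e := by
  have h1 : (cotractorCoord D e U).2.1 ≠ 0 := by
    have := eval_coordVol_ne_zero he hU h0
    rwa [Cotractor.tau_eq _ D] at this
  have h2 : ∀ᶠ V in nhds U, (cotractorCoord D e V).2.1 ≠ 0 :=
    ((continuous_fst.comp continuous_snd).continuousAt.comp
      (cotractorCoord_contMDiffAt D he hU).continuousAt).eventually_ne h1
  have h3 : ∀ᶠ V in nhds U, V.base ∈ e.source ∧ Cotractor.tau V.vec ≠ 0 := by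
    filter_upwards [(cotractorHomeomorph D he).open_source.mem_nhds hU, h2] with V hV hV2
    refine ⟨hV, fun h => hV2 ?_⟩
    rw [Cotractor.tau_eq _ D] at h
    simp [cotractorCoord, h]
  constructor
  · filter_upwards [h3] with V hV
    have h4 := (projChart D e he).left_inv (x := kappa V) (by
      change (kappa V).base ∈ e.source
      rw [kappa_base]
      exact hV.1)
    refine h4.symm.trans ?_
    exact congrArg (projOfCoord D e) (projCoord_kappa D he hV.1 hV.2)
  · filter_upwards [h3] with V hV using projCoord_kappa D he hV.1 hV.2

/-- The quotient rule for ξⱼ = Vⱼ/V₀. -/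
theorem mfderiv_projCoord_kappaPush (D : P.reps) (he : e ∈ IsManifold.maximalAtlas 𝓘(ℝ, Rn n) ∞ N)
    (hU : U.base ∈ e.source) (h0 : Cotractor.tau U.vec ≠ 0) (w : TCotractor P U) :
    (mfderiv 𝓘(ℝ, Fin n ⊕ Fin n → ℝ) 𝓘(ℝ, Fin n ⊕ Fin n → ℝ) (projCoord D e) (kappa U)
        (kappaPush U w) : Fin n ⊕ Fin n → ℝ)
      = Sum.elim (cotractorDiff D e U w).1 fun j =>
        (cotractorDiff D e U w).2.2 j / (cotractorCoord D e U).2.1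
          - (cotractorCoord D e U).2.2 j * (cotractorDiff D e U w).2.1
            / (cotractorCoord D e U).2.1 ^ 2 := by
  have h1 : (cotractorCoord D e U).2.1 ≠ 0 := by
    have := eval_coordVol_ne_zero he hU h0
    rwa [Cotractor.tau_eq _ D] at this
  obtain ⟨hk, hk'⟩ := kappa_eventuallyEq D he hU h0
  obtain ⟨L, hL, hL'⟩ := hasFDerivAt_projectivize h1
  have hpc : MDifferentiableAt 𝓘(ℝ, Rn n × ℝ × Rn n) 𝓘(ℝ, Fin n ⊕ Fin n → ℝ)
      (projectivize ∘ cotractorCoord D e : CotractorBundle P → _) U :=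
    hL.differentiableAt.mdifferentiableAt.comp U (cotractorCoord_mdifferentiableAt D he hU)
  have hdk : MDifferentiableAt 𝓘(ℝ, Rn n × ℝ × Rn n) 𝓘(ℝ, Fin n ⊕ Fin n → ℝ)
      (kappa : CotractorBundle P → _) U := by
    refine MDifferentiableAt.congr_of_eventuallyEq ?_ hk
    exact ((projOfCoord_contMDiffAt D he (y := projectivize (cotractorCoord D e U))
      (e.map_source hU)).mdifferentiableAt (by simp)).comp U hpc
  have hkU : (kappa U).base ∈ e.source := by rwa [kappa_base]
  have h2 := mfderiv_comp_apply_at hdk rfl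
    ((projCoord_contMDiffAt D he hkU).mdifferentiableAt (by simp)) w
  refine h2.symm.trans ?_
  rw [hk'.mfderiv_eq]
  refine (mfderiv_comp_apply_at (cotractorCoord_mdifferentiableAt D he hU) rfl
    hL.differentiableAt.mdifferentiableAt w).trans ?_
  rw [mfderiv_eq_fderiv, hL.fderiv]
  exact hL' _

end PushForward

/-! ### The pairing in coordinates and the explicit tensors. -/

section Pairing

variable {n : ℕ} {N : Type*} [TopologicalSpace N] [ChartedSpace (Rn n) N]
  [IsManifold 𝓘(ℝ, Rn n) ∞ N] {P : ProjectiveStructure n N}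
  {e : OpenPartialHomeomorph N (Rn n)} {U : CotractorBundle P}

theorem cotractorCoord_tau_ne_zero (D : P.reps) (he : e ∈ IsManifold.maximalAtlas 𝓘(ℝ, Rn n) ∞ N)
    (hU : U.base ∈ e.source) (h0 : Cotractor.tau U.vec ≠ 0) : (cotractorCoord D e U).2.1 ≠ 0 := by
  have := eval_coordVol_ne_zero he hU h0
  rwa [Cotractor.tau_eq _ D] at this

/-- The components of the form part of `W`, divided by `τ(U)`. -/
def formCoord (D : P.reps) (e : OpenPartialHomeomorph N (Rn n)) (U : CotractorBundle P)
    (W : Cotractor P U.base) (j : Fin n) : ℝ :=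
  (cotractorCoord D e ⟨U.base, W⟩).2.2 j / (cotractorCoord D e U).2.1
    - (cotractorCoord D e U).2.2 j * (cotractorCoord D e ⟨U.base, W⟩).2.1
      / (cotractorCoord D e U).2.1 ^ 2

theorem tau_formPart (h0 : Cotractor.tau U.vec ≠ 0) (W : Cotractor P U.base) :
    Cotractor.tau (formPart U W) = 0 := by
  have h1 := Density.eq_smul_std (Cotractor.tau W)
  have h2 := Density.eq_smul_std (Cotractor.tau U.vec)
  rw [formPart, map_sub, map_smul, sub_eq_zero]
  refine h1.trans (Eq.symm ((congrArg _ h2).trans ?_))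
  rw [smul_smul, Density.ratio, div_mul_cancel₀ _ (Density.stdVol_ne h0)]

/-- The form part has vanishing σ, so its μ is the same in every splitting. -/
theorem pairing_congr (D D' : P.reps) (h0 : Cotractor.tau U.vec ≠ 0) (v : TN n U.base)
    (W : Cotractor P U.base) : pairing D U v W = pairing D' U v W := by
  have h := tau_formPart h0 W
  rw [Cotractor.tau_eq _ D'] at h
  rw [pairing, pairing, Cotractor.change_apply (formPart U W) D' D, h]
  simp

theorem pairing_eq_sum (D : P.reps) (he : e ∈ IsManifold.maximalAtlas 𝓘(ℝ, Rn n) ∞ N)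
    (hU : U.base ∈ e.source) (h0 : Cotractor.tau U.vec ≠ 0) (v : TN n U.base)
    (W : Cotractor P U.base) :
    pairing D U v W = ∑ j, coordForm e j U.base v * formCoord D e U W j := by
  have h1 := cotractorCoord_tau_ne_zero D he hU h0
  rw [pairing, ratio_eq_coordVol he hU, formPart, ratio_eq_coordVol he hU, Cotractor.tau_eq _ D,
    Cotractor.tau_eq _ D]
  have h2 : ∀ r : ℝ, (((W - r • U.vec).split D).2 v).eval (coordVol e U.base)
      = ∑ j, coordForm e j U.base v * ((cotractorCoord D e ⟨U.base, W⟩).2.2 j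
        - r * (cotractorCoord D e U).2.2 j) := by
    intro r
    have h3 : (((W - r • U.vec).split D).2 v) = (W.split D).2 v - r • (U.vec.split D).2 v := rfl
    have h4 : ∀ V : Cotractor P U.base, ((V.split D).2 v).eval (coordVol e U.base)
        = ∑ j, coordForm e j U.base v * (cotractorCoord D e ⟨U.base, V⟩).2.2 j := by
      intro V
      conv_lhs => rw [tangent_eq_sum he hU v, map_sum, Density.eval_sum]
      simp only [map_smul, Density.eval_smul]
      rfl
    rw [h3, sub_eq_add_neg, ← neg_smul, Density.eval_add, Density.eval_smul, h4, h4 U.vec,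
      Finset.mul_sum, ← Finset.sum_add_distrib]
    exact Finset.sum_congr rfl fun j _ => by ring
  rw [h2, Finset.sum_div]
  refine Finset.sum_congr rfl fun j _ => ?_
  have h5 : (U.vec.split D).1.eval (coordVol e U.base) = (cotractorCoord D e U).2.1 := rfl
  have h6 : (W.split D).1.eval (coordVol e U.base) = (cotractorCoord D e ⟨U.base, W⟩).2.1 := rfl
  rw [h5, h6, formCoord]
  field_simp

theorem dx_kappaPush (D : P.reps) (he : e ∈ IsManifold.maximalAtlas 𝓘(ℝ, Rn n) ∞ N)
    (hU : U.base ∈ e.source) (h0 : Cotractor.tau U.vec ≠ 0) (h : TCotractor P U)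
    (W : Cotractor P U.base) (i : Fin n) :
    dx D e (kappa U) i (kappaPush U (h + vertical U W)) = coordForm e i U.base (basePush U h) := by
  rw [dx, mfderiv_projCoord_kappaPush D he hU h0, coordForm_basePush D he hU, map_add,
    cotractorDiff_vertical D he hU]
  simp

/-- A section that is parallel at the base point with value U has its first derivatives there
dictated by the tractor connection. A horizontal vector is thus determined by U and its projection.
-/
theorem horizontal_cotractorDiff (D : P.reps) (he : e ∈ IsManifold.maximalAtlas 𝓘(ℝ, Rn n) ∞ N)
    (hU : U.base ∈ e.source) {h : TCotractor P U} (hh : IsHorizontal U h) :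
    (cotractorDiff D e U h).2.1 = ∑ i, coordForm e i U.base (basePush U h)
        * ((cotractorCoord D e U).2.2 i - (∑ k, christoffel D.1 e i k k (e U.base)) / ((n : ℝ) + 1)
          * (cotractorCoord D e U).2.1) ∧
    ∀ j, (cotractorDiff D e U h).2.2 j = ∑ i, coordForm e i U.base (basePush U h)
        * (∑ k, christoffel D.1 e i j k (e U.base) * (cotractorCoord D e U).2.2 k
          - (∑ k, christoffel D.1 e i k k (e U.base)) / ((n : ℝ) + 1) * (cotractorCoord D e U).2.2 j
          - schouten D.1 e i j (e U.base) * (cotractorCoord D e U).2.1) := by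
  have hb := fun i => coordForm_basePush D he hU h i
  obtain ⟨s, hsU, hs, hp, v, hv⟩ := hh
  have hd := section_cotractorDiff D he hU hsU hs v
  rw [← hv] at hd
  have hbv : ∀ i, coordForm e i U.base (basePush U h) = coordForm e i U.base v := fun i => by
    rw [hb, hd]
  have hp' := hp D e he hU
  have hσ : sectionDensity D e s (e U.base) = (cotractorCoord D e U).2.1 := by
    have := cotractorCoord_section D s (e.map_source hU)
    rw [e.left_inv hU, hsU] at this
    exact (congrArg (fun y => y.2.1) this).symm
  have hμ : ∀ j, sectionForm D e s j (e U.base) = (cotractorCoord D e U).2.2 j := by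
    have := cotractorCoord_section D s (e.map_source hU)
    rw [e.left_inv hU, hsU] at this
    exact fun j => (congrArg (fun y => y.2.2 j) this).symm
  have h1 : ∀ i, _ := fun i => congrArg Prod.fst (hp' i)
  have h2 : ∀ i j, _ := fun i j => congrFun (congrArg Prod.snd (hp' i)) j
  simp only [tractorDeriv_eq_tractorOf, tractorOf, hσ, hμ, Prod.fst_zero, Prod.snd_zero,
    Pi.zero_apply] at h1 h2
  have e1 : ∀ i j, schouten D.1 e i j = schoutenOf (christoffel D.1 e) i j := fun i j => rfl
  simp only [hd, hbv, e1]
  refine ⟨Finset.sum_congr rfl fun i _ => ?_, fun j => Finset.sum_congr rfl fun i _ => ?_⟩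
  · linear_combination coordForm e i U.base v * h1 i
  · linear_combination coordForm e i U.base v * h2 i j

theorem projCoord_kappa_inr (D : P.reps) (he : e ∈ IsManifold.maximalAtlas 𝓘(ℝ, Rn n) ∞ N)
    (hU : U.base ∈ e.source) (h0 : Cotractor.tau U.vec ≠ 0) (j : Fin n) :
    projCoord D e (kappa U) (Sum.inr j)
      = (cotractorCoord D e U).2.2 j / (cotractorCoord D e U).2.1 :=
  congrFun (projCoord_kappa D he hU h0) (Sum.inr j)

/-- The central computation. In the quotient rule for μⱼ/σ the density terms Γᵏᵢₖ/(n+1) cancel, the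
term μᵢ of dσ produces -ξᵢξⱼ, and the vertical part contributes exactly the form part of W. -/
theorem dxi_kappaPush (D : P.reps) (he : e ∈ IsManifold.maximalAtlas 𝓘(ℝ, Rn n) ∞ N)
    (hU : U.base ∈ e.source) (h0 : Cotractor.tau U.vec ≠ 0) {h : TCotractor P U}
    (hh : IsHorizontal U h) (W : Cotractor P U.base) (j : Fin n) :
    dxi D e (kappa U) j (kappaPush U (h + vertical U W)) = formCoord D e U W j
      + ∑ i, coordForm e i U.base (basePush U h)
        * (∑ k, christoffel D.1 e i j k (e U.base) * projCoord D e (kappa U) (Sum.inr k)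
          - projCoord D e (kappa U) (Sum.inr i) * projCoord D e (kappa U) (Sum.inr j)
          - schouten D.1 e i j (e U.base)) := by
  have h1 := cotractorCoord_tau_ne_zero D he hU h0
  obtain ⟨hd1, hd2⟩ := horizontal_cotractorDiff D he hU hh
  rw [dxi, mfderiv_projCoord_kappaPush D he hU h0, map_add, cotractorDiff_vertical D he hU]
  simp only [Sum.elim_inr, Prod.snd_add, Prod.fst_add, Pi.add_apply, hd1, hd2,
    projCoord_kappa_inr D he hU h0]
  rw [formCoord]
  have e1 : ∀ i, ∑ k, christoffel D.1 e i j k (e U.base)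
      * ((cotractorCoord D e U).2.2 k / (cotractorCoord D e U).2.1)
      = (∑ k, christoffel D.1 e i j k (e U.base) * (cotractorCoord D e U).2.2 k)
        / (cotractorCoord D e U).2.1 := fun i => by
    rw [Finset.sum_div]
    exact Finset.sum_congr rfl fun k _ => by ring
  simp only [e1]
  generalize hu : (fun i => coordForm e i U.base (basePush U h)) = u
  have hu' : ∀ i, coordForm e i U.base (basePush U h) = u i := congrFun hu
  simp only [hu']
  rw [add_div, mul_add, add_div, add_sub_add_comm, add_comm]
  congr 1
  rw [Finset.sum_div, Finset.mul_sum, Finset.sum_div, ← Finset.sum_sub_distrib]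
  refine Finset.sum_congr rfl fun i _ => ?_
  field_simp
  ring

/-- The horizontal and vertical parts of tangent vectors to `ℙ(𝒯*) ∖ 𝒵(τ)` determine the explicit
metric. -/
theorem explicitMetric_kappaPush (D : P.reps) (he : e ∈ IsManifold.maximalAtlas 𝓘(ℝ, Rn n) ∞ N)
    (hU : U.base ∈ e.source) (h0 : Cotractor.tau U.vec ≠ 0) {h₁ h₂ : TCotractor P U}
    (hh₁ : IsHorizontal U h₁) (hh₂ : IsHorizontal U h₂) (W₁ W₂ : Cotractor P U.base) :
    explicitMetric D e (kappa U) (kappaPush U (h₁ + vertical U W₁))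
        (kappaPush U (h₂ + vertical U W₂))
      = (pairing D U (basePush U h₁) W₂ + pairing D U (basePush U h₂) W₁) / 2 := by
  have ht : ∀ {h : TCotractor P U} (_ : IsHorizontal U h) (W : Cotractor P U.base) (j : Fin n),
      theta D e (kappa U) j (kappaPush U (h + vertical U W)) = formCoord D e U W j
        - ∑ i, coordForm e i U.base (basePush U h)
          * ((schouten D.1 e i j (e U.base) - schouten D.1 e j i (e U.base)) / 2) := by
    intro h hh W j
    simp only [theta, dxi_kappaPush D he hU h0 hh, dx_kappaPush D he hU h0, kappa_base]
    rw [add_sub_assoc, ← Finset.sum_sub_distrib, sub_eq_add_neg, ← Finset.sum_neg_distrib]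
    congr 1
    exact Finset.sum_congr rfl fun i _ => by ring
  rw [explicitMetric, pairing_eq_sum D he hU h0, pairing_eq_sum D he hU h0,
    ← Finset.sum_add_distrib, ← Finset.sum_div]
  congr 1
  simp only [ht hh₁, ht hh₂, dx_kappaPush D he hU h0, sub_mul, mul_sub, Finset.sum_add_distrib,
    Finset.sum_sub_distrib]
  -- Since θⱼ contains only the symmetric part of P, it misses the form part of W by a contraction
  -- with the skew part, which vanishes on symmetrisation in the two vectors.
  have hz : ∀ v w : Fin n → ℝ, ∑ j, (∑ i, v i
        * ((schouten D.1 e i j (e U.base) - schouten D.1 e j i (e U.base)) / 2)) * w j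
      + ∑ j, v j * ∑ i, w i
        * ((schouten D.1 e i j (e U.base) - schouten D.1 e j i (e U.base)) / 2) = 0 := by
    intro v w
    simp only [Finset.sum_mul, Finset.mul_sum]
    rw [Finset.sum_comm, ← Finset.sum_add_distrib]
    refine Finset.sum_eq_zero fun j _ => ?_
    rw [← Finset.sum_add_distrib]
    exact Finset.sum_eq_zero fun i _ => by ring
  have := hz (fun i => coordForm e i U.base (basePush U h₁))
    (fun i => coordForm e i U.base (basePush U h₂))
  simp only [mul_comm (formCoord D e U W₁ _)]
  linear_combination -this

/-- The minus sign arises because dξᵢ∧dxⁱ evaluates the form part of the first vector on the second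
with a plus sign, opposite to the order in the pairing. -/
theorem explicitForm_kappaPush (D : P.reps) (he : e ∈ IsManifold.maximalAtlas 𝓘(ℝ, Rn n) ∞ N)
    (hU : U.base ∈ e.source) (h0 : Cotractor.tau U.vec ≠ 0) {h₁ h₂ : TCotractor P U}
    (hh₁ : IsHorizontal U h₁) (hh₂ : IsHorizontal U h₂) (W₁ W₂ : Cotractor P U.base) :
    -explicitForm D e (kappa U) (kappaPush U (h₁ + vertical U W₁))
        (kappaPush U (h₂ + vertical U W₂))
      = (pairing D U (basePush U h₁) W₂ - pairing D U (basePush U h₂) W₁) / 2 := by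
  rw [explicitForm, pairing_eq_sum D he hU h0, pairing_eq_sum D he hU h0,
    ← Finset.sum_sub_distrib, ← Finset.sum_div]
  simp only [dxi_kappaPush D he hU h0 hh₁, dxi_kappaPush D he hU h0 hh₂, dx_kappaPush D he hU h0,
    kappa_base, add_mul, mul_add, Finset.sum_sub_distrib, Finset.sum_add_distrib]
  generalize projCoord D e (kappa U) = ξ
  have hs : ∀ i j k, christoffel D.1 e i j k (e U.base) = christoffel D.1 e j i k (e U.base) :=
    christoffel_symm D.1 he (e.map_source hU)
  -- The Γ and ξξ terms are symmetric and cancel; what is left of P is its skew part, cancelled by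
  -- the second term of the explicit form.
  have hz : ∀ v w : Fin n → ℝ, ∑ j, (∑ i, v i
        * (∑ k, christoffel D.1 e i j k (e U.base) * ξ (Sum.inr k)
          - ξ (Sum.inr i) * ξ (Sum.inr j) - schouten D.1 e i j (e U.base))) * w j
      - ∑ j, v j * ∑ i, w i
        * (∑ k, christoffel D.1 e i j k (e U.base) * ξ (Sum.inr k)
          - ξ (Sum.inr i) * ξ (Sum.inr j) - schouten D.1 e i j (e U.base))
      + 2 * ∑ i, ∑ j, (schouten D.1 e i j (e U.base) - schouten D.1 e j i (e U.base)) / 2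
        * ((v i * w j - v j * w i) / 2) = 0 := by
    intro v w
    have hc : ∑ i, ∑ j, (schouten D.1 e i j (e U.base) - schouten D.1 e j i (e U.base)) / 2
        * (v j * w i) = -∑ i, ∑ j, (schouten D.1 e i j (e U.base)
          - schouten D.1 e j i (e U.base)) / 2 * (v i * w j) := by
      rw [Finset.sum_comm, ← Finset.sum_neg_distrib]
      refine Finset.sum_congr rfl fun i _ => ?_
      rw [← Finset.sum_neg_distrib]
      exact Finset.sum_congr rfl fun j _ => by ring
    have hd : 2 * ∑ i, ∑ j, (schouten D.1 e i j (e U.base) - schouten D.1 e j i (e U.base)) / 2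
        * ((v i * w j - v j * w i) / 2) = ∑ i, ∑ j, (schouten D.1 e i j (e U.base)
          - schouten D.1 e j i (e U.base)) * (v i * w j) := by
      have : ∀ i j, (schouten D.1 e i j (e U.base) - schouten D.1 e j i (e U.base)) / 2
          * ((v i * w j - v j * w i) / 2)
          = 1 / 2 * ((schouten D.1 e i j (e U.base) - schouten D.1 e j i (e U.base)) / 2
            * (v i * w j)) - 1 / 2 * ((schouten D.1 e i j (e U.base)
              - schouten D.1 e j i (e U.base)) / 2 * (v j * w i)) := fun i j => by ring
      simp only [this, Finset.sum_sub_distrib, ← Finset.mul_sum, hc]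
      simp only [div_mul_eq_mul_div, ← Finset.sum_div]
      ring
    rw [hd]
    simp only [Finset.sum_mul, Finset.mul_sum]
    rw [Finset.sum_comm, ← Finset.sum_sub_distrib, ← Finset.sum_add_distrib]
    refine Finset.sum_eq_zero fun i _ => ?_
    rw [← Finset.sum_sub_distrib, ← Finset.sum_add_distrib]
    refine Finset.sum_eq_zero fun j _ => ?_
    simp only [hs i j]
    ring
  have := hz (fun i => coordForm e i U.base (basePush U h₁))
    (fun i => coordForm e i U.base (basePush U h₂))
  simp only [mul_comm (formCoord D e U W₁ _)]
  linear_combination (-1 / 2) * this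

end Pairing

/-! ### Existence of horizontal vectors, uniqueness, and the global tensors. -/

section Spanning

variable {n : ℕ} {N : Type*} [TopologicalSpace N] [ChartedSpace (Rn n) N]
  [IsManifold 𝓘(ℝ, Rn n) ∞ N] {P : ProjectiveStructure n N}
  {e e' : OpenPartialHomeomorph N (Rn n)} {U : CotractorBundle P}

theorem hasFDerivAt_affine {ι : Type*} [Fintype ι] (c : ℝ) (a x y : ι → ℝ) :
    ∃ L : (ι → ℝ) →L[ℝ] ℝ, HasFDerivAt (fun z : ι → ℝ => c + ∑ k, a k * (z k - x k)) L y ∧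
      ∀ v, L v = ∑ k, a k * v k := by
  refine ⟨∑ k, a k • ContinuousLinearMap.proj k, ?_, fun v => by simp⟩
  refine HasFDerivAt.const_add _ (HasFDerivAt.fun_sum fun k _ => ?_)
  exact ((hasFDerivAt_apply k y).sub_const _).const_mul _

theorem differentiableAt_affine {ι : Type*} [Fintype ι] (c : ℝ) (a x y : ι → ℝ) :
    DifferentiableAt ℝ (fun z : ι → ℝ => c + ∑ k, a k * (z k - x k)) y :=
  (hasFDerivAt_affine c a x y).choose_spec.1.differentiableAt

theorem pd_affine {ι : Type*} [Fintype ι] [DecidableEq ι] (c : ℝ) (a x y : ι → ℝ) (i : ι) :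
    pd i (fun z : ι → ℝ => c + ∑ k, a k * (z k - x k)) y = a i := by
  obtain ⟨L, hL, hL'⟩ := hasFDerivAt_affine c a x y
  rw [pd, hL.fderiv, hL']
  simp [Pi.single_apply]

/-- A section affine in the coordinates can be given any value and any first derivatives at the
point, in particular those required for being parallel there. Flatness is not needed, since the
condition concerns a single point. -/
theorem exists_isHorizontal [T2Space N] (hn : 2 ≤ n) (D : P.reps)
    (he : e ∈ IsManifold.maximalAtlas 𝓘(ℝ, Rn n) ∞ N) (hU : U.base ∈ e.source)
    (v : TN n U.base) : ∃ h : TCotractor P U, IsHorizontal U h ∧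
      ∀ i, coordForm e i U.base (basePush U h) = coordForm e i U.base v := by
  set x := e U.base with hx
  set V₀ := (cotractorCoord D e U).2.1
  set V := (cotractorCoord D e U).2.2
  let t : Fin n → ℝ := fun i => (∑ k, christoffel D.1 e i k k x) / ((n : ℝ) + 1)
  -- The slopes solve ∇σ - μ = 0 and ∇μ + Pσ = 0 at x for the partial derivatives.
  let σ : Rn n → ℝ := fun y => V₀ + ∑ i, (V i - t i * V₀) * (y i - x i)
  let μ : Fin n → Rn n → ℝ := fun j y => V j + ∑ i, (∑ k, christoffel D.1 e i j k x * V k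
    - t i * V j - schouten D.1 e i j x * V₀) * (y i - x i)
  let s : ∀ q : N, Cotractor P q := fun q => cotractorAt D e q (σ (e q), fun j => μ j (e q))
  have hσx : σ x = V₀ := by simp [σ]
  have hμx : ∀ j, μ j x = V j := fun j => by simp [μ]
  have hc : ∀ y ∈ e.target, (sectionDensity D e s y, fun j => sectionForm D e s j y)
      = (σ y, fun j => μ j y) := by
    intro y hy
    have h1 := cotractorCoord_section D s hy
    have h2 := cotractorCoord_cotractorAt_self he D (e.map_target hy)
      (σ (e (e.symm y)), fun j => μ j (e (e.symm y)))
    rw [h1, e.right_inv hy] at h2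
    exact congrArg Prod.snd h2
  have hev : ∀ᶠ y in nhds x, y ∈ e.target := e.open_target.mem_nhds (e.map_source hU)
  have hσ : sectionDensity D e s =ᶠ[nhds x] σ := by
    filter_upwards [hev] with y hy using congrArg Prod.fst (hc y hy)
  have hμ : ∀ j, sectionForm D e s j =ᶠ[nhds x] μ j := fun j => by
    filter_upwards [hev] with y hy using congrFun (congrArg Prod.snd (hc y hy)) j
  have hsU : s U.base = U.vec := by
    simp only [s, ← hx, hσx, hμx]
    exact cotractorAt_eq he D hU U.vec
  have hs : MDifferentiableAt 𝓘(ℝ, Rn n) 𝓘(ℝ, Rn n × ℝ × Rn n)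
      (fun q : N => (⟨q, s q⟩ : CotractorBundle P)) U.base :=
    mdifferentiableAt_section D he hU
      ((differentiableAt_affine _ _ _ _).congr_of_eventuallyEq hσ)
      fun j => (differentiableAt_affine _ _ _ _).congr_of_eventuallyEq (hμ j)
  have hp : IsParallelAt s U.base := by
    refine isParallelAt_of_tractorDeriv_eq_zero hn D he hU hs fun i => ?_
    rw [tractorDeriv_eq_tractorOf, tractorOf_congr (fun _ _ _ => .rfl) hσ hμ]
    have e1 : ∀ i j, schouten D.1 e i j = schoutenOf (christoffel D.1 e) i j := fun i j => rfl
    refine Prod.ext ?_ (funext fun j => ?_)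
    · simp only [tractorOf, hσx, hμx]
      rw [pd_affine]
      simp only [t, Prod.fst_zero]
      ring
    · simp only [tractorOf, hσx, hμx]
      rw [pd_affine]
      simp only [t, e1, Prod.snd_zero, Pi.zero_apply]
      ring
  refine ⟨_, ⟨s, hsU, hs, hp, v, rfl⟩, fun i => ?_⟩
  refine (coordForm_basePush D he hU _ i).trans ?_
  exact congrArg (fun y => y.1 i) (section_cotractorDiff D he hU hsU hs v)

theorem projCoord_mfderiv_injective (D : P.reps)
    (he : e ∈ IsManifold.maximalAtlas 𝓘(ℝ, Rn n) ∞ N) {m : ProjCotractorBundle P}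
    (hm : m.base ∈ e.source) {w w' : TProj P m} (h1 : ∀ i, dx D e m i w = dx D e m i w')
    (h2 : ∀ i, dxi D e m i w = dxi D e m i w') : w = w' := by
  have hmem := projHomeomorph_mem_maximalAtlas D he
  have h : (projHomeomorph D he).MDifferentiable 𝓘(ℝ, Fin n ⊕ Fin n → ℝ)
      𝓘(ℝ, Fin n ⊕ Fin n → ℝ) :=
    ⟨(contMDiffOn_of_mem_maximalAtlas hmem).mdifferentiableOn (by simp),
      (contMDiffOn_symm_of_mem_maximalAtlas hmem).mdifferentiableOn (by simp)⟩
  refine h.mfderiv_injective (x := m) hm (funext ?_)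
  rintro (i | i)
  · exact h1 i
  · exact h2 i

/-- The horizontal vector accounts for the dx-components. The form part of W is arbitrary and
accounts for what is left of the dξ-components. -/
theorem exists_eq_kappaPush [T2Space N] (hn : 2 ≤ n) (h0 : Cotractor.tau U.vec ≠ 0)
    (w : TProj P (kappa U)) : ∃ (h : TCotractor P U) (W : Cotractor P U.base),
      IsHorizontal U h ∧ kappaPush U (h + vertical U W) = w := by
  obtain ⟨D⟩ : Nonempty P.reps := P.nonempty.to_subtype
  have he := IsManifold.chart_mem_maximalAtlas (I := 𝓘(ℝ, Rn n)) (n := ∞) U.base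
  have hU : U.base ∈ (chartAt (Rn n) U.base).source := mem_chart_source _ _
  generalize chartAt (Rn n) U.base = e at he hU
  obtain ⟨h, hh, hb⟩ := exists_isHorizontal hn D he hU
    (∑ i, dx D e (kappa U) i w • coordField e i U.base)
  have hb' : ∀ i, coordForm e i U.base (basePush U h) = dx D e (kappa U) i w := fun i => by
    rw [hb, map_sum]
    simp [coordForm_coordField_self he hU, Pi.single_apply]
  have h1 := cotractorCoord_tau_ne_zero D he hU h0
  let c : Fin n → ℝ := fun j => dxi D e (kappa U) j w
    - ∑ i, coordForm e i U.base (basePush U h)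
        * (∑ k, christoffel D.1 e i j k (e U.base) * projCoord D e (kappa U) (Sum.inr k)
          - projCoord D e (kappa U) (Sum.inr i) * projCoord D e (kappa U) (Sum.inr j)
          - schouten D.1 e i j (e U.base))
  -- With zero density component, W already lies in the kernel of τ; the factor V₀ undoes the
  -- division by τ(U) in `formCoord`.
  refine ⟨h, cotractorAt D e U.base (0, fun j => (cotractorCoord D e U).2.1 * c j), hh, ?_⟩
  refine projCoord_mfderiv_injective D he (by rwa [kappa_base]) (fun i => ?_) fun j => ?_
  · rw [dx_kappaPush D he hU h0, hb']
  · rw [dxi_kappaPush D he hU h0 hh, formCoord, cotractorCoord_cotractorAt_self he D hU]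
    simp only [mul_zero, zero_div, sub_zero]
    rw [mul_div_cancel_left₀ _ h1]
    simp [c]

theorem exists_eq_kappa (m : ProjCotractorBundle P) :
    ∃ U : CotractorBundle P, Cotractor.tau U.vec ≠ 0 ∧ kappa U = m := by
  refine ⟨⟨m.base, m.line.rep⟩, m.tau_ne, ?_⟩
  obtain ⟨p, l, hl⟩ := m
  rw [kappa, dif_pos hl]
  simp only [ProjCotractorBundle.mk', Projectivization.mk_rep]

/-- Every point of `M` is some κ(U), and at it every tangent vector is a push-forward of the
admissible kind, so the defining identity prescribes all values. -/
theorem IsPairingMetric.eq [T2Space N] (hn : 2 ≤ n) {g g' : ProjTensor P} (h : IsPairingMetric g)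
    (h' : IsPairingMetric g') : g = g' := by
  obtain ⟨D⟩ : Nonempty P.reps := P.nonempty.to_subtype
  funext m
  obtain ⟨U, h0, rfl⟩ := exists_eq_kappa m
  ext w₁ w₂
  obtain ⟨h₁, W₁, hh₁, rfl⟩ := exists_eq_kappaPush hn h0 w₁
  obtain ⟨h₂, W₂, hh₂, rfl⟩ := exists_eq_kappaPush hn h0 w₂
  rw [h U h0 D h₁ h₂ hh₁ hh₂, h' U h0 D h₁ h₂ hh₁ hh₂]

theorem IsPairingForm.eq [T2Space N] (hn : 2 ≤ n) {g g' : ProjTensor P} (h : IsPairingForm g)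
    (h' : IsPairingForm g') : g = g' := by
  obtain ⟨D⟩ : Nonempty P.reps := P.nonempty.to_subtype
  funext m
  obtain ⟨U, h0, rfl⟩ := exists_eq_kappa m
  ext w₁ w₂
  obtain ⟨h₁, W₁, hh₁, rfl⟩ := exists_eq_kappaPush hn h0 w₁
  obtain ⟨h₂, W₂, hh₂, rfl⟩ := exists_eq_kappaPush hn h0 w₂
  rw [h U h0 D h₁ h₂ hh₁ hh₂, h' U h0 D h₁ h₂ hh₁ hh₂]

variable (D : P.reps) (m : ProjCotractorBundle P)

theorem dx_add (i : Fin n) (w w' : TProj P m) : dx D e m i (w + w') = dx D e m i w + dx D e m i w' := by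
  simp only [dx, map_add]
  rfl

theorem dx_smul (i : Fin n) (c : ℝ) (w : TProj P m) : dx D e m i (c • w) = c * dx D e m i w := by
  simp only [dx, map_smul]
  rfl

theorem dxi_add (i : Fin n) (w w' : TProj P m) :
    dxi D e m i (w + w') = dxi D e m i w + dxi D e m i w' := by
  simp only [dxi, map_add]
  rfl

theorem dxi_smul (i : Fin n) (c : ℝ) (w : TProj P m) : dxi D e m i (c • w) = c * dxi D e m i w := by
  simp only [dxi, map_smul]
  rfl

theorem theta_add (i : Fin n) (w w' : TProj P m) :
    theta D e m i (w + w') = theta D e m i w + theta D e m i w' := by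
  simp only [theta, dx_add, dxi_add, mul_add, Finset.sum_add_distrib]
  ring

theorem theta_smul (i : Fin n) (c : ℝ) (w : TProj P m) :
    theta D e m i (c • w) = c * theta D e m i w := by
  simp only [theta, dx_smul, dxi_smul, mul_sub, Finset.mul_sum]
  congr 1
  exact Finset.sum_congr rfl fun k _ => by ring

/-- The explicit metric as a bilinear form. -/
def explicitMetricBilin (D : P.reps) (e : OpenPartialHomeomorph N (Rn n))
    (m : ProjCotractorBundle P) : LinearMap.BilinForm ℝ (TProj P m) :=
  LinearMap.mk₂ ℝ (explicitMetric D e m)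
    (fun w w' u => by
      simp only [explicitMetric, theta_add, dx_add, ← Finset.sum_add_distrib]
      exact Finset.sum_congr rfl fun i _ => by ring)
    (fun c w u => by
      simp only [explicitMetric, theta_smul, dx_smul, smul_eq_mul, Finset.mul_sum]
      exact Finset.sum_congr rfl fun i _ => by ring)
    (fun w u u' => by
      simp only [explicitMetric, theta_add, dx_add, ← Finset.sum_add_distrib]
      exact Finset.sum_congr rfl fun i _ => by ring)
    (fun c w u => by
      simp only [explicitMetric, theta_smul, dx_smul, smul_eq_mul, Finset.mul_sum]
      exact Finset.sum_congr rfl fun i _ => by ring)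

/-- The explicit two-form as a bilinear form. -/
def explicitFormBilin (D : P.reps) (e : OpenPartialHomeomorph N (Rn n))
    (m : ProjCotractorBundle P) : LinearMap.BilinForm ℝ (TProj P m) :=
  LinearMap.mk₂ ℝ (explicitForm D e m)
    (fun w w' u => by
      simp only [explicitForm, dxi_add, dx_add, ← Finset.sum_add_distrib]
      refine Finset.sum_congr rfl fun i _ => ?_
      rw [add_add_add_comm, ← Finset.sum_add_distrib]
      congr 1
      · ring
      · exact Finset.sum_congr rfl fun j _ => by ring)
    (fun c w u => by
      simp only [explicitForm, dxi_smul, dx_smul, smul_eq_mul, mul_add, Finset.mul_sum]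
      exact congrArg₂ _ (Finset.sum_congr rfl fun i _ => by ring)
        (Finset.sum_congr rfl fun i _ => Finset.sum_congr rfl fun j _ => by ring))
    (fun w u u' => by
      simp only [explicitForm, dxi_add, dx_add, ← Finset.sum_add_distrib]
      refine Finset.sum_congr rfl fun i _ => ?_
      rw [add_add_add_comm, ← Finset.sum_add_distrib]
      congr 1
      · ring
      · exact Finset.sum_congr rfl fun j _ => by ring)
    (fun c w u => by
      simp only [explicitForm, dxi_smul, dx_smul, smul_eq_mul, mul_add, Finset.mul_sum]
      exact congrArg₂ _ (Finset.sum_congr rfl fun i _ => by ring)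
        (Finset.sum_congr rfl fun i _ => Finset.sum_congr rfl fun j _ => by ring))

variable (P) in
/-- The pairing metric on `ℙ(𝒯*) ∖ 𝒵(τ)`. -/
def pairingMetric : ProjTensor P := fun m =>
  explicitMetricBilin ⟨_, P.nonempty.some_mem⟩ (chartAt (Rn n) m.base) m

variable (P) in
/-- The pairing two-form on `ℙ(𝒯*) ∖ 𝒵(τ)`. -/
def pairingForm : ProjTensor P := fun m =>
  -explicitFormBilin ⟨_, P.nonempty.some_mem⟩ (chartAt (Rn n) m.base) m

/-- The definition uses an arbitrary connection and a chart varying with the point. This does no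
harm: the pairing identity holds for the explicit metric of any choice, and `pairing_congr` passes
to any other connection. -/
theorem isPairingMetric_pairingMetric : IsPairingMetric (pairingMetric P) := by
  intro U h0 D h₁ h₂ hh₁ hh₂ W₁ W₂
  refine (explicitMetric_kappaPush _ (IsManifold.chart_mem_maximalAtlas _)
    (by rw [kappa_base]; exact mem_chart_source _ _) h0 hh₁ hh₂ W₁ W₂).trans ?_
  rw [pairing_congr _ D h0, pairing_congr ⟨_, P.nonempty.some_mem⟩ D h0 (basePush U h₂)]

theorem isPairingForm_pairingForm : IsPairingForm (pairingForm P) := by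
  intro U h0 D h₁ h₂ hh₁ hh₂ W₁ W₂
  refine (explicitForm_kappaPush _ (IsManifold.chart_mem_maximalAtlas _)
    (by rw [kappa_base]; exact mem_chart_source _ _) h0 hh₁ hh₂ W₁ W₂).trans ?_
  rw [pairing_congr _ D h0, pairing_congr ⟨_, P.nonempty.some_mem⟩ D h0 (basePush U h₂)]

/-- Both sides satisfy the pairing identity at the point, and the vectors it speaks of exhaust the
tangent space. No direct transformation of the coordinate formula between charts is needed. -/
theorem pairingMetric_eq [T2Space N] (hn : 2 ≤ n)
    (he : e ∈ IsManifold.maximalAtlas 𝓘(ℝ, Rn n) ∞ N) (hm : m.base ∈ e.source)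
    (w₁ w₂ : TProj P m) : pairingMetric P m w₁ w₂ = explicitMetric D e m w₁ w₂ := by
  obtain ⟨U, h0, rfl⟩ := exists_eq_kappa m
  obtain ⟨h₁, W₁, hh₁, rfl⟩ := exists_eq_kappaPush hn h0 w₁
  obtain ⟨h₂, W₂, hh₂, rfl⟩ := exists_eq_kappaPush hn h0 w₂
  rw [kappa_base] at hm
  rw [isPairingMetric_pairingMetric U h0 D h₁ h₂ hh₁ hh₂,
    explicitMetric_kappaPush D he hm h0 hh₁ hh₂]

theorem pairingForm_eq [T2Space N] (hn : 2 ≤ n)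
    (he : e ∈ IsManifold.maximalAtlas 𝓘(ℝ, Rn n) ∞ N) (hm : m.base ∈ e.source)
    (w₁ w₂ : TProj P m) : pairingForm P m w₁ w₂ = -explicitForm D e m w₁ w₂ := by
  obtain ⟨U, h0, rfl⟩ := exists_eq_kappa m
  obtain ⟨h₁, W₁, hh₁, rfl⟩ := exists_eq_kappaPush hn h0 w₁
  obtain ⟨h₂, W₂, hh₂, rfl⟩ := exists_eq_kappaPush hn h0 w₂
  rw [kappa_base] at hm
  rw [isPairingForm_pairingForm U h0 D h₁ h₂ hh₁ hh₂,
    explicitForm_kappaPush D he hm h0 hh₁ hh₂]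

end Spanning

/-! ### The model metric and two-form in coordinates. -/

section ModelTensors

variable {n : ℕ} {Γ : Fin n → Fin n → Fin n → Rn n → ℝ} {S : Set (Rn n)}
  {y : Fin n ⊕ Fin n → ℝ}

/-- The components of `-(dξᵢ ∧ dxⁱ + P₍[ᵢⱼ]₎ dxⁱ ∧ dxʲ)`. -/
def symplecticCoeff (Γ : Fin n → Fin n → Fin n → Rn n → ℝ) :
    Fin n ⊕ Fin n → Fin n ⊕ Fin n → (Fin n ⊕ Fin n → ℝ) → ℝ
  | inl i, inl j => fun y => (-1 / 2) * (schoutenOf Γ i j (basePart y) - schoutenOf Γ j i (basePart y))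
  | inl i, inr j => fun _ => if i = j then 1 / 2 else 0
  | inr i, inl j => fun _ => if i = j then -1 / 2 else 0
  | inr _, inr _ => fun _ => 0

theorem contDiffOn_comp_basePart {f : Rn n → ℝ} (hf : ContDiffOn ℝ ∞ f S) :
    ContDiffOn ℝ ∞ (fun z : Fin n ⊕ Fin n → ℝ => f (basePart z)) (basePart ⁻¹' S) :=
  hf.comp contDiff_basePart.contDiffOn fun _ hz => hz

theorem contDiffOn_walkerMetric (hS : IsOpen S) (hΓ : ∀ i j k, ContDiffOn ℝ ∞ (Γ i j k) S)
    (a b : Fin n ⊕ Fin n) :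
    ContDiffOn ℝ ∞ (walkerMetric (metricCoeff Γ) a b) (basePart ⁻¹' S) := by
  have hc : ∀ a : Fin n ⊕ Fin n, ContDiffOn ℝ ∞ (fun z : Fin n ⊕ Fin n → ℝ => z a)
      (basePart ⁻¹' S) := fun a => (contDiff_apply ℝ ℝ a).contDiffOn
  rcases a with i | i <;> rcases b with j | j
  · exact (((ContDiffOn.sum fun k _ => (contDiffOn_comp_basePart (hΓ i j k)).mul
      (hc (inr k))).neg).add ((hc _).mul (hc _))).add
      (contDiffOn_comp_basePart (contDiffOn_schoutenSymm hS hΓ i j))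
  all_goals exact contDiffOn_const

theorem contDiffOn_symplecticCoeff (hS : IsOpen S) (hΓ : ∀ i j k, ContDiffOn ℝ ∞ (Γ i j k) S)
    (a b : Fin n ⊕ Fin n) : ContDiffOn ℝ ∞ (symplecticCoeff Γ a b) (basePart ⁻¹' S) := by
  rcases a with i | i <;> rcases b with j | j
  · exact contDiffOn_const.mul ((contDiffOn_comp_basePart (contDiffOn_schoutenOf hS hΓ i j)).sub
      (contDiffOn_comp_basePart (contDiffOn_schoutenOf hS hΓ j i)))
  all_goals exact contDiffOn_const

/-- Entries involving the fibre are constant and the base entries depend only on x, so only the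
component with three base indices is not trivially zero; there the skew Schouten tensor is closed.
-/
theorem symplecticCoeff_closed (hS : IsOpen S) (hΓ : ∀ i j k, ContDiffOn ℝ ∞ (Γ i j k) S)
    (hs : ∀ x ∈ S, ∀ i j k, Γ i j k x = Γ j i k x) (hy : basePart y ∈ S)
    (a b c : Fin n ⊕ Fin n) : pd a (symplecticCoeff Γ b c) y + pd b (symplecticCoeff Γ c a) y
      + pd c (symplecticCoeff Γ a b) y = 0 := by
  have hd : ∀ i j, DifferentiableAt ℝ (fun z => schoutenOf Γ i j z - schoutenOf Γ j i z)
      (basePart y) := fun i j =>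
    ((contDiffOn_schoutenOf hS hΓ i j).sub (contDiffOn_schoutenOf hS hΓ j i)).diffAt hS hy
  have h1 : ∀ a i j, pd (inl a) (symplecticCoeff Γ (inl i) (inl j)) y
      = (-1 / 2) * pd a (fun z => schoutenOf Γ i j z - schoutenOf Γ j i z) (basePart y) := by
    intro a i j
    rw [← pd_inl_comp_basePart (hd i j), ← pd_const_mul]
    · rfl
    · exact (hd i j).comp y ((contDiff_basePart.contDiffAt).differentiableAt (by simp))
  have h2 : ∀ a i j, pd (inr a) (symplecticCoeff Γ (inl i) (inl j)) y = 0 := by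
    intro a i j
    have := pd_inr_comp_basePart (hd i j) a
    have h3 := pd_const_mul (inr a) (-1 / 2)
      ((hd i j).comp y ((contDiff_basePart.contDiffAt).differentiableAt (by simp)))
    refine h3.trans ?_
    rw [show pd (inr a) ((fun z => schoutenOf Γ i j z - schoutenOf Γ j i z) ∘ basePart) y = 0
      from this, mul_zero]
  have h3 : ∀ a i j, pd a (symplecticCoeff Γ (inl i) (inr j)) y = 0 := fun a i j => pd_const a _
  have h4 : ∀ a i j, pd a (symplecticCoeff Γ (inr i) (inl j)) y = 0 := fun a i j => pd_const a _
  have h5 : ∀ a i j, pd a (symplecticCoeff Γ (inr i) (inr j)) y = 0 := fun a i j => pd_const a _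
  rcases a with i | i <;> rcases b with j | j <;> rcases c with k | k <;>
    simp only [h1, h2, h3, h4, h5, add_zero]
  linear_combination (-1 / 2) * schoutenOf_closed hS hΓ hs hy i j k

/-- The metric `walkerMetric (metricCoeff Γ)` is Einstein. -/
theorem einstein_walkerMetric (hn : 2 ≤ n) (hS : IsOpen S)
    (hΓ : ∀ i j k, ContDiffOn ℝ ∞ (Γ i j k) S) (hs : ∀ x ∈ S, ∀ i j k, Γ i j k x = Γ j i k x)
    {G : Fin n ⊕ Fin n → Fin n ⊕ Fin n → (Fin n ⊕ Fin n → ℝ) → ℝ}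
    (hG : ∀ z, basePart z ∈ S → ∀ a b, G a b z = walkerMetric (metricCoeff Γ) a b z)
    (hy : basePart y ∈ S) (a b : Fin n ⊕ Fin n) :
    ricciOf (leviCivitaOf G) a b y = 2 * ((n : ℝ) + 1) * walkerMetric (metricCoeff Γ) a b y := by
  rw [← ricciOf_walkerConnection_metricCoeff hn hS hΓ hs hy]
  -- The Ricci tensor differentiates the Christoffel symbols, which must therefore agree on a
  -- neighbourhood; at each point of it the metrics must in turn agree nearby.
  refine ricciOf_congr (fun a b c => ?_) a b
  filter_upwards [eventually_basePart_mem hS hy] with z hz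
  rw [← leviCivitaOf_walkerMetric]
  · exact leviCivitaOf_congr (fun a b => by
      filter_upwards [eventually_basePart_mem hS hz] with w hw using hG w hw a b) a b c
  · intro i j
    filter_upwards [eventually_basePart_mem hS hz] with w hw using metricCoeff_symm hs hw i j

/-- The trace of c times the identity on a space of dimension 2n. -/
theorem sum_walkerInverse_mul_walkerMetric (A : Fin n → Fin n → (Fin n ⊕ Fin n → ℝ) → ℝ)
    (y : Fin n ⊕ Fin n → ℝ) (c : ℝ) :
    ∑ a, ∑ b, walkerInverse A y a b * (c * walkerMetric A a b y) = 2 * n * c := by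
  simp [Fintype.sum_sum_type, walkerInverse, walkerMetric]
  ring

end ModelTensors

/-- With the factor ½ in the wedge and summation over all ordered pairs, the components of
Qₖₗdxᵏ∧dxˡ are exactly the skew part of Q. -/
theorem sum_mul_wedge {ι : Type*} [Fintype ι] [DecidableEq ι] (Q : ι → ι → ℝ) (i j : ι) :
    ∑ k, ∑ l, Q k l * (((if k = i then 1 else 0) * (if l = j then 1 else 0)
      - (if l = i then 1 else 0) * (if k = j then 1 else 0)) / 2) = (Q i j - Q j i) / 2 := by
  simp only [mul_div_assoc', ← Finset.sum_div, mul_sub, Finset.sum_sub_distrib]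
  congr 2
  · simp
  · simp

/-! ### Transfer to the manifold: smoothness, Einstein equation, signature, symplectic form. -/

section Components

variable {n : ℕ} {N : Type*} [TopologicalSpace N] [ChartedSpace (Rn n) N]
  [IsManifold 𝓘(ℝ, Rn n) ∞ N] {P : ProjectiveStructure n N}
  {e : OpenPartialHomeomorph N (Rn n)}

theorem exists_eq_projHomeomorph
    {φ : OpenPartialHomeomorph (ProjCotractorBundle P) (Fin n ⊕ Fin n → ℝ)}
    (h : φ ∈ atlas (Fin n ⊕ Fin n → ℝ) (ProjCotractorBundle P)) :
    ∃ (D : P.reps) (e : OpenPartialHomeomorph N (Rn n))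
      (he : e ∈ IsManifold.maximalAtlas 𝓘(ℝ, Rn n) ∞ N), φ = projHomeomorph D he := by
  obtain ⟨D, e, he, h⟩ := proj_mem_atlas h
  exact ⟨D, e, he, OpenPartialHomeomorph.toPartialEquiv_injective h⟩

theorem mfderiv_coordField_symm {ι : Type*} [Fintype ι] [DecidableEq ι] {X : Type*}
    [TopologicalSpace X] [ChartedSpace (ι → ℝ) X] [IsManifold 𝓘(ℝ, ι → ℝ) ∞ X]
    {φ : OpenPartialHomeomorph X (ι → ℝ)} (hφ : φ ∈ IsManifold.maximalAtlas 𝓘(ℝ, ι → ℝ) ∞ X)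
    {y : ι → ℝ} (hy : y ∈ φ.target) (a : ι) :
    (mfderiv 𝓘(ℝ, ι → ℝ) 𝓘(ℝ, ι → ℝ) φ (φ.symm y) (coordField φ a (φ.symm y)) : ι → ℝ)
      = Pi.single a 1 := by
  have hy2 : φ (φ.symm y) ∈ φ.target := φ.map_source (φ.map_target hy)
  have h := mfderiv_comp_apply_at (f := φ.symm) (g := φ) (x := φ (φ.symm y)) (y := φ.symm y)
    ((contMDiffAt_symm_of_mem_maximalAtlas hφ hy2).mdifferentiableAt (by simp))
    (φ.left_inv (φ.map_target hy))
    ((contMDiffAt_of_mem_maximalAtlas hφ (φ.map_target hy)).mdifferentiableAt (by simp))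
    (Pi.single a 1 : ι → ℝ)
  refine h.symm.trans ?_
  have h2 : φ ∘ φ.symm =ᶠ[nhds (φ (φ.symm y))] id := by
    filter_upwards [φ.open_target.mem_nhds hy2] with z hz using φ.right_inv hz
  rw [h2.mfderiv_eq, mfderiv_id]
  rfl

theorem mfderiv_projCoord_coordField (D : P.reps)
    (he : e ∈ IsManifold.maximalAtlas 𝓘(ℝ, Rn n) ∞ N) {y : Fin n ⊕ Fin n → ℝ}
    (hy : basePart y ∈ e.target) (a : Fin n ⊕ Fin n) :
    (mfderiv 𝓘(ℝ, Fin n ⊕ Fin n → ℝ) 𝓘(ℝ, Fin n ⊕ Fin n → ℝ) (projCoord D e)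
      ((projHomeomorph D he).symm y) (coordField (projHomeomorph D he) a
        ((projHomeomorph D he).symm y)) : Fin n ⊕ Fin n → ℝ) = Pi.single a 1 :=
  mfderiv_coordField_symm (projHomeomorph_mem_maximalAtlas D he) hy a

/-- Identifies the global metric with the model in every chart of the atlas. Symmetry of Γ enters
because the product ⊙ symmetrises the coefficients. -/
theorem component_pairingMetric [T2Space N] (hn : 2 ≤ n) (D : P.reps)
    (he : e ∈ IsManifold.maximalAtlas 𝓘(ℝ, Rn n) ∞ N) {y : Fin n ⊕ Fin n → ℝ}
    (hy : basePart y ∈ e.target) (a b : Fin n ⊕ Fin n) :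
    component (pairingMetric P) (projHomeomorph D he) a b y
      = walkerMetric (metricCoeff (christoffel D.1 e)) a b y := by
  have hb : ((projHomeomorph D he).symm y).base = e.symm (basePart y) := rfl
  have hx : ∀ a i, dx D e _ i (coordField (projHomeomorph D he) a ((projHomeomorph D he).symm y))
      = (Pi.single a (1 : ℝ) : Fin n ⊕ Fin n → ℝ) (inl i) := fun a i =>
    congrFun (mfderiv_projCoord_coordField D he hy a) (inl i)
  have hξ : ∀ a i, dxi D e _ i (coordField (projHomeomorph D he) a ((projHomeomorph D he).symm y))
      = (Pi.single a (1 : ℝ) : Fin n ⊕ Fin n → ℝ) (inr i) := fun a i =>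
    congrFun (mfderiv_projCoord_coordField D he hy a) (inr i)
  have hc : projCoord D e ((projHomeomorph D he).symm y) = y :=
    (projHomeomorph D he).right_inv hy
  have hsy := christoffel_symm D.1 he hy
  rw [component, pairingMetric_eq D _ hn he (by rw [hb]; exact e.map_target hy)]
  simp only [explicitMetric, theta, hx, hξ, hc, hb, e.right_inv hy]
  have e1 : ∀ i j, schouten D.1 e i j = schoutenOf (christoffel D.1 e) i j := fun i j => rfl
  rcases a with i | i <;> rcases b with j | j
  · simp [walkerMetric, Pi.single_apply, metricCoeff, schoutenSymm, e1, ← Finset.sum_div,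
      Finset.sum_add_distrib, hsy i j]
    ring
  · simp [walkerMetric, Pi.single_apply, ite_div, eq_comm (a := j)]
  · simp [walkerMetric, Pi.single_apply, ite_div, eq_comm]
  · simp [walkerMetric, Pi.single_apply]

theorem component_pairingForm [T2Space N] (hn : 2 ≤ n) (D : P.reps)
    (he : e ∈ IsManifold.maximalAtlas 𝓘(ℝ, Rn n) ∞ N) {y : Fin n ⊕ Fin n → ℝ}
    (hy : basePart y ∈ e.target) (a b : Fin n ⊕ Fin n) :
    component (pairingForm P) (projHomeomorph D he) a b y
      = symplecticCoeff (christoffel D.1 e) a b y := by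
  have hb : ((projHomeomorph D he).symm y).base = e.symm (basePart y) := rfl
  have hx : ∀ a i, dx D e _ i (coordField (projHomeomorph D he) a ((projHomeomorph D he).symm y))
      = (Pi.single a (1 : ℝ) : Fin n ⊕ Fin n → ℝ) (inl i) := fun a i =>
    congrFun (mfderiv_projCoord_coordField D he hy a) (inl i)
  have hξ : ∀ a i, dxi D e _ i (coordField (projHomeomorph D he) a ((projHomeomorph D he).symm y))
      = (Pi.single a (1 : ℝ) : Fin n ⊕ Fin n → ℝ) (inr i) := fun a i =>
    congrFun (mfderiv_projCoord_coordField D he hy a) (inr i)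
  rw [component, pairingForm_eq D _ hn he (by rw [hb]; exact e.map_target hy)]
  simp only [explicitForm, hx, hξ, hb, e.right_inv hy]
  have e1 : ∀ i j, schouten D.1 e i j = schoutenOf (christoffel D.1 e) i j := fun i j => rfl
  rcases a with i | i <;> rcases b with j | j
  · simp only [Pi.single_apply, Sum.inl.injEq, reduceCtorEq, if_false, mul_zero, zero_mul, sub_zero,
      zero_div, Finset.sum_const_zero, zero_add, sum_mul_wedge, symplecticCoeff, e1]
    ring
  · simp [symplecticCoeff, Pi.single_apply, ← Finset.sum_div, eq_comm (a := j)]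
    split_ifs <;> norm_num
  · simp [symplecticCoeff, Pi.single_apply, ite_div, neg_div, eq_comm (a := j)]
    split_ifs <;> norm_num
  · simp [symplecticCoeff, Pi.single_apply]

theorem isSmoothTensor_pairingMetric [T2Space N] (hn : 2 ≤ n) :
    IsSmoothTensor (pairingMetric P) := by
  intro φ hφ a b
  obtain ⟨D, e, he, rfl⟩ := exists_eq_projHomeomorph hφ
  exact (contDiffOn_walkerMetric e.open_target (christoffel_contDiffOn D.1 he) a b).congr
    fun y hy => component_pairingMetric hn D he hy a b

theorem isEinstein_pairingMetric [T2Space N] (hn : 2 ≤ n) :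
    IsEinstein (pairingMetric P) (2 * n * (2 * (n + 1))) := by
  intro φ hφ y hy
  obtain ⟨D, e, he, rfl⟩ := exists_eq_projHomeomorph hφ
  have hR : ∀ a b, metricRicci (pairingMetric P) (projHomeomorph D he) a b y = _ :=
    einstein_walkerMetric hn e.open_target (christoffel_contDiffOn D.1 he)
      (fun x hx => christoffel_symm D.1 he hx)
      (fun z hz => component_pairingMetric hn D he hz) hy
  refine ⟨?_, fun a b => ?_⟩
  · have hM : inverseMetric (pairingMetric P) (projHomeomorph D he) y
        = Matrix.of (walkerInverse (metricCoeff (christoffel D.1 e)) y) := by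
      rw [← walkerMetric_inv]
      simp only [inverseMetric, component_pairingMetric hn D he hy]
    simp only [scalarCurvature, hM, hR, Matrix.of_apply]
    exact sum_walkerInverse_mul_walkerMetric _ _ _
  · have hn' : (n : ℝ) ≠ 0 := by positivity
    rw [hR, component_pairingMetric hn D he hy]
    simp only [Fintype.card_sum, Fintype.card_fin, Nat.cast_add]
    field_simp
    ring

theorem eq_zero_of_dx_eq_zero (D : P.reps)
    (he : e ∈ IsManifold.maximalAtlas 𝓘(ℝ, Rn n) ∞ N) {m : ProjCotractorBundle P}
    (hm : m.base ∈ e.source) {w : TProj P m} (h1 : ∀ i, dx D e m i w = 0)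
    (h2 : ∀ i, dxi D e m i w = 0) : w = 0 :=
  projCoord_mfderiv_injective D he hm
    (fun i => by rw [h1, ← zero_smul ℝ (0 : TProj P m), dx_smul, zero_mul])
    fun i => by rw [h2, ← zero_smul ℝ (0 : TProj P m), dxi_smul, zero_mul]

/-- By polarisation of uv = ((u+v)/2)² - ((u-v)/2)²: the forms dxʲ and θⱼ are a coframe, and g =
θⱼ⊙dxʲ becomes diagonal in the coframe of their half sums and half differences. -/
theorem isNeutral_pairingMetric (m : ProjCotractorBundle P) : IsNeutral n (pairingMetric P m) := by
  let D : P.reps := ⟨_, P.nonempty.some_mem⟩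
  let e := chartAt (Rn n) m.base
  have he : e ∈ IsManifold.maximalAtlas 𝓘(ℝ, Rn n) ∞ N := IsManifold.chart_mem_maximalAtlas _
  have hm : m.base ∈ e.source := mem_chart_source _ _
  let f : TProj P m →ₗ[ℝ] (Fin n ⊕ Fin n → ℝ) :=
    { toFun := fun w => Sum.elim (fun j => (dx D e m j w + theta D e m j w) / 2)
        fun j => (dx D e m j w - theta D e m j w) / 2
      map_add' := fun w w' => by
        funext a
        rcases a with j | j <;> simp [dx_add, theta_add] <;> ring
      map_smul' := fun c w => by
        funext a
        rcases a with j | j <;> simp [dx_smul, theta_smul] <;> ring }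
  have hf : Function.Injective f := by
    refine (injective_iff_map_eq_zero f).2 fun w hw => ?_
    have h1 : ∀ j, (dx D e m j w + theta D e m j w) / 2 = 0 := fun j => congrFun hw (inl j)
    have h2 : ∀ j, (dx D e m j w - theta D e m j w) / 2 = 0 := fun j => congrFun hw (inr j)
    have h3 : ∀ j, dx D e m j w = 0 := fun j => by linarith [h1 j, h2 j]
    have h4 : ∀ j, theta D e m j w = 0 := fun j => by linarith [h1 j, h2 j]
    have h5 : ∀ j, dxi D e m j w = 0 := fun j => by
      simpa only [theta, h3, mul_zero, Finset.sum_const_zero, sub_zero] using h4 j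
    exact eq_zero_of_dx_eq_zero D he hm h3 h5
  have hfin : FiniteDimensional ℝ (TProj P m) :=
    inferInstanceAs (FiniteDimensional ℝ (Fin n ⊕ Fin n → ℝ))
  let F : TProj P m ≃ₗ[ℝ] (Fin n ⊕ Fin n → ℝ) := LinearEquiv.ofInjectiveOfFinrankEq f hf rfl
  have hF : ∀ w, F w = f w := fun w => rfl
  refine ⟨Module.Basis.ofEquivFun F, fun a b => ?_⟩
  have hs : ∀ a, f (Module.Basis.ofEquivFun F a) = Pi.single a 1 := fun a => by
    rw [← hF, Module.Basis.coe_ofEquivFun, LinearEquiv.apply_symm_apply]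
  have hB : ∀ w w', pairingMetric P m w w'
      = ∑ j, (f w (inl j) * f w' (inl j) - f w (inr j) * f w' (inr j)) := fun w w' => by
    have h1 : ∀ w j, f w (inl j) = (dx D e m j w + theta D e m j w) / 2 := fun _ _ => rfl
    have h2 : ∀ w j, f w (inr j) = (dx D e m j w - theta D e m j w) / 2 := fun _ _ => rfl
    -- Holds by definition, since `D` and `e` are the choices made in `pairingMetric` at this point.
    have h3 : pairingMetric P m w w' = explicitMetric D e m w w' := rfl
    rw [h3, explicitMetric]
    refine Finset.sum_congr rfl fun j _ => ?_
    rw [h1, h1, h2, h2]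
    ring
  rw [hB, hs, hs]
  rcases a with i | i <;> rcases b with j | j <;> simp [Pi.single_apply, eq_comm]
  split_ifs <;> simp

theorem exists_projCoord_mfderiv_eq (D : P.reps)
    (he : e ∈ IsManifold.maximalAtlas 𝓘(ℝ, Rn n) ∞ N) {m : ProjCotractorBundle P}
    (hm : m.base ∈ e.source) (x ξ : Fin n → ℝ) :
    ∃ w : TProj P m, (∀ i, dx D e m i w = x i) ∧ ∀ i, dxi D e m i w = ξ i := by
  have hmem := projHomeomorph_mem_maximalAtlas D he
  have h : (projHomeomorph D he).MDifferentiable 𝓘(ℝ, Fin n ⊕ Fin n → ℝ)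
      𝓘(ℝ, Fin n ⊕ Fin n → ℝ) :=
    ⟨(contMDiffOn_of_mem_maximalAtlas hmem).mdifferentiableOn (by simp),
      (contMDiffOn_symm_of_mem_maximalAtlas hmem).mdifferentiableOn (by simp)⟩
  obtain ⟨w, hw⟩ := h.mfderiv_surjective (x := m) hm (Sum.elim x ξ : Fin n ⊕ Fin n → ℝ)
  exact ⟨w, fun i => congrFun hw (inl i), fun i => congrFun hw (inr i)⟩

theorem isSymplectic_pairingForm [T2Space N] (hn : 2 ≤ n) : IsSymplectic (pairingForm P) where
  smooth φ hφ a b := by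
    obtain ⟨D, e, he, rfl⟩ := exists_eq_projHomeomorph hφ
    exact (contDiffOn_symplecticCoeff e.open_target (christoffel_contDiffOn D.1 he) a b).congr
      fun y hy => component_pairingForm hn D he hy a b
  alternating m v := by
    have : explicitForm (⟨_, P.nonempty.some_mem⟩ : P.reps) (chartAt (Rn n) m.base) m v v = 0 := by
      simp [explicitForm, mul_comm]
    change -explicitForm _ _ _ _ _ = 0
    rw [this, neg_zero]
  nondegenerate m v hv := by
    let D : P.reps := ⟨_, P.nonempty.some_mem⟩
    let e := chartAt (Rn n) m.base
    have he : e ∈ IsManifold.maximalAtlas 𝓘(ℝ, Rn n) ∞ N := IsManifold.chart_mem_maximalAtlas _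
    have hm : m.base ∈ e.source := mem_chart_source _ _
    have hv' : ∀ w, explicitForm D e m v w = 0 := fun w => neg_eq_zero.1 (hv w)
    -- Pairing with ∂/∂ξₖ isolates dxᵏ(v); once these vanish, pairing with ∂/∂xᵏ isolates dξₖ(v).
    have h1 : ∀ k, dx D e m k v = 0 := by
      intro k
      obtain ⟨w, hw1, hw2⟩ := exists_projCoord_mfderiv_eq D he hm 0 (Pi.single k 1)
      have := hv' w
      simpa [explicitForm, hw1, hw2, Pi.single_apply, ← Finset.sum_div] using this
    have h2 : ∀ k, dxi D e m k v = 0 := by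
      intro k
      obtain ⟨w, hw1, hw2⟩ := exists_projCoord_mfderiv_eq D he hm (Pi.single k 1) 0
      have := hv' w
      simpa [explicitForm, hw1, hw2, h1, Pi.single_apply, ← Finset.sum_div] using this
    exact eq_zero_of_dx_eq_zero D he hm h1 h2
  closed φ hφ y hy a b c := by
    obtain ⟨D, e, he, rfl⟩ := exists_eq_projHomeomorph hφ
    have h : ∀ a b, component (pairingForm P) (projHomeomorph D he) a b
        =ᶠ[nhds y] symplecticCoeff (christoffel D.1 e) a b := fun a b => by
      filter_upwards [(projHomeomorph D he).open_target.mem_nhds hy] with z hz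
        using component_pairingForm hn D he hz a b
    rw [pd_congr _ (h b c), pd_congr _ (h c a), pd_congr _ (h a b)]
    exact symplecticCoeff_closed e.open_target (christoffel_contDiffOn D.1 he)
      (fun x hx => christoffel_symm D.1 he hx) hy a b c

end Components

end TractorGeometry

end

theorem theorem2 {n : ℕ} (hn : 2 ≤ n) {N : Type*} [TopologicalSpace N] [T2Space N]
    [SecondCountableTopology N] [ChartedSpace (Rn n) N] [IsManifold 𝓘(ℝ, Rn n) ∞ N]
    (P : ProjectiveStructure n N) :
    ∃ g Ω : ProjTensor P,
      (IsPairingMetric g ∧ ∀ g' : ProjTensor P, IsPairingMetric g' → g' = g) ∧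
      (IsPairingForm Ω ∧ ∀ Ω' : ProjTensor P, IsPairingForm Ω' → Ω' = Ω) ∧
      IsSmoothTensor g ∧
      (∀ m, IsNeutral n (g m)) ∧
      (∃ S : ℝ, S ≠ 0 ∧ IsEinstein g S) ∧
      IsSymplectic Ω ∧
      ∀ (D : P.reps), ∀ e ∈ IsManifold.maximalAtlas 𝓘(ℝ, Rn n) ∞ N,
        ∀ m : ProjCotractorBundle P, m.base ∈ e.source → ∀ w₁ w₂ : TProj P m,
          g m w₁ w₂ = explicitMetric D e m w₁ w₂ ∧
          Ω m w₁ w₂ = -explicitForm D e m w₁ w₂ := by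
  refine ⟨pairingMetric P, pairingForm P,
    ⟨isPairingMetric_pairingMetric, fun g' hg' => hg'.eq hn isPairingMetric_pairingMetric⟩,
    ⟨isPairingForm_pairingForm, fun Ω' hΩ' => hΩ'.eq hn isPairingForm_pairingForm⟩,
    isSmoothTensor_pairingMetric hn, isNeutral_pairingMetric,
    -- The scalar curvature is the dimension 2n times the Einstein constant 2(n+1).
    ⟨2 * n * (2 * (n + 1)), by positivity, isEinstein_pairingMetric hn⟩,
    isSymplectic_pairingForm hn, fun D e he m hm w₁ w₂ =>
      ⟨pairingMetric_eq D m hn he hm w₁ w₂, pairingForm_eq D m hn he hm w₁ w₂⟩⟩
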